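/- Let $T>0$, let $\Theta\subset\mathbb{R}^p$ be compact, and for $\theta\in\Theta$, $t\in[0,T]$ let $A_\theta(t)\in\mathbb{R}^{d\times d}$; let $B\in\mathbb{R}^{d\times d_u}$, $C\in\mathbb{R}^{d'\times d}$, let $U\in\mathbb{R}^{d_u\times d_u}$ be symmetric positive definite, and $\sigma>0$. Let $\theta^*\in\Theta$, $x_0^*\in\mathbb{R}^d$, and write $X_{\theta,x_0}$ for the solution of $\dot x(t)=A_\theta(t)x(t)$, $x(0)=x_0$ on $[0,T]$; put $X^*=X_{\theta^*,x_0^*}$, $Y^*=CX^*$. For each $n\ge 1$ put $\Delta=T/n$, $t_i=i\Delta$, and observe $Y_i=CX^*(t_i)+\epsilon_i$, $0\le i\le n$, with $\epsilon_0,\dots,\epsilon_n$ i.i.d. $N(0,\sigma^2I_{d'})$. For $x_0\in\mathbb{R}^d$ and $u=(u_0,\dots,u_{n-1})$, $u_i\in\mathbb{R}^{d_u}$, let $X(t_0)=x_0$, $X(t_{i+1})=(I_d+\Delta A_\theta(t_i))X(t_i)+\Delta Bu_i$, and $$S_n^{CI}(Y;\theta)=\inf_{x_0}\inf_u\Big\{\sum_{i=0}^n\Delta\|CX(t_i)-Y_i\|_2^2+\sum_{i=0}^{n-1}\Delta\,u_i^TUu_i\Big\}.$$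 The estimator $\widehat\theta=\widehat\theta^{T,CI}$ is a measurable minimizer of $\theta\mapsto S_n^{CI}(Y;\theta)$ over $\Theta$. Let also $$S^{CI}(\theta)=d'\sigma^2+\inf_{x_0\in\mathbb{R}^d}\inf_{u\in L^2([0,T],\mathbb{R}^{d_u})}\int_0^T\big(\|CX_{\theta,x_0,u}(t)-Y^*(t)\|_2^2+u(t)^TUu(t)\big)\,dt,$$ where $\dot X_{\theta,x_0,u}=A_\theta(t)X_{\theta,x_0,u}+Bu$, $X_{\theta,x_0,u}(0)=x_0$. Assume: * (LC1) for all $\theta\in\Theta$, $t\mapsto A_\theta(t)$ is differentiable on $[0,T]$ with bounded derivative; * (LC2) $\theta\mapsto A_\theta$ is continuous from $\Theta$ to $C([0,T],\mathbb{R}^{d\times d})$ with the uniform norm; * (LC3) for all $\theta\in\Theta$, $R_\theta(0)$ is nonsingular, where $R_\theta$ is the solution on $[0,T]$ of $\dot R_\theta=-C^TC-A_\theta^TR_\theta-R_\theta A_\theta+R_\theta BU^{-1}B^TR_\theta$, $R_\theta(T)=0$; * (LC4) $\theta^*$ belongs to the interior of $\Theta$; * (LC5) if $\theta\in\Theta$,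 $x_0\in\mathbb{R}^d$ and $CX_{\theta,x_0}(t)=CX_{\theta^*,x_0^*}(t)$ for all $t\in[0,T]$, then $(\theta,x_0)=(\theta^*,x_0^*)$; * (LC6) $\theta\mapsto A_\theta$ is $C^2$ on $\Theta$ as a map into $C([0,T],\mathbb{R}^{d\times d})$; * (LC7) the Hessian matrix of $S^{CI}$ at $\theta^*$ is nonsingular. Then $\widehat\theta$ is asymptotically normal with rate $n^{-1/2}$: there is a positive definite matrix $V\in\mathbb{R}^{p\times p}$, depending only on the model, $\Theta$, $\sigma$ and $(\theta^*,x_0^*)$, such that $\sqrt n(\widehat\theta-\theta^*)$ converges in distribution to $N(0,V)$ as $n\to\infty$; moreover $\widehat\theta-\theta^*=O_p(n^{-1/2})$. -/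

import Mathlib

open MeasureTheory ProbabilityTheory Filter Topology Set
open scoped Matrix

noncomputable section

namespace TrackedLinearODE

/-- The data of a parametric linear ODE model `x' = A_θ(t) x` on `[0, T]`, with parameter
`θ ∈ ℝ^p`, state in `ℝ^d`, observation matrix `C` (observations in `ℝ^q`), control matrix `B`
(controls in `ℝ^m`) and symmetric positive definite weight matrix `U`.
Only the values `A θ t` with `t ∈ [0, T]` and `θ` in the parameter set matter. -/
structure Model (p d q m : ℕ) where
  T : ℝ
  T_pos : 0 < T
  A : EuclideanSpace ℝ (Fin p) → ℝ → Matrix (Fin d) (Fin d) ℝ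
  B : Matrix (Fin d) (Fin m) ℝ
  C : Matrix (Fin q) (Fin d) ℝ
  U : Matrix (Fin m) (Fin m) ℝ
  U_posDef : U.PosDef

variable {p d q m : ℕ} (M : Model p d q m)

namespace Model

/-- `X` solves `x' = A_θ(t) x`, `x(0) = x₀` on `[0, T]`. -/
def IsSolution (θ : EuclideanSpace ℝ (Fin p)) (x₀ : Fin d → ℝ) (X : ℝ → Fin d → ℝ) : Prop :=
  X 0 = x₀ ∧ ∀ t ∈ Icc 0 M.T, HasDerivWithinAt X (M.A θ t *ᵥ X t) (Icc 0 M.T) t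

/-! ### The discretized cost -/

/-- The mesh size `Δ = T / n`. -/
def mesh (n : ℕ) : ℝ := M.T / n

/-- The observation times `t_i = i Δ`. -/
def time (n i : ℕ) : ℝ := i * M.mesh n

/-- The controlled finite difference equation
`X(t_{i+1}) = (I + Δ A_θ(t_i)) X(t_i) + Δ B u_i`, `X(t_0) = x₀`. -/
def discreteState (n : ℕ) (θ : EuclideanSpace ℝ (Fin p)) (x₀ : Fin d → ℝ)
    (u : ℕ → Fin m → ℝ) : ℕ → Fin d → ℝ
  | 0 => x₀
  | i + 1 => (1 + M.mesh n • M.A θ (M.time n i)) *ᵥ discreteState n θ x₀ u i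
      + M.mesh n • (M.B *ᵥ u i)

/-- The discretized cost
`∑_{i=0}^n Δ ‖C X(t_i) - Y_i‖₂² + ∑_{i=0}^{n-1} Δ u_iᵀ U u_i`
(only `Y 0, …, Y n` and `u 0, …, u (n-1)` intervene). -/
def discreteCost (n : ℕ) (Y : ℕ → Fin q → ℝ) (θ : EuclideanSpace ℝ (Fin p))
    (x₀ : Fin d → ℝ) (u : ℕ → Fin m → ℝ) : ℝ :=
  ∑ i ∈ Finset.range (n + 1), M.mesh n *
      ((M.C *ᵥ M.discreteState n θ x₀ u i - Y i) ⬝ᵥ (M.C *ᵥ M.discreteState n θ x₀ u i - Y i))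
    + ∑ i ∈ Finset.range n, M.mesh n * (u i ⬝ᵥ (M.U *ᵥ u i))

/-- The discretized cost profiled on the control, `S_n(Y; θ, x₀) = inf_u C^d(Y; θ, x₀, u)`. -/
def discreteProfile (n : ℕ) (Y : ℕ → Fin q → ℝ) (θ : EuclideanSpace ℝ (Fin p))
    (x₀ : Fin d → ℝ) : ℝ :=
  ⨅ u : ℕ → Fin m → ℝ, M.discreteCost n Y θ x₀ u

/-- The discretized cost profiled on the control, then on the initial condition,
`S_n^{CI}(Y; θ) = inf_{x₀} inf_u C^d(Y; θ, x₀, u)`. -/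
def discreteProfileCI (n : ℕ) (Y : ℕ → Fin q → ℝ) (θ : EuclideanSpace ℝ (Fin p)) : ℝ :=
  ⨅ x₀ : Fin d → ℝ, M.discreteProfile n Y θ x₀

/-! ### The asymptotic cost -/

/-- `u` is a square integrable control on `[0, T]` and `X` is the corresponding (absolutely
continuous) solution of `X' = A_θ(t) X + B u`, `X(0) = x₀`. -/
def IsControlled (θ : EuclideanSpace ℝ (Fin p)) (x₀ : Fin d → ℝ) (u : ℝ → Fin m → ℝ)
    (X : ℝ → Fin d → ℝ) : Prop :=
  MemLp u 2 (volume.restrict (Icc 0 M.T)) ∧ ContinuousOn X (Icc 0 M.T) ∧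
    ∀ t ∈ Icc 0 M.T, X t = x₀ + ∫ s in (0 : ℝ)..t, (M.A θ s *ᵥ X s + M.B *ᵥ u s)

/-- The asymptotic cost of a control `u` with trajectory `X`, for the noiseless signal `Ystar` and
noise variance `σ²`: `q σ² + ∫_0^T (‖C X(t) - Ystar(t)‖₂² + u(t)ᵀ U u(t)) dt`. -/
def cost (σ : ℝ) (Ystar : ℝ → Fin q → ℝ) (u : ℝ → Fin m → ℝ) (X : ℝ → Fin d → ℝ) : ℝ :=
  q * σ ^ 2 + ∫ t in (0 : ℝ)..M.T,
    ((M.C *ᵥ X t - Ystar t) ⬝ᵥ (M.C *ᵥ X t - Ystar t) + u t ⬝ᵥ (M.U *ᵥ u t))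

/-- The asymptotic cost profiled on the control, `S(θ, x₀) = inf_u C_T(θ, x₀, u)`. -/
def profile (σ : ℝ) (Ystar : ℝ → Fin q → ℝ) (θ : EuclideanSpace ℝ (Fin p))
    (x₀ : Fin d → ℝ) : ℝ :=
  sInf {c | ∃ u X, M.IsControlled θ x₀ u X ∧ c = M.cost σ Ystar u X}

/-- The asymptotic cost profiled on the control, then on the initial condition,
`S^{CI}(θ) = inf_{x₀} inf_u C_T(θ, x₀, u)`. -/
def profileCI (σ : ℝ) (Ystar : ℝ → Fin q → ℝ) (θ : EuclideanSpace ℝ (Fin p)) : ℝ :=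
  ⨅ x₀ : Fin d → ℝ, M.profile σ Ystar θ x₀

/-- `R` solves on `[0, T]` the matrix Riccati equation
`R' = - CᵀC - A_θᵀ R - R A_θ + R B U⁻¹ Bᵀ R`, `R(T) = 0`. -/
def IsRiccatiSolution (θ : EuclideanSpace ℝ (Fin p)) (R : ℝ → Matrix (Fin d) (Fin d) ℝ) : Prop :=
  R M.T = 0 ∧ ∀ t ∈ Icc 0 M.T, ∀ i j, HasDerivWithinAt (fun s => R s i j)
    ((-(M.Cᵀ * M.C) - (M.A θ t)ᵀ * R t - R t * M.A θ t
      + R t * M.B * M.U⁻¹ * M.Bᵀ * R t) i j) (Icc 0 M.T) t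

end Model

/-- The Hessian matrix of `f : ℝ^p → ℝ` at `θ`. -/
def hessian (f : EuclideanSpace ℝ (Fin p) → ℝ) (θ : EuclideanSpace ℝ (Fin p)) :
    Matrix (Fin p) (Fin p) ℝ :=
  Matrix.of fun i j =>
    fderiv ℝ (fderiv ℝ f) θ (EuclideanSpace.single i 1) (EuclideanSpace.single j 1)

/-- The conditions on the model, the parameter set `Θ` and the true parameters `(θs, x₀s)`
with true trajectory `Xs`. -/
structure Conditions (Θ : Set (EuclideanSpace ℝ (Fin p))) (σ : ℝ)
    (θs : EuclideanSpace ℝ (Fin p)) (x₀s : Fin d → ℝ) (Xs : ℝ → Fin d → ℝ) : Prop where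
  /-- For `θ ∈ Θ`, `t ↦ A_θ(t)` is differentiable on `[0, T]` with bounded derivative. -/
  lc1 : ∀ θ ∈ Θ, ∀ i j, DifferentiableOn ℝ (fun t => M.A θ t i j) (Icc 0 M.T) ∧
    ∃ K : ℝ, ∀ t ∈ Icc 0 M.T, |derivWithin (fun s => M.A θ s i j) (Icc 0 M.T) t| ≤ K
  /-- `θ ↦ A_θ` is continuous on `Θ`, as a map into the continuous matrix functions on `[0, T]`
  with the uniform norm. -/
  lc2 : ∀ i j, ∃ F : EuclideanSpace ℝ (Fin p) → C(Icc (0 : ℝ) M.T, ℝ),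
    (∀ θ ∈ Θ, ∀ t : Icc (0 : ℝ) M.T, F θ t = M.A θ t i j) ∧ ContinuousOn F Θ
  /-- For `θ ∈ Θ`, the solution `R_θ` of the Riccati equation has `R_θ(0)` nonsingular. -/
  lc3 : ∀ θ ∈ Θ, ∃ R, M.IsRiccatiSolution θ R ∧ IsUnit (R 0)
  /-- The true parameter belongs to the interior of `Θ`. -/
  lc4 : θs ∈ interior Θ
  /-- Identifiability of the parameter and the initial condition from the noiseless signal. -/
  lc5 : ∀ θ ∈ Θ, ∀ x₀ X, M.IsSolution θ x₀ X →
    (∀ t ∈ Icc 0 M.T, M.C *ᵥ X t = M.C *ᵥ Xs t) → θ = θs ∧ x₀ = x₀s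
  /-- `θ ↦ A_θ` is `C²` on `Θ`, as a map into the continuous matrix functions on `[0, T]` with the
  uniform norm. -/
  lc6 : ∀ i j, ∃ F : EuclideanSpace ℝ (Fin p) → C(Icc (0 : ℝ) M.T, ℝ),
    (∀ θ ∈ Θ, ∀ t : Icc (0 : ℝ) M.T, F θ t = M.A θ t i j) ∧ ContDiffOn ℝ 2 F Θ
  /-- The Hessian of the asymptotic profiled cost at the true parameter is nonsingular. -/
  lc7 : IsUnit (hessian (M.profileCI σ (fun t => M.C *ᵥ Xs t)) θs)

/-- The observations `Y_i = C Xs(t_i) + ε_i` for a sample of index `n`, where `e i` is the value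
of the noise vector `ε_i`. -/
def observations (n : ℕ) (Xs : ℝ → Fin d → ℝ) (e : ℕ → EuclideanSpace ℝ (Fin q)) :
    ℕ → Fin q → ℝ :=
  fun i j => (M.C *ᵥ Xs (M.time n i)) j + e i j

/-- `Z n = O_p(r n)` as `n → ∞`: `Z n / r n` is bounded in probability. -/
def IsBigOInProbability {Ω : Type*} [MeasurableSpace Ω] (P : Measure Ω)
    (Z : ℕ → Ω → EuclideanSpace ℝ (Fin p)) (r : ℕ → ℝ) : Prop :=
  ∀ η : ℝ, 0 < η → ∃ K : ℝ, ∀ᶠ n in atTop, P.real {ω | K * r n < ‖Z n ω‖} ≤ η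

end TrackedLinearODE

end

open MeasureTheory ProbabilityTheory Filter Topology Set
open scoped Matrix

/-! Up to a term that depends on the noise alone, the discretized cost is `Model.excess`, and near
the truth this is almost a quadratic function of the parameter shift `h`, the initial value and the
control. The proof finds coordinates in which `h` decouples from the other unknowns, and then
minimizes. For each parameter direction, `Sensitivity` holds the optimal response of the
linear-quadratic problem forced by the derivative of `A` along the true trajectory. Its adjoint
state vanishes at both ends because the initial value and the final value are free; hence the pair
(sensitivity, control) is orthogonal, for the quadratic cost, to every free pair (trajectory,
control). With initial value `x₀s + S.state h 0 + ξ` and control `S.control h + u`, the excess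
becomes `hᵀ F h - 2 hᵀ s + nuisance (ξ, u)` up to a negligible error, where `F` is `fisher` and `s`
is `score` (`exists_orthogonality_bound`, `exists_remainder_bound`, `eventually_expansion`). So the
estimation error is `F⁻¹ s + o(n^{-1/2})` (`eventually_linearization`). The inputs are the
following. The matrix `F` is positive definite: along a null direction the asymptotic profiled cost
would be flat to second order, against the nonsingular Hessian (`fisher_pos`,
`eq_zero_of_isUnit_hessian`). The noise only enters through pairings with regular sequences, and
summation by parts bounds these by `noiseSize`, which is `O_p(n^{-1/2})`; on the event `noiseSize ≤
K n^{-1/2}` the analysis is deterministic. Consistency and coercivity follow by compactness from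
identifiability and from observability, the latter being a consequence of the invertibility of the
Riccati solution at time `0` (`exists_consistent`, `exists_coercive`, `eq_zero_of_unobserved`).
Finally `√n F⁻¹ s` is linear in Gaussian vectors, so its characteristic function is explicit. It
converges to that of a centred Gaussian with covariance `T σ² F⁻¹ G F⁻¹`, where `G` is `gram`, also
positive definite. -/

namespace TrackedLinearODE

/-! ### Crude bounds for matrices and dot products -/

/-- The sum of the absolute values of the entries of a matrix. -/
def entrySum {a b : ℕ} (A : Matrix (Fin a) (Fin b) ℝ) : ℝ := ∑ i, ∑ j, |A i j|

lemma entrySum_nonneg {a b : ℕ} (A : Matrix (Fin a) (Fin b) ℝ) : 0 ≤ entrySum A := by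
  unfold entrySum; positivity

lemma norm_mulVec_le {a b : ℕ} (A : Matrix (Fin a) (Fin b) ℝ) (v : Fin b → ℝ) :
    ‖A *ᵥ v‖ ≤ entrySum A * ‖v‖ := by
  refine (pi_norm_le_iff_of_nonneg (mul_nonneg (entrySum_nonneg A) (norm_nonneg v))).2 fun i => ?_
  calc ‖(A *ᵥ v) i‖ = |∑ j, A i j * v j| := rfl
    _ ≤ ∑ j, |A i j| * ‖v‖ := by
        refine (Finset.abs_sum_le_sum_abs _ _).trans (Finset.sum_le_sum fun j _ => ?_)
        rw [abs_mul]
        exact mul_le_mul_of_nonneg_left (norm_le_pi_norm v j) (abs_nonneg _)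
    _ = (∑ j, |A i j|) * ‖v‖ := by rw [Finset.sum_mul]
    _ ≤ entrySum A * ‖v‖ := by
        refine mul_le_mul_of_nonneg_right ?_ (norm_nonneg v)
        exact Finset.single_le_sum (f := fun i => ∑ j, |A i j|)
          (fun _ _ => Finset.sum_nonneg fun _ _ => abs_nonneg _) (Finset.mem_univ i)

lemma abs_dotProduct_le {a : ℕ} (v w : Fin a → ℝ) : |v ⬝ᵥ w| ≤ a * (‖v‖ * ‖w‖) := by
  calc |v ⬝ᵥ w| ≤ ∑ i, |v i * w i| := Finset.abs_sum_le_sum_abs _ _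
    _ ≤ ∑ _i : Fin a, ‖v‖ * ‖w‖ := Finset.sum_le_sum fun i _ => by
        rw [abs_mul]
        exact mul_le_mul (norm_le_pi_norm v i) (norm_le_pi_norm w i) (abs_nonneg _) (norm_nonneg _)
    _ = a * (‖v‖ * ‖w‖) := by simp

lemma sq_norm_le_dotProduct {a : ℕ} (v : Fin a → ℝ) : ‖v‖ ^ 2 ≤ v ⬝ᵥ v := by
  have h : ‖v‖ ≤ √(v ⬝ᵥ v) := by
    refine (pi_norm_le_iff_of_nonneg (Real.sqrt_nonneg _)).2 fun i => ?_
    refine Real.le_sqrt_of_sq_le ?_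
    rw [Real.norm_eq_abs, sq_abs, pow_two]
    exact Finset.single_le_sum (f := fun i => v i * v i) (fun _ _ => mul_self_nonneg _)
      (Finset.mem_univ i)
  calc ‖v‖ ^ 2 ≤ √(v ⬝ᵥ v) ^ 2 := by gcongr
    _ = v ⬝ᵥ v := Real.sq_sqrt (Finset.sum_nonneg fun _ _ => mul_self_nonneg _)

lemma dotProduct_self_nonneg' {a : ℕ} (v : Fin a → ℝ) : 0 ≤ v ⬝ᵥ v :=
  (sq_nonneg _).trans (sq_norm_le_dotProduct v)

/-! ### Derivatives and continuity of matrix-vector expressions -/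

lemma HasDerivWithinAt.matrix_mulVec {a b : ℕ} {R : ℝ → Matrix (Fin a) (Fin b) ℝ}
    {R' : Matrix (Fin a) (Fin b) ℝ} {v : ℝ → Fin b → ℝ} {v' : Fin b → ℝ} {s : Set ℝ} {t : ℝ}
    (hR : ∀ i j, HasDerivWithinAt (fun r => R r i j) (R' i j) s t)
    (hv : HasDerivWithinAt v v' s t) :
    HasDerivWithinAt (fun r => R r *ᵥ v r) (R' *ᵥ v t + R t *ᵥ v') s t := by
  rw [hasDerivWithinAt_pi] at hv ⊢
  intro i
  have h := HasDerivWithinAt.fun_sum (u := Finset.univ) fun j _ => (hR i j).mul (hv j)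
  rw [Finset.sum_add_distrib] at h
  exact h

lemma ContinuousOn.matrix_mulVec {a b : ℕ} {R : ℝ → Matrix (Fin a) (Fin b) ℝ}
    {v : ℝ → Fin b → ℝ} {s : Set ℝ} (hR : ∀ i j, ContinuousOn (fun r => R r i j) s)
    (hv : ContinuousOn v s) : ContinuousOn (fun r => R r *ᵥ v r) s := by
  rw [continuousOn_pi] at hv ⊢
  intro i
  exact continuousOn_finsetSum Finset.univ fun j _ => (hR i j).mul (hv j)

lemma ContinuousOn.const_mulVec {a b : ℕ} (A : Matrix (Fin a) (Fin b) ℝ)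
    {v : ℝ → Fin b → ℝ} {s : Set ℝ} (hv : ContinuousOn v s) :
    ContinuousOn (fun r => A *ᵥ v r) s :=
  ContinuousOn.matrix_mulVec (fun _ _ => continuousOn_const) hv

lemma ContinuousOn.dotProd {a : ℕ} {v w : ℝ → Fin a → ℝ} {s : Set ℝ}
    (hv : ContinuousOn v s) (hw : ContinuousOn w s) : ContinuousOn (fun r => v r ⬝ᵥ w r) s := by
  rw [continuousOn_pi] at hv hw
  exact continuousOn_finsetSum _ fun j _ => (hv j).mul (hw j)

lemma ContinuousOn.exists_bound {E : Type*} [SeminormedAddCommGroup E] {T : ℝ} {f : ℝ → E}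
    (hf : ContinuousOn f (Icc 0 T)) : ∃ K, 0 ≤ K ∧ ∀ t ∈ Icc 0 T, ‖f t‖ ≤ K := by
  obtain ⟨K, hK⟩ := isCompact_Icc.exists_bound_of_continuousOn hf
  exact ⟨max K 0, le_max_right _ _, fun t ht => (hK t ht).trans (le_max_left _ _)⟩

lemma exists_entrySum_bound {a b : ℕ} {T : ℝ} {R : ℝ → Matrix (Fin a) (Fin b) ℝ}
    (hR : ∀ i j, ContinuousOn (fun t => R t i j) (Icc 0 T)) :
    ∃ K, 0 ≤ K ∧ ∀ t ∈ Icc 0 T, entrySum (R t) ≤ K := by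
  have : ContinuousOn (fun t => entrySum (R t)) (Icc 0 T) :=
    continuousOn_finsetSum _ fun i _ => continuousOn_finsetSum _ fun j _ => (hR i j).abs
  obtain ⟨K, hK0, hK⟩ := ContinuousOn.exists_bound this
  exact ⟨K, hK0, fun t ht => (le_abs_self _).trans (hK t ht)⟩

/-! ### Linear differential equations on `[0, T]` -/

lemma norm_le_of_linear_ode {d : ℕ} {T K ε : ℝ} (hK : 0 < K) (hε : 0 ≤ ε) {X X' : ℝ → Fin d → ℝ}
    (hX : ∀ t ∈ Icc 0 T, HasDerivWithinAt X (X' t) (Icc 0 T) t)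
    (hb : ∀ t ∈ Icc 0 T, ‖X' t‖ ≤ K * ‖X t‖ + ε) :
    ∀ t ∈ Icc 0 T, ‖X t‖ ≤ Real.exp (K * T) * (‖X 0‖ + ε / K) := by
  intro t ht
  have hXc : ContinuousOn X (Icc 0 T) := fun t ht => (hX t ht).continuousWithinAt
  have h := norm_le_gronwallBound_of_norm_deriv_right_le (f := X) (f' := X') (δ := ‖X 0‖) (K := K)
    (ε := ε) (a := 0) (b := T) hXc (fun t ht => ((hX t ⟨ht.1, ht.2.le⟩).mono_of_mem_nhdsWithin
      (Icc_mem_nhdsGE_of_mem ht))) le_rfl (fun t ht => hb t ⟨ht.1, ht.2.le⟩) t ht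
  refine h.trans ?_
  rw [gronwallBound_of_K_ne_0 hK.ne', sub_zero]
  have h1 : Real.exp (K * t) ≤ Real.exp (K * T) :=
    Real.exp_le_exp.2 (mul_le_mul_of_nonneg_left ht.2 hK.le)
  have h2 : 0 ≤ ε / K := by positivity
  calc ‖X 0‖ * Real.exp (K * t) + ε / K * (Real.exp (K * t) - 1)
      ≤ ‖X 0‖ * Real.exp (K * t) + ε / K * Real.exp (K * t) := by gcongr; linarith
    _ = Real.exp (K * t) * (‖X 0‖ + ε / K) := by ring
    _ ≤ _ := by gcongr

/-- Picard–Lindelöf on all of `[0, T]` needs a bounded field, so the state is clamped coordinatewise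
to `[-ρ, ρ]`, with `ρ` the Gronwall bound. Clamping does not increase the norm, so the clamped
solution obeys the same bound and the clamp is never active. -/
lemma exists_linear_ode_solution {d : ℕ} {T : ℝ} (hT : 0 ≤ T) {a : ℝ → Matrix (Fin d) (Fin d) ℝ}
    (ha : ∀ i j, ContinuousOn (fun t => a t i j) (Icc 0 T)) {g : ℝ → Fin d → ℝ}
    (hg : ContinuousOn g (Icc 0 T)) (x₀ : Fin d → ℝ) :
    ∃ X : ℝ → Fin d → ℝ, X 0 = x₀ ∧
      ∀ t ∈ Icc 0 T, HasDerivWithinAt X (a t *ᵥ X t + g t) (Icc 0 T) t := by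
  obtain ⟨K₀, hK₀, hK⟩ := exists_entrySum_bound ha
  obtain ⟨G, hG₀, hG⟩ := ContinuousOn.exists_bound hg
  have hK' : 0 < K₀ + 1 := by linarith
  -- truncate the vector field outside of an a priori ball
  set ρ : ℝ := Real.exp ((K₀ + 1) * T) * (‖x₀‖ + G / (K₀ + 1)) with hρ
  have hρ0 : 0 ≤ ρ := by positivity
  have hρle : -ρ ≤ ρ := by linarith
  let φ : (Fin d → ℝ) → Fin d → ℝ := fun x i => (projIcc (-ρ) ρ hρle (x i) : ℝ)
  have hφlip : ∀ x y, ‖φ x - φ y‖ ≤ ‖x - y‖ := fun x y => by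
    refine (pi_norm_le_iff_of_nonneg (norm_nonneg _)).2 fun i => ?_
    refine le_trans ?_ (norm_le_pi_norm (x - y) i)
    have := (LipschitzWith.projIcc hρle).dist_le_mul (x i) (y i)
    simpa [Subtype.dist_eq, Real.dist_eq, φ] using this
  have hφ0 : φ 0 = 0 := by
    ext i
    have : (0 : ℝ) ∈ Icc (-ρ) ρ := ⟨by linarith, hρ0⟩
    simp [φ, projIcc_of_mem hρle this]
  have hφle : ∀ x, ‖φ x‖ ≤ ‖x‖ := fun x => by simpa [hφ0] using hφlip x 0
  have hφb : ∀ x, ‖φ x‖ ≤ ρ := fun x => by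
    refine (pi_norm_le_iff_of_nonneg hρ0).2 fun i => ?_
    rw [Real.norm_eq_abs, abs_le]
    exact (projIcc (-ρ) ρ hρle (x i)).2
  have hφid : ∀ x, ‖x‖ ≤ ρ → φ x = x := fun x hx => by
    ext i
    have : x i ∈ Icc (-ρ) ρ := abs_le.1 ((norm_le_pi_norm x i).trans hx)
    simp [φ, projIcc_of_mem hρle this]
  have hL0 : 0 ≤ K₀ * ρ + G := by positivity
  have hpl : IsPicardLindelof (fun t x => a t *ᵥ φ x + g t) (tmin := 0) (tmax := T)
      ⟨0, left_mem_Icc.2 hT⟩ x₀ ⟨(K₀ * ρ + G) * T, by positivity⟩ 0 ⟨K₀ * ρ + G, hL0⟩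
      ⟨K₀, hK₀⟩ := by
    refine ⟨fun t ht => ?_, fun x _ => ?_, fun t ht x _ => ?_, ?_⟩
    · refine LipschitzOnWith.of_dist_le_mul fun x _ y _ => ?_
      rw [dist_eq_norm, dist_eq_norm]
      have : a t *ᵥ φ x + g t - (a t *ᵥ φ y + g t) = a t *ᵥ (φ x - φ y) := by
        rw [Matrix.mulVec_sub]; abel
      rw [this]
      exact (norm_mulVec_le _ _).trans (mul_le_mul (hK t ht) (hφlip x y) (norm_nonneg _) hK₀)
    · exact (ContinuousOn.matrix_mulVec ha continuousOn_const).add hg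
    · refine (norm_add_le _ _).trans (add_le_add ?_ (hG t ht))
      exact (norm_mulVec_le _ _).trans (mul_le_mul (hK t ht) (hφb x) (norm_nonneg _) hK₀)
    · simp only [sub_zero, sub_self, max_eq_left hT, NNReal.coe_zero]
      exact le_rfl
  obtain ⟨X, hX0, hX⟩ := hpl.exists_eq_forall_mem_Icc_hasDerivWithinAt₀
  refine ⟨X, hX0, fun t ht => ?_⟩
  have hb := norm_le_of_linear_ode hK' hG₀ hX (fun t ht => by
    refine (norm_add_le _ _).trans (add_le_add ?_ (hG t ht))
    refine (norm_mulVec_le _ _).trans (mul_le_mul ((hK t ht).trans ?_) (hφle _) (norm_nonneg _)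
      hK'.le)
    linarith) t ht
  have hX0' : X 0 = x₀ := hX0
  rw [hX0'] at hb
  have := hX t ht
  rwa [hφid _ hb] at this

lemma hasDerivWithinAt_reverse {E : Type*} [NormedAddCommGroup E] [NormedSpace ℝ E] {T : ℝ}
    {X : ℝ → E} {X' : E} {t : ℝ} (hX : HasDerivWithinAt X X' (Icc 0 T) (T - t)) :
    HasDerivWithinAt (fun s => X (T - s)) (-X') (Icc 0 T) t := by
  have h := HasDerivWithinAt.scomp t hX (((hasDerivAt_id t).const_sub T).hasDerivWithinAt
    (s := Icc 0 T)) (fun s hs => ⟨by simpa using hs.2, by simpa using hs.1⟩)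
  simpa [Function.comp_def] using h

lemma exists_linear_ode_solution_backward {d : ℕ} {T : ℝ} (hT : 0 ≤ T)
    {a : ℝ → Matrix (Fin d) (Fin d) ℝ}
    (ha : ∀ i j, ContinuousOn (fun t => a t i j) (Icc 0 T)) {g : ℝ → Fin d → ℝ}
    (hg : ContinuousOn g (Icc 0 T)) (x₁ : Fin d → ℝ) :
    ∃ X : ℝ → Fin d → ℝ, X T = x₁ ∧
      ∀ t ∈ Icc 0 T, HasDerivWithinAt X (a t *ᵥ X t + g t) (Icc 0 T) t := by
  have hm : MapsTo (fun t => T - t) (Icc 0 T) (Icc 0 T) :=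
    fun s hs => ⟨by simpa using hs.2, by simpa using hs.1⟩
  have hc : ContinuousOn (fun t => T - t) (Icc 0 T) := by fun_prop
  obtain ⟨X, hX0, hX⟩ := exists_linear_ode_solution hT (a := fun t => -a (T - t))
    (g := fun t => -g (T - t)) (fun i j => ((ha i j).comp hc hm).neg) (hg.comp hc hm).neg x₁
  refine ⟨fun t => X (T - t), by simpa using hX0, fun t ht => ?_⟩
  have := hasDerivWithinAt_reverse (hX (T - t) (hm ht))
  simpa [Matrix.neg_mulVec, neg_add, add_comm] using this

lemma linear_ode_eq_zero_backward {d : ℕ} {T : ℝ} {a : ℝ → Matrix (Fin d) (Fin d) ℝ}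
    (ha : ∀ i j, ContinuousOn (fun t => a t i j) (Icc 0 T)) {X : ℝ → Fin d → ℝ}
    (hX : ∀ t ∈ Icc 0 T, HasDerivWithinAt X (a t *ᵥ X t) (Icc 0 T) t) (hT : X T = 0) :
    ∀ t ∈ Icc 0 T, X t = 0 := by
  have hm : MapsTo (fun t => T - t) (Icc 0 T) (Icc 0 T) :=
    fun s hs => ⟨by simpa using hs.2, by simpa using hs.1⟩
  obtain ⟨K, hK₀, hK⟩ := exists_entrySum_bound ha
  have hY : ∀ t ∈ Icc 0 T, HasDerivWithinAt (fun s => X (T - s)) (-(a (T - t) *ᵥ X (T - t)))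
      (Icc 0 T) t := fun t ht => hasDerivWithinAt_reverse (hX _ (hm ht))
  have h := eq_zero_of_abs_deriv_le_mul_abs_self_of_eq_zero_right (K := K)
    (fun t ht => (hY t ht).continuousWithinAt)
    (fun t ht => (hY t ⟨ht.1, ht.2.le⟩).mono_of_mem_nhdsWithin (Icc_mem_nhdsGE_of_mem ht))
    (by simpa using hT) (fun t ht => by
      rw [norm_neg]
      exact (norm_mulVec_le _ _).trans
        (mul_le_mul_of_nonneg_right (hK _ (hm ⟨ht.1, ht.2.le⟩)) (norm_nonneg _)))
  intro t ht
  simpa using h (T - t) (hm ht)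

end TrackedLinearODE

namespace TrackedLinearODE

/-! ### The time grid -/

namespace Model

variable {p d q m : ℕ} (M : Model p d q m)

lemma mesh_nonneg (n : ℕ) : 0 ≤ M.mesh n := div_nonneg M.T_pos.le n.cast_nonneg

lemma mesh_pos {n : ℕ} (hn : 0 < n) : 0 < M.mesh n := div_pos M.T_pos (Nat.cast_pos.2 hn)

lemma natCast_mul_mesh {n : ℕ} (hn : 0 < n) : (n : ℝ) * M.mesh n = M.T := by
  have : (n : ℝ) ≠ 0 := by positivity
  unfold mesh; field_simp

lemma natCast_mul_mesh_le (n : ℕ) : (n : ℝ) * M.mesh n ≤ M.T := by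
  rcases n.eq_zero_or_pos with rfl | hn
  · simpa using M.T_pos.le
  · exact (M.natCast_mul_mesh hn).le

lemma time_zero (n : ℕ) : M.time n 0 = 0 := by simp [time]

lemma time_succ (n i : ℕ) : M.time n (i + 1) = M.time n i + M.mesh n := by
  simp [time]; ring

lemma time_last {n : ℕ} (hn : 0 < n) : M.time n n = M.T := M.natCast_mul_mesh hn

lemma time_mem (n : ℕ) {i : ℕ} (hi : i ≤ n) : M.time n i ∈ Icc 0 M.T := by
  refine ⟨mul_nonneg i.cast_nonneg (M.mesh_nonneg n), le_trans ?_ (M.natCast_mul_mesh_le n)⟩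
  exact mul_le_mul_of_nonneg_right (Nat.cast_le.2 hi) (M.mesh_nonneg n)

lemma tendsto_mesh : Tendsto M.mesh atTop (𝓝 0) :=
  tendsto_const_div_atTop_nhds_zero_nat M.T

lemma sum_mesh_le (n : ℕ) (c : ℝ) (hc : 0 ≤ c) : ∑ _i ∈ Finset.range n, M.mesh n * c ≤ M.T * c := by
  rw [Finset.sum_const, Finset.card_range, nsmul_eq_mul, ← mul_assoc]
  exact mul_le_mul_of_nonneg_right (M.natCast_mul_mesh_le n) hc

/-! ### Consistency of the explicit Euler scheme and of Riemann sums -/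

end Model

lemma norm_taylor_le {E : Type*} [NormedAddCommGroup E] [NormedSpace ℝ E] {T ε s t : ℝ}
    {X X' : ℝ → E} (hX : ∀ r ∈ Icc 0 T, HasDerivWithinAt X (X' r) (Icc 0 T) r)
    (hs : 0 ≤ s) (hst : s ≤ t) (ht : t ≤ T) (hb : ∀ r ∈ Icc s t, ‖X' r - X' s‖ ≤ ε) :
    ‖X t - X s - (t - s) • X' s‖ ≤ ε * (t - s) := by
  have hsub : Icc s t ⊆ Icc 0 T := Icc_subset_Icc hs ht
  have hY : ∀ r ∈ Icc s t, HasDerivWithinAt (fun r => X r - (r - s) • X' s) (X' r - X' s)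
      (Icc s t) r := fun r hr => by
    have h2 : HasDerivWithinAt (fun r : ℝ => (r - s) • X' s) ((1 : ℝ) • X' s) (Icc s t) r :=
      ((hasDerivAt_id r).sub_const s).hasDerivWithinAt.smul_const (X' s)
    rw [one_smul] at h2
    exact ((hX r (hsub hr)).mono hsub).sub h2
  have h := (convex_Icc s t).norm_image_sub_le_of_norm_hasDerivWithin_le hY hb
    (left_mem_Icc.2 hst) (right_mem_Icc.2 hst)
  rw [Real.norm_of_nonneg (sub_nonneg.2 hst)] at h
  convert h using 2
  simp
  abel

namespace Model

variable {p d q m : ℕ} (M : Model p d q m)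

lemma eventually_euler_consistent {E : Type*} [NormedAddCommGroup E] [NormedSpace ℝ E]
    {X X' : ℝ → E} (hX : ∀ r ∈ Icc 0 M.T, HasDerivWithinAt X (X' r) (Icc 0 M.T) r)
    (hX' : ContinuousOn X' (Icc 0 M.T)) {ε : ℝ} (hε : 0 < ε) :
    ∀ᶠ n in atTop, ∀ i < n,
      ‖X (M.time n (i + 1)) - X (M.time n i) - M.mesh n • X' (M.time n i)‖ ≤ M.mesh n * ε := by
  have huc := isCompact_Icc.uniformContinuousOn_of_continuous hX'
  rw [Metric.uniformContinuousOn_iff_le] at huc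
  obtain ⟨η, hη, huc⟩ := huc ε hε
  filter_upwards [M.tendsto_mesh.eventually_le_const hη] with n hn i hi
  have h1 := M.time_mem n hi.le
  have h2 := M.time_mem n (Nat.succ_le_of_lt hi)
  have h12 : M.time n i ≤ M.time n (i + 1) := by
    rw [M.time_succ]; linarith [M.mesh_nonneg n]
  have h := norm_taylor_le hX h1.1 h12 h2.2 (fun r hr => by
    rw [← dist_eq_norm]
    refine huc r ⟨h1.1.trans hr.1, hr.2.trans h2.2⟩ _ h1 ?_
    rw [M.time_succ] at hr
    rw [Real.dist_eq, abs_of_nonneg (sub_nonneg.2 hr.1)]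
    linarith [hr.2])
  rw [M.time_succ, add_sub_cancel_left] at h
  rw [M.time_succ]
  linarith

/-- A Lipschitz derivative gives a defect of order `mesh ^ 2`. This rate is needed for the true
trajectory, whose Euler bias must be negligible against `n^{-1/2}`; curves multiplied by a small `h`
only need the rate-free version above. -/
lemma euler_consistent_of_lipschitz {E : Type*} [NormedAddCommGroup E] [NormedSpace ℝ E]
    {X X' : ℝ → E} (hX : ∀ r ∈ Icc 0 M.T, HasDerivWithinAt X (X' r) (Icc 0 M.T) r) {L : ℝ}
    (hL : 0 ≤ L)
    (hX' : ∀ r ∈ Icc 0 M.T, ∀ s ∈ Icc 0 M.T, ‖X' r - X' s‖ ≤ L * |r - s|) (n : ℕ) :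
    ∀ i < n, ‖X (M.time n (i + 1)) - X (M.time n i) - M.mesh n • X' (M.time n i)‖
      ≤ M.mesh n * (L * M.mesh n) := by
  intro i hi
  have h1 := M.time_mem n hi.le
  have h2 := M.time_mem n (Nat.succ_le_of_lt hi)
  have h12 : M.time n i ≤ M.time n (i + 1) := by
    rw [M.time_succ]; linarith [M.mesh_nonneg n]
  have h := norm_taylor_le (ε := L * M.mesh n) hX h1.1 h12 h2.2 (fun r hr => by
    refine (hX' r ⟨h1.1.trans hr.1, hr.2.trans h2.2⟩ _ h1).trans ?_
    rw [M.time_succ] at hr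
    rw [abs_of_nonneg (sub_nonneg.2 hr.1)]
    exact mul_le_mul_of_nonneg_left (by linarith [hr.2]) hL)
  rw [M.time_succ, add_sub_cancel_left] at h
  rw [M.time_succ]
  linarith

/-- The Riemann sum is the Euler scheme of a primitive of `φ`. The integrand is extended
continuously to `ℝ` so that the primitive is differentiable at the end points too. -/
lemma tendsto_riemann_sum {φ : ℝ → ℝ} (hφ : ContinuousOn φ (Icc 0 M.T)) :
    Tendsto (fun n => ∑ i ∈ Finset.range n, M.mesh n * φ (M.time n i)) atTop
      (𝓝 (∫ t in (0 : ℝ)..M.T, φ t)) := by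
  have hT := M.T_pos
  set ψ : ℝ → ℝ := IccExtend hT.le ((Icc 0 M.T).domRestrict φ) with hψ
  have hψc : Continuous ψ := (continuousOn_iff_continuous_domRestrict.1 hφ).Icc_extend'
  have hψφ : ∀ t ∈ Icc 0 M.T, ψ t = φ t := fun t ht => by
    simp [hψ, IccExtend_of_mem hT.le _ ht, domRestrict_apply]
  have hint : ∫ t in (0 : ℝ)..M.T, φ t = ∫ t in (0 : ℝ)..M.T, ψ t := by
    refine intervalIntegral.integral_congr fun t ht => ?_
    rw [uIcc_of_le hT.le] at ht
    exact (hψφ t ht).symm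
  rw [hint]
  set Φ : ℝ → ℝ := fun t => ∫ s in (0 : ℝ)..t, ψ s with hΦ
  have hΦd : ∀ r ∈ Icc 0 M.T, HasDerivWithinAt Φ (ψ r) (Icc 0 M.T) r := fun r _ =>
    (hψc.integral_hasStrictDerivAt 0 r).hasDerivAt.hasDerivWithinAt
  rw [Metric.tendsto_nhds]
  intro ε hε
  have hε' : 0 < ε / (2 * M.T) := by positivity
  filter_upwards [M.eventually_euler_consistent hΦd hψc.continuousOn hε', eventually_gt_atTop 0]
    with n hn hn0
  have htel : Φ M.T = ∑ i ∈ Finset.range n, (Φ (M.time n (i + 1)) - Φ (M.time n i)) := by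
    rw [Finset.sum_range_sub (fun i => Φ (M.time n i)), M.time_last hn0, M.time_zero]
    simp [hΦ]
  have h0 : ∑ i ∈ Finset.range n, M.mesh n * φ (M.time n i) - Φ M.T
      = - ∑ i ∈ Finset.range n, (Φ (M.time n (i + 1)) - Φ (M.time n i)
          - M.mesh n • ψ (M.time n i)) := by
    rw [htel, ← Finset.sum_sub_distrib, ← Finset.sum_neg_distrib]
    refine Finset.sum_congr rfl fun i hi => ?_
    rw [hψφ _ (M.time_mem n (Finset.mem_range.1 hi).le), smul_eq_mul]
    ring
  change dist _ (Φ M.T) < ε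
  rw [Real.dist_eq, h0, abs_neg]
  calc _ ≤ ∑ i ∈ Finset.range n, M.mesh n * (ε / (2 * M.T)) :=
        (Finset.abs_sum_le_sum_abs _ _).trans
          (Finset.sum_le_sum fun i hi => hn i (Finset.mem_range.1 hi))
    _ ≤ M.T * (ε / (2 * M.T)) := M.sum_mesh_le n _ hε'.le
    _ = ε / 2 := by field_simp
    _ < ε := by linarith

lemma tendsto_riemann_sum_succ {φ : ℝ → ℝ} (hφ : ContinuousOn φ (Icc 0 M.T)) :
    Tendsto (fun n => ∑ i ∈ Finset.range (n + 1), M.mesh n * φ (M.time n i)) atTop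
      (𝓝 (∫ t in (0 : ℝ)..M.T, φ t)) := by
  have h1 : Tendsto (fun n => M.mesh n * φ (M.time n n)) atTop (𝓝 0) := by
    have : Tendsto (fun n => M.mesh n * φ M.T) atTop (𝓝 (0 * φ M.T)) :=
      M.tendsto_mesh.mul_const _
    rw [zero_mul] at this
    refine this.congr' ?_
    filter_upwards [eventually_gt_atTop 0] with n hn
    rw [M.time_last hn]
  have := (M.tendsto_riemann_sum hφ).add h1
  rw [add_zero] at this
  refine this.congr fun n => ?_
  rw [Finset.sum_range_succ]

/-! ### The discrete Gronwall bound -/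

end Model

lemma norm_le_of_discrete_linear {d n : ℕ} {δ K : ℝ} (hδ : 0 ≤ δ) (hK : 0 ≤ K)
    {a : ℕ → Matrix (Fin d) (Fin d) ℝ} {x f : ℕ → Fin d → ℝ}
    (hx : ∀ i < n, x (i + 1) = x i + δ • (a i *ᵥ x i + f i)) (ha : ∀ i < n, entrySum (a i) ≤ K) :
    ∀ i ≤ n, ‖x i‖ ≤ Real.exp (K * (n * δ)) * (‖x 0‖ + ∑ j ∈ Finset.range n, δ * ‖f j‖) := by
  have key : ∀ i ≤ n, ‖x i‖ ≤
      Real.exp (K * (i * δ)) * (‖x 0‖ + ∑ j ∈ Finset.range i, δ * ‖f j‖) := by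
    intro i
    induction i with
    | zero => intro _; simp
    | succ i ih =>
      intro hi
      have ih' := ih (by omega)
      have hS : 0 ≤ ‖x 0‖ + ∑ j ∈ Finset.range i, δ * ‖f j‖ := by positivity
      have hexp : 1 + δ * K ≤ Real.exp (K * δ) := by
        have := Real.add_one_le_exp (K * δ); linarith
      have h1 : (1 : ℝ) ≤ Real.exp (K * ((i + 1 : ℕ) * δ)) := Real.one_le_exp (by positivity)
      calc ‖x (i + 1)‖ ≤ ‖x i‖ + δ * (K * ‖x i‖ + ‖f i‖) := by
            rw [hx i hi]
            refine (norm_add_le _ _).trans (add_le_add le_rfl ?_)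
            rw [norm_smul, Real.norm_of_nonneg hδ]
            refine mul_le_mul_of_nonneg_left ((norm_add_le _ _).trans (add_le_add ?_ le_rfl)) hδ
            exact (norm_mulVec_le _ _).trans
              (mul_le_mul_of_nonneg_right (ha i hi) (norm_nonneg _))
        _ = (1 + δ * K) * ‖x i‖ + δ * ‖f i‖ := by ring
        _ ≤ Real.exp (K * δ) * (Real.exp (K * (i * δ)) *
              (‖x 0‖ + ∑ j ∈ Finset.range i, δ * ‖f j‖)) + δ * ‖f i‖ := by gcongr
        _ = Real.exp (K * ((i + 1 : ℕ) * δ)) * (‖x 0‖ + ∑ j ∈ Finset.range i, δ * ‖f j‖)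
              + δ * ‖f i‖ := by
            rw [← mul_assoc, ← Real.exp_add]; push_cast; ring_nf
        _ ≤ Real.exp (K * ((i + 1 : ℕ) * δ)) * (‖x 0‖ + ∑ j ∈ Finset.range i, δ * ‖f j‖)
              + Real.exp (K * ((i + 1 : ℕ) * δ)) * (δ * ‖f i‖) := by
            exact add_le_add le_rfl (le_mul_of_one_le_left (by positivity) h1)
        _ = _ := by rw [Finset.sum_range_succ]; ring
  intro i hi
  refine (key i hi).trans ?_
  gcongr

namespace Model

variable {p d q m : ℕ} (M : Model p d q m)

/-! ### Discrete square norms and summation by parts -/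

/-- The discrete `L²` norm of `u 0, …, u (n - 1)`. -/
noncomputable def l2 {a : ℕ} (n : ℕ) (u : ℕ → Fin a → ℝ) : ℝ :=
  √(∑ i ∈ Finset.range n, M.mesh n * ‖u i‖ ^ 2)

/-- The cumulated noise `Δ ∑_{j ≤ i} e_j`. -/
noncomputable def noisePath (n : ℕ) (e : ℕ → Fin q → ℝ) (i : ℕ) : Fin q → ℝ :=
  M.mesh n • ∑ j ∈ Finset.range (i + 1), e j

/-- The size of the cumulated noise: `L²` norm and terminal value. -/
noncomputable def noiseSize (n : ℕ) (e : ℕ → Fin q → ℝ) : ℝ :=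
  √(‖M.noisePath n e n‖ ^ 2 + ∑ i ∈ Finset.range n, M.mesh n * ‖M.noisePath n e i‖ ^ 2)

/-- The pairing `Δ ∑_{i ≤ n} x_i ⬝ y_i`. -/
noncomputable def pair (n : ℕ) (x y : ℕ → Fin q → ℝ) : ℝ :=
  ∑ i ∈ Finset.range (n + 1), M.mesh n * (x i ⬝ᵥ y i)

lemma l2_nonneg {a : ℕ} (n : ℕ) (u : ℕ → Fin a → ℝ) : 0 ≤ M.l2 n u := Real.sqrt_nonneg _

lemma noiseSize_nonneg (n : ℕ) (e : ℕ → Fin q → ℝ) : 0 ≤ M.noiseSize n e := Real.sqrt_nonneg _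

lemma sq_l2 {a : ℕ} (n : ℕ) (u : ℕ → Fin a → ℝ) :
    M.l2 n u ^ 2 = ∑ i ∈ Finset.range n, M.mesh n * ‖u i‖ ^ 2 :=
  Real.sq_sqrt (Finset.sum_nonneg fun _ _ => mul_nonneg (M.mesh_nonneg n) (sq_nonneg _))

lemma sum_mesh_mul_mul_le (n : ℕ) (f g : ℕ → ℝ) :
    ∑ i ∈ Finset.range n, M.mesh n * (f i * g i) ≤
      √(∑ i ∈ Finset.range n, M.mesh n * f i ^ 2) *
        √(∑ i ∈ Finset.range n, M.mesh n * g i ^ 2) := by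
  have h := Real.sum_mul_le_sqrt_mul_sqrt (Finset.range n) (fun i => √(M.mesh n) * f i)
    (fun i => √(M.mesh n) * g i)
  have hs := Real.mul_self_sqrt (M.mesh_nonneg n)
  have hs2 := Real.sq_sqrt (M.mesh_nonneg n)
  simp only [mul_pow, hs2] at h
  refine le_trans (le_of_eq (Finset.sum_congr rfl fun i _ => ?_)) h
  linear_combination (-(f i * g i)) * hs

lemma sum_mesh_mul_norm_le {a : ℕ} (n : ℕ) (u : ℕ → Fin a → ℝ) :
    ∑ i ∈ Finset.range n, M.mesh n * ‖u i‖ ≤ √M.T * M.l2 n u := by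
  have h := M.sum_mesh_mul_mul_le n (fun _ => 1) (fun i => ‖u i‖)
  simp only [one_mul] at h
  refine h.trans (mul_le_mul_of_nonneg_right (Real.sqrt_le_sqrt ?_) (Real.sqrt_nonneg _))
  have := M.sum_mesh_le n 1 zero_le_one
  simpa using this

lemma l2_noisePath_le (n : ℕ) (e : ℕ → Fin q → ℝ) :
    M.l2 n (M.noisePath n e) ≤ M.noiseSize n e :=
  Real.sqrt_le_sqrt (le_add_of_nonneg_left (sq_nonneg _))

lemma norm_noisePath_last_le (n : ℕ) (e : ℕ → Fin q → ℝ) :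
    ‖M.noisePath n e n‖ ≤ M.noiseSize n e :=
  Real.le_sqrt_of_sq_le (le_add_of_nonneg_right
    (Finset.sum_nonneg fun _ _ => mul_nonneg (M.mesh_nonneg n) (sq_nonneg _)))

/-- Abel summation trades the noise, of size `1`, for its cumulated path, of size `n^{-1/2}`, at the
price of differencing the other factor. -/
lemma sum_by_parts (n k : ℕ) (x e : ℕ → Fin q → ℝ) :
    ∑ i ∈ Finset.range (k + 1), M.mesh n * (x i ⬝ᵥ e i) = x k ⬝ᵥ M.noisePath n e k
      - ∑ i ∈ Finset.range k, (x (i + 1) - x i) ⬝ᵥ M.noisePath n e i := by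
  induction k with
  | zero => simp [noisePath, dotProduct_smul]
  | succ k ih =>
    rw [Finset.sum_range_succ, ih, Finset.sum_range_succ _ k]
    have : M.noisePath n e (k + 1) = M.noisePath n e k + M.mesh n • e (k + 1) := by
      simp [noisePath, Finset.sum_range_succ _ (k + 1), smul_add]
    rw [this, dotProduct_add, dotProduct_smul, sub_dotProduct, smul_eq_mul]
    ring

/-- After Abel summation only the last value and the increments of `x` meet the noise path. The term
`b₂ * ‖u i‖` admits states driven by controls that are bounded in discrete `L²` only; Cauchy–Schwarz
handles it. -/
lemma abs_pair_noise_le {a : ℕ} (n : ℕ) (x e : ℕ → Fin q → ℝ) (u : ℕ → Fin a → ℝ) {b₀ b₁ b₂ : ℝ}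
    (hb₁ : 0 ≤ b₁) (hb₂ : 0 ≤ b₂) (h₀ : ‖x n‖ ≤ b₀)
    (hx : ∀ i < n, ‖x (i + 1) - x i‖ ≤ M.mesh n * (b₁ + b₂ * ‖u i‖)) :
    |M.pair n x e| ≤ q * ((b₀ + b₁ * √M.T + b₂ * M.l2 n u) * M.noiseSize n e) := by
  have hq : (0 : ℝ) ≤ q := q.cast_nonneg
  have hN := M.noiseSize_nonneg n e
  unfold pair
  rw [M.sum_by_parts n n]
  have h1 : |x n ⬝ᵥ M.noisePath n e n| ≤ q * (b₀ * M.noiseSize n e) := by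
    refine (abs_dotProduct_le _ _).trans (mul_le_mul_of_nonneg_left ?_ hq)
    exact mul_le_mul h₀ (M.norm_noisePath_last_le n e) (norm_nonneg _) ((norm_nonneg _).trans h₀)
  have h2 : |∑ i ∈ Finset.range n, (x (i + 1) - x i) ⬝ᵥ M.noisePath n e i| ≤
      q * ((b₁ * √M.T + b₂ * M.l2 n u) * M.noiseSize n e) := by
    calc _ ≤ ∑ i ∈ Finset.range n, q * (b₁ * (M.mesh n * ‖M.noisePath n e i‖)
          + b₂ * (M.mesh n * (‖u i‖ * ‖M.noisePath n e i‖))) := by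
          refine (Finset.abs_sum_le_sum_abs _ _).trans (Finset.sum_le_sum fun i hi => ?_)
          refine (abs_dotProduct_le _ _).trans (mul_le_mul_of_nonneg_left ?_ hq)
          refine (mul_le_mul_of_nonneg_right (hx i (Finset.mem_range.1 hi))
            (norm_nonneg _)).trans (le_of_eq ?_)
          ring
      _ = q * (b₁ * ∑ i ∈ Finset.range n, M.mesh n * ‖M.noisePath n e i‖
          + b₂ * ∑ i ∈ Finset.range n, M.mesh n * (‖u i‖ * ‖M.noisePath n e i‖)) := by
          rw [← Finset.mul_sum, Finset.sum_add_distrib, Finset.mul_sum, Finset.mul_sum]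
      _ ≤ q * (b₁ * (√M.T * M.noiseSize n e) + b₂ * (M.l2 n u * M.noiseSize n e)) := by
          have h3 := (M.sum_mesh_mul_norm_le n (M.noisePath n e)).trans
            (mul_le_mul_of_nonneg_left (M.l2_noisePath_le n e) (Real.sqrt_nonneg _))
          have h4 := (M.sum_mesh_mul_mul_le n (fun i => ‖u i‖)
            (fun i => ‖M.noisePath n e i‖)).trans
            (mul_le_mul_of_nonneg_left (M.l2_noisePath_le n e) (M.l2_nonneg n u))
          unfold l2 at *
          gcongr
      _ = _ := by ring
  calc _ ≤ q * (b₀ * M.noiseSize n e) + q * ((b₁ * √M.T + b₂ * M.l2 n u) * M.noiseSize n e) :=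
        (abs_sub _ _).trans (add_le_add h1 h2)
    _ = _ := by ring

end Model

end TrackedLinearODE

namespace TrackedLinearODE

variable {p d q m : ℕ} {M : Model p d q m} {Θ : Set (EuclideanSpace ℝ (Fin p))} {σ : ℝ}
  {θs : EuclideanSpace ℝ (Fin p)} {x₀s : Fin d → ℝ} {Xs : ℝ → Fin d → ℝ}

lemma entrySum_add_le {a b : ℕ} (A B : Matrix (Fin a) (Fin b) ℝ) :
    entrySum (A + B) ≤ entrySum A + entrySum B := by
  unfold entrySum
  rw [← Finset.sum_add_distrib]
  refine Finset.sum_le_sum fun i _ => ?_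
  rw [← Finset.sum_add_distrib]
  exact Finset.sum_le_sum fun j _ => abs_add_le _ _

lemma entrySum_le_of_forall {a b : ℕ} {A : Matrix (Fin a) (Fin b) ℝ} {c : ℝ}
    (h : ∀ i j, |A i j| ≤ c) : entrySum A ≤ a * b * c := by
  calc entrySum A ≤ ∑ _i : Fin a, ∑ _j : Fin b, c :=
        Finset.sum_le_sum fun i _ => Finset.sum_le_sum fun j _ => h i j
    _ = a * b * c := by simp [mul_assoc]

namespace Conditions

/-! ### Regularity of the coefficients -/

lemma mem (hLC : Conditions M Θ σ θs x₀s Xs) : θs ∈ Θ := interior_subset hLC.lc4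

lemma continuousOn_A (hLC : Conditions M Θ σ θs x₀s Xs) {θ : EuclideanSpace ℝ (Fin p)}
    (hθ : θ ∈ Θ) (i j : Fin d) : ContinuousOn (fun t => M.A θ t i j) (Icc 0 M.T) :=
  (hLC.lc1 θ hθ i j).1.continuousOn

lemma exists_bound_A (hLC : Conditions M Θ σ θs x₀s Xs) (hΘ : IsCompact Θ) :
    ∃ K, 0 < K ∧ ∀ θ ∈ Θ, ∀ t ∈ Icc 0 M.T, entrySum (M.A θ t) ≤ K := by
  choose F hF hFc using hLC.lc2
  choose K hK using fun i j => hΘ.exists_bound_of_continuousOn (hFc i j)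
  refine ⟨(∑ i, ∑ j, |K i j|) + 1, by positivity, fun θ hθ t ht => ?_⟩
  refine le_trans (Finset.sum_le_sum fun i _ => Finset.sum_le_sum fun j _ => ?_)
    (le_add_of_nonneg_right zero_le_one)
  rw [← hF i j θ hθ ⟨t, ht⟩]
  exact ((ContinuousMap.norm_coe_le_norm _ _).trans (hK i j θ hθ)).trans (le_abs_self _)

lemma eventually_A_close (hLC : Conditions M Θ σ θs x₀s Xs) {θ' : EuclideanSpace ℝ (Fin p)}
    (hθ' : θ' ∈ Θ) {ε : ℝ} (hε : 0 < ε) :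
    ∀ᶠ θ in 𝓝[Θ] θ', ∀ t ∈ Icc 0 M.T, entrySum (M.A θ t - M.A θ' t) ≤ ε := by
  choose F hF hFc using hLC.lc2
  -- There are `d * d` entries to sum; the `+ 1` covers `d = 0`.
  have hc : 0 < ε / (d * d + 1) := by positivity
  have h : ∀ i j, ∀ᶠ θ in 𝓝[Θ] θ', dist (F i j θ) (F i j θ') < ε / (d * d + 1) := fun i j =>
    Metric.tendsto_nhds.1 (hFc i j θ' hθ') _ hc
  filter_upwards [eventually_all.2 fun i => eventually_all.2 fun j => h i j,
    self_mem_nhdsWithin] with θ hθ hθΘ t ht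
  refine (entrySum_le_of_forall (c := ε / (d * d + 1)) fun i j => ?_).trans ?_
  · rw [Matrix.sub_apply, ← hF i j θ hθΘ ⟨t, ht⟩, ← hF i j θ' hθ' ⟨t, ht⟩, ← Real.dist_eq]
    exact (ContinuousMap.dist_apply_le_dist _).trans (hθ i j).le
  · rw [mul_div_assoc']
    exact div_le_of_le_mul₀ (by positivity) hε.le (by nlinarith)

/-- This regularity in time makes the drift along the true trajectory Lipschitz, hence its Euler
bias of order `1 / n`. -/
lemma exists_lipschitz_A (hLC : Conditions M Θ σ θs x₀s Xs) :
    ∃ L, 0 ≤ L ∧ ∀ s ∈ Icc 0 M.T, ∀ t ∈ Icc 0 M.T,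
      entrySum (M.A θs s - M.A θs t) ≤ L * |s - t| := by
  choose hd K hK using hLC.lc1 θs hLC.mem
  refine ⟨∑ i, ∑ j, |K i j|, by positivity, fun s hs t ht => ?_⟩
  rw [Finset.sum_mul]
  refine Finset.sum_le_sum fun i _ => ?_
  rw [Finset.sum_mul]
  refine Finset.sum_le_sum fun j _ => ?_
  have := (convex_Icc 0 M.T).norm_image_sub_le_of_norm_derivWithin_le (hd i j)
    (fun x hx => (hK i j x hx)) ht hs
  exact this.trans (mul_le_mul_of_nonneg_right (le_abs_self _) (abs_nonneg _))

/-- Since `lc6` is expressed in the uniform norm, the first order expansion at `θs` is uniform in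
`t`; `lc4` turns smoothness on `Θ` into a genuine Fréchet derivative at `θs`. -/
lemma exists_deriv_A (hLC : Conditions M Θ σ θs x₀s Xs) :
    ∃ G : Fin p → ℝ → Matrix (Fin d) (Fin d) ℝ,
      (∀ k i j, ContinuousOn (fun t => G k t i j) (Icc 0 M.T)) ∧
      ∀ ε, 0 < ε → ∀ᶠ h : EuclideanSpace ℝ (Fin p) in 𝓝 0, ∀ t ∈ Icc 0 M.T,
        entrySum (M.A (θs + h) t - M.A θs t - ∑ k, h k • G k t) ≤ ε * ‖h‖ := by
  choose F hF hFc using hLC.lc6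
  have hΘn : Θ ∈ 𝓝 θs := mem_interior_iff_mem_nhds.1 hLC.lc4
  have hd : ∀ i j, HasFDerivAt (F i j) (fderiv ℝ (F i j) θs) θs := fun i j =>
    (((hFc i j).contDiffAt hΘn).differentiableAt (by norm_num)).hasFDerivAt
  have hT := M.T_pos.le
  -- The projection onto `[0, T]` only serves to give `G k t` a value for every real `t`.
  refine ⟨fun k t => Matrix.of fun i j =>
    fderiv ℝ (F i j) θs (EuclideanSpace.single k 1) (projIcc 0 M.T hT t), fun k i j => ?_,
    fun ε hε => ?_⟩
  · exact (((fderiv ℝ (F i j) θs (EuclideanSpace.single k 1)).continuous).comp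
      continuous_projIcc).continuousOn
  · have hc : 0 < ε / (d * d + 1) := by positivity
    have h1 : ∀ i j, ∀ᶠ h : EuclideanSpace ℝ (Fin p) in 𝓝 0,
        ‖F i j (θs + h) - F i j θs - fderiv ℝ (F i j) θs h‖ ≤ ε / (d * d + 1) * ‖h‖ := fun i j =>
      (hasFDerivAt_iff_isLittleO_nhds_zero.1 (hd i j)).def hc
    have h2 : ∀ᶠ h : EuclideanSpace ℝ (Fin p) in 𝓝 0, θs + h ∈ Θ := by
      have : Tendsto (fun h : EuclideanSpace ℝ (Fin p) => θs + h) (𝓝 0) (𝓝 θs) := by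
        have h : Continuous fun h : EuclideanSpace ℝ (Fin p) => θs + h := by fun_prop
        simpa using h.tendsto 0
      exact this hΘn
    filter_upwards [eventually_all.2 fun i => eventually_all.2 fun j => h1 i j, h2]
      with h hh hhΘ t ht
    refine (entrySum_le_of_forall (c := ε / (d * d + 1) * ‖h‖) fun i j => ?_).trans ?_
    · refine le_trans (le_of_eq ?_) ((ContinuousMap.norm_coe_le_norm _ ⟨t, ht⟩).trans (hh i j))
      rw [Real.norm_eq_abs]
      congr 1
      have hsum : h = ∑ k, h k • EuclideanSpace.single k (1 : ℝ) := by
        ext k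
        simp [Finset.sum_apply, Pi.single_apply]
      have hfd : fderiv ℝ (F i j) θs h ⟨t, ht⟩
          = ∑ k, h k * fderiv ℝ (F i j) θs (EuclideanSpace.single k 1) ⟨t, ht⟩ := by
        conv_lhs => rw [hsum]
        simp [map_sum, ContinuousMap.sum_apply]
      simp only [Matrix.sub_apply, Matrix.sum_apply, Matrix.smul_apply, Matrix.of_apply,
        smul_eq_mul, projIcc_of_mem hT ht, ContinuousMap.sub_apply, hfd,
        hF i j _ hhΘ, hF i j _ hLC.mem]
    · rw [← mul_assoc]
      refine mul_le_mul_of_nonneg_right ?_ (norm_nonneg h)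
      rw [mul_div_assoc']
      exact div_le_of_le_mul₀ (by positivity) hε.le (by nlinarith)

lemma exists_solution (hLC : Conditions M Θ σ θs x₀s Xs) {θ : EuclideanSpace ℝ (Fin p)}
    (hθ : θ ∈ Θ) (x₀ : Fin d → ℝ) : ∃ X, M.IsSolution θ x₀ X := by
  obtain ⟨X, hX0, hX⟩ := exists_linear_ode_solution M.T_pos.le (hLC.continuousOn_A hθ)
    (g := fun _ => 0) continuousOn_const x₀
  exact ⟨X, hX0, fun t ht => by simpa using hX t ht⟩

/-! ### The Riccati equation: observability and optimal sensitivities -/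

lemma continuousOn_riccati {θ : EuclideanSpace ℝ (Fin p)} {R : ℝ → Matrix (Fin d) (Fin d) ℝ}
    (hR : M.IsRiccatiSolution θ R) (i j : Fin d) :
    ContinuousOn (fun t => R t i j) (Icc 0 M.T) :=
  fun t ht => (hR.2 t ht i j).continuousWithinAt

lemma continuousOn_matrix_mul {a b c : ℕ} {R : ℝ → Matrix (Fin a) (Fin b) ℝ}
    {S : ℝ → Matrix (Fin b) (Fin c) ℝ} {s : Set ℝ}
    (hR : ∀ i j, ContinuousOn (fun t => R t i j) s)
    (hS : ∀ i j, ContinuousOn (fun t => S t i j) s) (i : Fin a) (j : Fin c) :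
    ContinuousOn (fun t => (R t * S t) i j) s := by
  simp only [Matrix.mul_apply]
  exact continuousOn_finsetSum _ fun k _ => (hR i k).mul (hS k j)

/-- This is the closed-loop adjoint coefficient: it drives `R X` when `X` is unobserved, and the
affine part of the feedback in `nonempty_sensitivity`. -/
lemma continuousOn_adjoint_coeff (hLC : Conditions M Θ σ θs x₀s Xs)
    {θ : EuclideanSpace ℝ (Fin p)} (hθ : θ ∈ Θ) {R : ℝ → Matrix (Fin d) (Fin d) ℝ}
    (hR : M.IsRiccatiSolution θ R) (i j : Fin d) :
    ContinuousOn (fun t => (-(M.A θ t)ᵀ + R t * M.B * M.U⁻¹ * M.Bᵀ) i j) (Icc 0 M.T) := by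
  have h1 := continuousOn_matrix_mul (S := fun _ => M.B * M.U⁻¹ * M.Bᵀ)
    (continuousOn_riccati hR) (fun _ _ => continuousOn_const) i j
  have h2 := (hLC.continuousOn_A hθ j i).neg.add h1
  refine h2.congr fun t _ => ?_
  simp [Matrix.mul_assoc]

/-- If `C X = 0`, the Riccati equation makes `R X` solve a homogeneous linear equation. It vanishes
at `T` because `R T = 0`, hence everywhere, and invertibility of `R 0` gives `X 0 = 0`. -/
lemma eq_zero_of_unobserved (hLC : Conditions M Θ σ θs x₀s Xs) {θ : EuclideanSpace ℝ (Fin p)}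
    (hθ : θ ∈ Θ) {x₀ : Fin d → ℝ} {X : ℝ → Fin d → ℝ} (hX : M.IsSolution θ x₀ X)
    (hCX : ∀ t ∈ Icc 0 M.T, M.C *ᵥ X t = 0) : x₀ = 0 := by
  obtain ⟨R, hR, hR0⟩ := hLC.lc3 θ hθ
  have hw := linear_ode_eq_zero_backward (hLC.continuousOn_adjoint_coeff hθ hR)
    (X := fun t => R t *ᵥ X t) (fun t ht => by
      have := HasDerivWithinAt.matrix_mulVec (R := R) (hR.2 t ht) (hX.2 t ht)
      convert this using 1
      have h0 : (M.Cᵀ * M.C) *ᵥ X t = 0 := by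
        rw [← Matrix.mulVec_mulVec, hCX t ht, Matrix.mulVec_zero]
      simp only [Matrix.add_mulVec, Matrix.sub_mulVec, Matrix.neg_mulVec, h0,
        ← Matrix.mulVec_mulVec]
      abel) (by simp [hR.1])
  have h0 := hw 0 (left_mem_Icc.2 M.T_pos.le)
  rw [hX.1] at h0
  have := congrArg ((R 0)⁻¹ *ᵥ ·) h0
  simpa [Matrix.mulVec_mulVec, Matrix.nonsing_inv_mul _ ((Matrix.isUnit_iff_isUnit_det _).1 hR0)]
    using this

end Conditions

/-- Derivatives `G k` of the coefficients with respect to the `k`-th parameter, together with the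
solution of the corresponding linear-quadratic problem: the controlled sensitivity `Ξ k`, the
control `w k` and the adjoint state `P k`. -/
structure Sensitivity (M : Model p d q m) (θs : EuclideanSpace ℝ (Fin p)) (Xs : ℝ → Fin d → ℝ) where
  G : Fin p → ℝ → Matrix (Fin d) (Fin d) ℝ
  Ξ : Fin p → ℝ → Fin d → ℝ
  w : Fin p → ℝ → Fin m → ℝ
  P : Fin p → ℝ → Fin d → ℝ
  G_cont : ∀ k i j, ContinuousOn (fun t => G k t i j) (Icc 0 M.T)
  G_deriv : ∀ ε, 0 < ε → ∀ᶠ h : EuclideanSpace ℝ (Fin p) in 𝓝 0, ∀ t ∈ Icc 0 M.T,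
    entrySum (M.A (θs + h) t - M.A θs t - ∑ k, h k • G k t) ≤ ε * ‖h‖
  Ξ_deriv : ∀ k, ∀ t ∈ Icc 0 M.T, HasDerivWithinAt (Ξ k)
    (M.A θs t *ᵥ Ξ k t + M.B *ᵥ w k t + G k t *ᵥ Xs t) (Icc 0 M.T) t
  P_deriv : ∀ k, ∀ t ∈ Icc 0 M.T, HasDerivWithinAt (P k)
    (-((M.A θs t)ᵀ *ᵥ P k t) - M.Cᵀ *ᵥ (M.C *ᵥ Ξ k t)) (Icc 0 M.T) t
  P_zero : ∀ k, P k 0 = 0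
  P_last : ∀ k, P k M.T = 0
  w_eq : ∀ k t, w k t = -(M.U⁻¹ *ᵥ (M.Bᵀ *ᵥ P k t))

/-- The optimality system is a two-point boundary value problem. The ansatz `P = R Ξ + κ` decouples
it: `κ` solves a backward linear equation with `κ T = 0`, then `Ξ` solves a forward one. `P T = 0`
is automatic, and the choice `Ξ 0 = -(R 0)⁻¹ κ 0` achieves `P 0 = 0`, the optimality condition for a
free initial value. -/
lemma Conditions.nonempty_sensitivity (hLC : Conditions M Θ σ θs x₀s Xs)
    (hXs : M.IsSolution θs x₀s Xs) : Nonempty (Sensitivity M θs Xs) := by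
  obtain ⟨G, hGc, hG⟩ := hLC.exists_deriv_A
  obtain ⟨R, hR, hR0⟩ := hLC.lc3 θs hLC.mem
  have hXc : ContinuousOn Xs (Icc 0 M.T) := fun t ht => (hXs.2 t ht).continuousWithinAt
  have hF : ∀ k, ContinuousOn (fun t => G k t *ᵥ Xs t) (Icc 0 M.T) := fun k =>
    ContinuousOn.matrix_mulVec (hGc k) hXc
  have hRc := continuousOn_riccati hR
  choose κ hκT hκ using fun k => exists_linear_ode_solution_backward M.T_pos.le
    (hLC.continuousOn_adjoint_coeff hLC.mem hR) (g := fun t => -(R t *ᵥ (G k t *ᵥ Xs t)))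
    (ContinuousOn.matrix_mulVec hRc (hF k)).neg 0
  have hκc : ∀ k, ContinuousOn (κ k) (Icc 0 M.T) := fun k t ht => (hκ k t ht).continuousWithinAt
  have hac : ∀ i j, ContinuousOn (fun t => (M.A θs t - M.B * M.U⁻¹ * M.Bᵀ * R t) i j)
      (Icc 0 M.T) := fun i j =>
    (hLC.continuousOn_A hLC.mem i j).sub (continuousOn_matrix_mul
      (R := fun _ => M.B * M.U⁻¹ * M.Bᵀ) (fun _ _ => continuousOn_const) hRc i j)
  choose Ξ hΞ0 hΞ using fun k => exists_linear_ode_solution M.T_pos.le hac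
    (g := fun t => G k t *ᵥ Xs t - (M.B * M.U⁻¹ * M.Bᵀ) *ᵥ κ k t)
    ((hF k).sub (ContinuousOn.const_mulVec _ (hκc k))) (-((R 0)⁻¹ *ᵥ κ k 0))
  have hRdet := (Matrix.isUnit_iff_isUnit_det _).1 hR0
  refine ⟨{
    G := G
    Ξ := Ξ
    w := fun k t => -(M.U⁻¹ *ᵥ (M.Bᵀ *ᵥ (R t *ᵥ Ξ k t + κ k t)))
    P := fun k t => R t *ᵥ Ξ k t + κ k t
    G_cont := hGc
    G_deriv := hG
    Ξ_deriv := fun k t ht => ?_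
    P_deriv := fun k t ht => ?_
    P_zero := fun k => ?_
    P_last := fun k => ?_
    w_eq := fun k t => rfl }⟩
  · convert hΞ k t ht using 1
    simp only [Matrix.sub_mulVec, ← Matrix.mulVec_mulVec, Matrix.mulVec_add, Matrix.mulVec_neg]
    abel
  · have h := (HasDerivWithinAt.matrix_mulVec (R := R) (hR.2 t ht) (hΞ k t ht)).add (hκ k t ht)
    refine h.congr_deriv ?_
    simp only [Matrix.add_mulVec, Matrix.sub_mulVec, Matrix.neg_mulVec, ← Matrix.mulVec_mulVec,
      Matrix.mulVec_add, Matrix.mulVec_sub]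
    abel
  · rw [hΞ0, Matrix.mulVec_neg, Matrix.mulVec_mulVec, Matrix.mul_nonsing_inv _ hRdet,
      Matrix.one_mulVec, neg_add_cancel]
  · rw [hR.1, hκT]; simp

end TrackedLinearODE

namespace TrackedLinearODE

/-! ### Second order behaviour at a point with nonsingular Hessian -/

/-- Second order Taylor expansion along a line when the gradient is only known to be differentiable
at the base point: the mean value inequality is applied to `f - s ^ 2 / 2 * L w w` on the segment.
-/
lemma isLittleO_second_order {V : Type*} [NormedAddCommGroup V] [NormedSpace ℝ V] {f : V → ℝ}
    {g : V → V →L[ℝ] ℝ} {L : V →L[ℝ] V →L[ℝ] ℝ} {θ : V}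
    (hf : ∀ᶠ y in 𝓝 θ, HasFDerivAt f (g y) y) (hg : HasFDerivAt g L θ) (hg0 : g θ = 0) (w : V) :
    (fun t : ℝ => f (θ + t • w) - f θ - t ^ 2 / 2 * L w w) =o[𝓝 0] fun t : ℝ => t ^ 2 := by
  have hc : Tendsto (fun t : ℝ => θ + t • w) (𝓝 0) (𝓝 θ) := by
    have : Continuous fun t : ℝ => θ + t • w := by fun_prop
    simpa using this.tendsto 0
  have hline : HasDerivAt (fun t : ℝ => θ + t • w) w 0 := by
    simpa using ((hasDerivAt_id (0 : ℝ)).smul_const w).const_add θ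
  have hgw : HasDerivAt (fun t : ℝ => g (θ + t • w) w) (L w w) 0 := by
    have h1 : HasFDerivAt g L (θ + (0 : ℝ) • w) := by simpa using hg
    have h2 : HasDerivAt (fun t : ℝ => g (θ + t • w)) (L w) 0 := h1.comp_hasDerivAt (0 : ℝ) hline
    have h3 := (ContinuousLinearMap.apply ℝ ℝ w).hasFDerivAt.comp_hasDerivAt (0 : ℝ) h2
    exact h3
  rw [Asymptotics.isLittleO_iff]
  intro ε hε
  have h1 := (hasDerivAt_iff_isLittleO_nhds_zero.1 hgw).def hε
  obtain ⟨δ, hδ, hball⟩ := Metric.eventually_nhds_iff_ball.1 (h1.and (hc.eventually hf))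
  filter_upwards [Metric.ball_mem_nhds (0 : ℝ) hδ] with t ht
  have hsub : ∀ s ∈ uIcc 0 t, s ∈ Metric.ball (0 : ℝ) δ ∧ |s| ≤ |t| := fun s hs => by
    have := abs_sub_left_of_mem_uIcc hs
    simp only [sub_zero] at this
    refine ⟨?_, this⟩
    rw [Metric.mem_ball, dist_zero_right, Real.norm_eq_abs] at ht ⊢
    exact this.trans_lt ht
  have hder : ∀ s ∈ uIcc 0 t, HasDerivWithinAt
      (fun s : ℝ => f (θ + s • w) - s ^ 2 / 2 * L w w) (g (θ + s • w) w - s * L w w)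
      (uIcc 0 t) s := fun s hs => by
    have hl : HasDerivAt (fun t : ℝ => θ + t • w) w s := by
      simpa using ((hasDerivAt_id s).smul_const w).const_add θ
    have h2 := ((hball s (hsub s hs).1).2.comp_hasDerivAt s hl).sub
      ((((hasDerivAt_id s).pow 2).div_const 2).mul_const (L w w))
    refine (h2.congr_deriv ?_).hasDerivWithinAt
    simp
  have hbd : ∀ s ∈ uIcc 0 t, ‖g (θ + s • w) w - s * L w w‖ ≤ ε * |t| := fun s hs => by
    have h3 := (hball s (hsub s hs).1).1
    simp only [zero_add, zero_smul, add_zero, hg0, zero_apply, sub_zero,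
      smul_eq_mul] at h3
    exact h3.trans (mul_le_mul_of_nonneg_left (hsub s hs).2 hε.le)
  have := (convex_uIcc 0 t).norm_image_sub_le_of_norm_hasDerivWithin_le hder hbd
    left_mem_uIcc right_mem_uIcc
  simp only [zero_smul, add_zero, sub_zero] at this
  rw [norm_pow, Real.norm_eq_abs t]
  calc _ = ‖f (θ + t • w) - t ^ 2 / 2 * L w w - (f θ - 0 ^ 2 / 2 * L w w)‖ := by
        congr 1; ring
    _ ≤ ε * |t| * |t| := this
    _ = ε * |t| ^ 2 := by ring

/-- At a minimum the Hessian is positive semidefinite, so a direction along which `f` is flat to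
second order lies in its kernel, which is trivial. No smoothness of `f` is assumed: nonsingularity
of the formal Hessian, together with the quadratic pinching at `θ`, already supplies the
differentiability that is needed. -/
lemma eq_zero_of_isUnit_hessian {p : ℕ} {f : EuclideanSpace ℝ (Fin p) → ℝ}
    {θ v : EuclideanSpace ℝ (Fin p)} (hH : IsUnit (hessian f θ))
    (hmin : ∀ᶠ h in 𝓝 0, f θ ≤ f (θ + h)) {K : ℝ}
    (hup : ∀ᶠ h in 𝓝 0, f (θ + h) - f θ ≤ K * ‖h‖ ^ 2)
    (hv : (fun t : ℝ => f (θ + t • v) - f θ) =o[𝓝 0] fun t : ℝ => t ^ 2) : v = 0 := by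
  by_contra hv0
  have hne : Nonempty (Fin p) := by
    by_contra h
    rw [not_nonempty_iff] at h
    exact hv0 (Subsingleton.elim _ _)
  set g := fderiv ℝ f with hgdef
  set L := fderiv ℝ g θ with hLdef
  have hHL : ∀ w : EuclideanSpace ℝ (Fin p), L w = 0 → w = 0 := fun w hw => by
    have h0 : (w : Fin p → ℝ) ᵥ* hessian f θ = 0 := by
      ext j
      have hsum : w = ∑ k, w k • EuclideanSpace.single k (1 : ℝ) := by
        ext k
        simp [Finset.sum_apply, Pi.single_apply]
      have h1 : L w (EuclideanSpace.single j 1) = 0 := by simp [hw]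
      rw [hsum] at h1
      simpa [map_sum, Matrix.vecMul, dotProduct, hessian, sum_apply] using h1
    have h2 := congrArg (· ᵥ* (hessian f θ)⁻¹) h0
    simp only [Matrix.vecMul_vecMul, Matrix.zero_vecMul,
      Matrix.mul_nonsing_inv _ ((Matrix.isUnit_iff_isUnit_det _).1 hH), Matrix.vecMul_one] at h2
    ext k
    exact congrFun h2 k
  -- Were `g` not differentiable at `θ`, its `fderiv` would be the default value `0`, which is not
  -- injective since `v ≠ 0`.
  have hgd : DifferentiableAt ℝ g θ := by
    by_contra hnd
    have hL0 : L = 0 := fderiv_zero_of_not_differentiableAt hnd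
    exact hv0 (hHL v (by simp [hL0]))
  have hgL : HasFDerivAt g L θ := hgd.hasFDerivAt
  have hf0 : HasFDerivAt f (0 : EuclideanSpace ℝ (Fin p) →L[ℝ] ℝ) θ := by
    rw [hasFDerivAt_iff_isLittleO_nhds_zero]
    have hO : (fun h : EuclideanSpace ℝ (Fin p) => f (θ + h) - f θ) =O[𝓝 0]
        fun h => ‖h‖ ^ 2 := by
      refine Asymptotics.IsBigO.of_bound K ?_
      filter_upwards [hmin, hup] with h h1 h2
      rw [Real.norm_of_nonneg (sub_nonneg.2 h1), Real.norm_of_nonneg (by positivity)]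
      exact h2
    have ho : (fun h : EuclideanSpace ℝ (Fin p) => ‖h‖ ^ 2) =o[𝓝 0] fun h => h :=
      Asymptotics.isLittleO_norm_pow_id one_lt_two
    simpa using hO.trans_isLittleO ho
  have hg0 : g θ = 0 := hf0.fderiv
  have hanti : ∃ C, AntilipschitzWith C L := by
    obtain ⟨c, _, hc⟩ := L.toLinearMap.exists_antilipschitzWith
      (LinearMap.ker_eq_bot'.2 fun w hw => hHL w hw)
    exact ⟨c, hc⟩
  -- Injectivity of `L` keeps `g` away from zero on a punctured neighbourhood of `θ`, and a nonzero
  -- `fderiv` is never the default value, so `f` is differentiable there.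
  have hfd : ∀ᶠ y in 𝓝 θ, HasFDerivAt f (g y) y := by
    have h1 : ∀ᶠ y in 𝓝[≠] θ, g y ≠ 0 := hgL.eventually_ne hanti
    rw [eventually_nhdsWithin_iff] at h1
    filter_upwards [h1] with y hy
    by_cases hyθ : y = θ
    · rw [hyθ, hg0]; exact hf0
    · have : DifferentiableAt ℝ f y := by
        by_contra hnd
        exact hy hyθ (fderiv_zero_of_not_differentiableAt hnd)
      exact this.hasFDerivAt
  have hsymm := second_derivative_symmetric_of_eventually hfd hgL
  have hpos : ∀ w, 0 ≤ L w w := fun w => by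
    by_contra! hneg
    have h1 := (isLittleO_second_order hfd hgL hg0 w).def (c := -(L w w) / 4) (by linarith)
    have hc : Tendsto (fun t : ℝ => t • w) (𝓝 0) (𝓝 0) := by
      have : Continuous fun t : ℝ => t • w := by fun_prop
      simpa using this.tendsto 0
    have h2 := (h1.and (hc.eventually hmin)).filter_mono (nhdsWithin_le_nhds (s := {0}ᶜ))
    obtain ⟨t, ⟨ht1, ht2⟩, ht0⟩ := (h2.and self_mem_nhdsWithin).exists
    have ht : 0 < t ^ 2 := sq_pos_iff.2 ht0
    rw [Real.norm_of_nonneg ht.le] at ht1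
    have := (abs_le.1 ht1).2
    nlinarith
  have hvv : L v v = 0 := by
    have h1 := (isLittleO_second_order hfd hgL hg0 v).sub hv
    refine le_antisymm ?_ (hpos v)
    by_contra! hlt
    have h2 := (h1.def (c := L v v / 4) (by linarith)).filter_mono
      (nhdsWithin_le_nhds (s := {0}ᶜ))
    obtain ⟨t, ht1, ht0⟩ := (h2.and self_mem_nhdsWithin).exists
    have ht : 0 < t ^ 2 := sq_pos_iff.2 ht0
    rw [Real.norm_of_nonneg ht.le] at ht1
    have := (abs_le.1 ht1).1
    nlinarith
  refine hv0 (hHL v ?_)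
  ext w
  -- Cauchy–Schwarz for a semidefinite symmetric form: since `L v v = 0`, a nonzero `L v w` would
  -- make `L` negative at `v + s • w` for a suitable small `s`. The `+ 1` in the choice of `s` below
  -- covers `L w w = 0`.
  have hquad : ∀ s : ℝ, 0 ≤ 2 * s * L v w + s ^ 2 * L w w := fun s => by
    have := hpos (v + s • w)
    simp only [map_add, map_smul, add_apply, smul_apply,
      smul_eq_mul, hvv, hsymm w v] at this
    linarith
  rw [zero_apply]
  have hw := hpos w
  by_contra hne0
  have h1 := hquad (-(L v w) / (L w w + 1))
  have hW : 0 < L w w + 1 := by linarith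
  have h2 : 2 * (-(L v w) / (L w w + 1)) * L v w + (-(L v w) / (L w w + 1)) ^ 2 * L w w
      = - ((L v w) ^ 2 * (L w w + 2)) / (L w w + 1) ^ 2 := by
    field_simp; ring
  rw [h2] at h1
  have h3 : 0 < (L v w) ^ 2 * (L w w + 2) := mul_pos (sq_pos_iff.2 hne0) (by linarith)
  have : - ((L v w) ^ 2 * (L w w + 2)) / (L w w + 1) ^ 2 < 0 :=
    div_neg_of_neg_of_pos (by linarith) (by positivity)
  linarith

end TrackedLinearODE

/-! ### Bounds on the asymptotic profiled cost. -/

namespace TrackedLinearODE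

lemma exists_quadratic_lower_bound {a : ℕ} {A : Matrix (Fin a) (Fin a) ℝ}
    (hA : ∀ u, u ≠ 0 → 0 < u ⬝ᵥ (A *ᵥ u)) : ∃ c, 0 < c ∧ ∀ u, c * ‖u‖ ^ 2 ≤ u ⬝ᵥ (A *ᵥ u) := by
  rcases (Metric.sphere (0 : Fin a → ℝ) 1).eq_empty_or_nonempty with hem | hne
  · refine ⟨1, one_pos, fun u => ?_⟩
    have hu : u = 0 := by
      by_contra hu
      have : (‖u‖⁻¹ • u) ∈ Metric.sphere (0 : Fin a → ℝ) 1 := by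
        simp [norm_smul, inv_mul_cancel₀ (norm_ne_zero_iff.2 hu)]
      rw [hem] at this
      exact this
    simp [hu]
  · have hc : Continuous fun u : Fin a → ℝ => u ⬝ᵥ (A *ᵥ u) := by fun_prop
    obtain ⟨u₀, hu₀, hmin⟩ := (isCompact_sphere (0 : Fin a → ℝ) 1).exists_isMinOn hne
      hc.continuousOn
    refine ⟨u₀ ⬝ᵥ (A *ᵥ u₀), hA _ (ne_zero_of_mem_unit_sphere ⟨u₀, hu₀⟩), fun u => ?_⟩
    by_cases hu : u = 0
    · simp [hu]
    · have hn : ‖u‖ ≠ 0 := norm_ne_zero_iff.2 hu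
      have hs : (‖u‖⁻¹ • u) ∈ Metric.sphere (0 : Fin a → ℝ) 1 := by
        simp [norm_smul, inv_mul_cancel₀ hn]
      have h := isMinOn_iff.1 hmin _ hs
      simp only [Matrix.mulVec_smul, dotProduct_smul, smul_dotProduct, smul_eq_mul] at h
      calc _ ≤ (‖u‖⁻¹ * (‖u‖⁻¹ * u ⬝ᵥ (A *ᵥ u))) * ‖u‖ ^ 2 := by gcongr
        _ = _ := by field_simp

namespace Model

variable {p d q m : ℕ} (M : Model p d q m)

lemma exists_U_lower_bound : ∃ c, 0 < c ∧ ∀ u, c * ‖u‖ ^ 2 ≤ u ⬝ᵥ (M.U *ᵥ u) :=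
  exists_quadratic_lower_bound fun u hu => by simpa using M.U_posDef.dotProduct_mulVec_pos hu

lemma U_quadratic_nonneg (u : Fin m → ℝ) : 0 ≤ u ⬝ᵥ (M.U *ᵥ u) := by
  obtain ⟨c, hc, h⟩ := M.exists_U_lower_bound
  exact le_trans (by positivity) (h u)

lemma U_symm (u v : Fin m → ℝ) : u ⬝ᵥ (M.U *ᵥ v) = v ⬝ᵥ (M.U *ᵥ u) := by
  have h : M.Uᵀ = M.U := by simpa using M.U_posDef.isHermitian.eq
  rw [Matrix.dotProduct_mulVec, ← Matrix.mulVec_transpose, h, dotProduct_comm]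

lemma le_cost (σ : ℝ) (Y : ℝ → Fin q → ℝ) (u : ℝ → Fin m → ℝ) (X : ℝ → Fin d → ℝ) :
    q * σ ^ 2 ≤ M.cost σ Y u X :=
  le_add_of_nonneg_right (intervalIntegral.integral_nonneg M.T_pos.le fun _ _ =>
    add_nonneg (dotProduct_self_nonneg' _) (M.U_quadratic_nonneg _))

lemma profile_nonneg (σ : ℝ) (Y : ℝ → Fin q → ℝ) (θ : EuclideanSpace ℝ (Fin p))
    (x₀ : Fin d → ℝ) : 0 ≤ M.profile σ Y θ x₀ :=
  Real.sInf_nonneg fun c ⟨u, X, _, hc⟩ => hc ▸ le_trans (by positivity) (M.le_cost σ Y u X)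

end Model

variable {p d q m : ℕ} {M : Model p d q m} {Θ : Set (EuclideanSpace ℝ (Fin p))} {σ : ℝ}
  {θs : EuclideanSpace ℝ (Fin p)} {x₀s : Fin d → ℝ} {Xs : ℝ → Fin d → ℝ}

lemma Model.IsSolution.continuousOn {θ : EuclideanSpace ℝ (Fin p)} {x₀ : Fin d → ℝ}
    {X : ℝ → Fin d → ℝ} (hX : M.IsSolution θ x₀ X) : ContinuousOn X (Icc 0 M.T) :=
  fun t ht => (hX.2 t ht).continuousWithinAt

namespace Conditions

lemma isControlled_zero (hLC : Conditions M Θ σ θs x₀s Xs) {θ : EuclideanSpace ℝ (Fin p)}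
    (hθ : θ ∈ Θ) {x₀ : Fin d → ℝ} {X : ℝ → Fin d → ℝ} (hX : M.IsSolution θ x₀ X) :
    M.IsControlled θ x₀ (fun _ => 0) X := by
  refine ⟨MemLp.zero', hX.continuousOn, fun t ht => ?_⟩
  simp only [Matrix.mulVec_zero, add_zero]
  have hsub : Icc 0 t ⊆ Icc 0 M.T := Icc_subset_Icc_right ht.2
  have h := intervalIntegral.integral_eq_sub_of_hasDeriv_right (a := 0) (b := t) (f := X)
    (f' := fun s => M.A θ s *ᵥ X s)
    (by rw [uIcc_of_le ht.1]; exact hX.continuousOn.mono hsub)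
    (fun s hs => by
      rw [min_eq_left ht.1, max_eq_right ht.1] at hs
      have hs' : s ∈ Ico 0 M.T := ⟨hs.1.le, hs.2.trans_le ht.2⟩
      exact ((hX.2 s ⟨hs'.1, hs'.2.le⟩).mono_of_mem_nhdsWithin
        (Icc_mem_nhdsGE_of_mem hs')).mono Ioi_subset_Ici_self)
    (by
      refine ContinuousOn.intervalIntegrable ?_
      rw [uIcc_of_le ht.1]
      exact (ContinuousOn.matrix_mulVec (hLC.continuousOn_A hθ) hX.continuousOn).mono hsub)
  rw [h, hX.1]
  abel

lemma le_profileCI (hLC : Conditions M Θ σ θs x₀s Xs) {θ : EuclideanSpace ℝ (Fin p)}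
    (hθ : θ ∈ Θ) (Y : ℝ → Fin q → ℝ) : q * σ ^ 2 ≤ M.profileCI σ Y θ := by
  refine le_ciInf fun x₀ => ?_
  obtain ⟨X, hX⟩ := hLC.exists_solution hθ x₀
  -- Exhibiting an admissible pair matters: the infimum of the empty set would be `0`, below `q * σ
  -- ^ 2`.
  refine le_csInf ⟨_, _, X, hLC.isControlled_zero hθ hX, rfl⟩ ?_
  rintro c ⟨u, X, _, rfl⟩
  exact M.le_cost σ Y u X

/-- The zero control is a competitor. This upper bound and the lower bound `q * σ ^ 2`, with `lc7`,
are all that is used of the asymptotic cost. -/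
lemma profileCI_le (hLC : Conditions M Θ σ θs x₀s Xs) {θ : EuclideanSpace ℝ (Fin p)}
    (hθ : θ ∈ Θ) {x₀ : Fin d → ℝ} {X : ℝ → Fin d → ℝ} (hX : M.IsSolution θ x₀ X)
    {Y : ℝ → Fin q → ℝ} {b : ℝ} (hb : ∀ t ∈ Icc 0 M.T, ‖M.C *ᵥ X t - Y t‖ ≤ b) :
    M.profileCI σ Y θ ≤ q * σ ^ 2 + q * M.T * b ^ 2 := by
  have h1 : M.profileCI σ Y θ ≤ M.profile σ Y θ x₀ :=
    ciInf_le ⟨0, by rintro _ ⟨x, rfl⟩; exact M.profile_nonneg σ Y θ x⟩ x₀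
  have h2 : M.profile σ Y θ x₀ ≤ M.cost σ Y (fun _ => 0) X :=
    csInf_le ⟨0, by
      rintro _ ⟨u, X, _, rfl⟩
      exact le_trans (by positivity) (M.le_cost σ Y u X)⟩
      ⟨_, X, hLC.isControlled_zero hθ hX, rfl⟩
  refine h1.trans (h2.trans (add_le_add le_rfl ?_))
  have h3 := intervalIntegral.norm_integral_le_of_norm_le_const (a := 0) (b := M.T)
    (C := q * b ^ 2) (f := fun t => (M.C *ᵥ X t - Y t) ⬝ᵥ (M.C *ᵥ X t - Y t)
      + (0 : Fin m → ℝ) ⬝ᵥ (M.U *ᵥ 0)) (fun t ht => by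
    rw [uIoc_of_le M.T_pos.le] at ht
    have hbt := hb t ⟨ht.1.le, ht.2⟩
    simp only [zero_dotProduct, add_zero]
    refine (abs_dotProduct_le _ _).trans (mul_le_mul_of_nonneg_left ?_ q.cast_nonneg)
    rw [pow_two]
    exact mul_le_mul hbt hbt (norm_nonneg _) ((norm_nonneg _).trans hbt))
  rw [sub_zero, abs_of_pos M.T_pos] at h3
  refine (le_abs_self _).trans (h3.trans (le_of_eq (by ring)))

end Conditions

/-! ### Controlled sensitivities and their Gram matrices. -/

namespace Sensitivity

variable (S : Sensitivity M θs Xs)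

/-- The sensitivity in the direction `h`. -/
def state (h : EuclideanSpace ℝ (Fin p)) (t : ℝ) : Fin d → ℝ := ∑ k, h k • S.Ξ k t

/-- The control of the sensitivity in the direction `h`. -/
def control (h : EuclideanSpace ℝ (Fin p)) (t : ℝ) : Fin m → ℝ := ∑ k, h k • S.w k t

/-- The adjoint state of the sensitivity in the direction `h`. -/
def adjoint (h : EuclideanSpace ℝ (Fin p)) (t : ℝ) : Fin d → ℝ := ∑ k, h k • S.P k t

/-- The derivative of the coefficients in the direction `h`. -/
def coeff (h : EuclideanSpace ℝ (Fin p)) (t : ℝ) : Matrix (Fin d) (Fin d) ℝ := ∑ k, h k • S.G k t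

lemma state_deriv (h : EuclideanSpace ℝ (Fin p)) : ∀ t ∈ Icc 0 M.T, HasDerivWithinAt (S.state h)
    (M.A θs t *ᵥ S.state h t + M.B *ᵥ S.control h t + S.coeff h t *ᵥ Xs t) (Icc 0 M.T) t := by
  intro t ht
  have := HasDerivWithinAt.fun_sum (u := Finset.univ) fun k _ =>
    (S.Ξ_deriv k t ht).const_smul (h k)
  refine this.congr_deriv ?_
  simp only [state, control, coeff, Matrix.mulVec_sum, Matrix.sum_mulVec, Matrix.mulVec_smul,
    Matrix.smul_mulVec, ← Finset.sum_add_distrib, smul_add]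

lemma adjoint_deriv (h : EuclideanSpace ℝ (Fin p)) : ∀ t ∈ Icc 0 M.T,
    HasDerivWithinAt (S.adjoint h)
    (-((M.A θs t)ᵀ *ᵥ S.adjoint h t) - M.Cᵀ *ᵥ (M.C *ᵥ S.state h t)) (Icc 0 M.T) t := by
  intro t ht
  have := HasDerivWithinAt.fun_sum (u := Finset.univ) fun k _ =>
    (S.P_deriv k t ht).const_smul (h k)
  refine this.congr_deriv ?_
  simp only [state, adjoint, Matrix.mulVec_sum, Matrix.mulVec_smul,
    ← Finset.sum_sub_distrib, ← Finset.sum_neg_distrib, smul_sub, smul_neg]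

lemma adjoint_zero (h : EuclideanSpace ℝ (Fin p)) : S.adjoint h 0 = 0 := by
  simp [adjoint, S.P_zero]

lemma adjoint_last (h : EuclideanSpace ℝ (Fin p)) : S.adjoint h M.T = 0 := by
  simp [adjoint, S.P_last]

lemma U_mulVec_inv (v : Fin m → ℝ) : M.U *ᵥ (M.U⁻¹ *ᵥ v) = v := by
  rw [Matrix.mulVec_mulVec, Matrix.mul_nonsing_inv _
    ((Matrix.isUnit_iff_isUnit_det _).1 M.U_posDef.isUnit), Matrix.one_mulVec]

lemma U_mulVec_w (k : Fin p) (t : ℝ) : M.U *ᵥ S.w k t = -(M.Bᵀ *ᵥ S.P k t) := by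
  rw [S.w_eq, Matrix.mulVec_neg, U_mulVec_inv]

lemma U_mulVec_control (h : EuclideanSpace ℝ (Fin p)) (t : ℝ) :
    M.U *ᵥ S.control h t = -(M.Bᵀ *ᵥ S.adjoint h t) := by
  simp only [control, adjoint, Matrix.mulVec_sum, Matrix.mulVec_smul, U_mulVec_w, smul_neg,
    Finset.sum_neg_distrib]

lemma continuousOn_Ξ (k : Fin p) : ContinuousOn (S.Ξ k) (Icc 0 M.T) :=
  fun t ht => (S.Ξ_deriv k t ht).continuousWithinAt

lemma continuousOn_P (k : Fin p) : ContinuousOn (S.P k) (Icc 0 M.T) :=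
  fun t ht => (S.P_deriv k t ht).continuousWithinAt

lemma continuousOn_w (k : Fin p) : ContinuousOn (S.w k) (Icc 0 M.T) := by
  have h : S.w k = fun t => -(M.U⁻¹ *ᵥ (M.Bᵀ *ᵥ S.P k t)) := funext fun t => S.w_eq k t
  rw [h]
  exact (ContinuousOn.const_mulVec _ (ContinuousOn.const_mulVec _ (S.continuousOn_P k))).neg

lemma continuousOn_sum {E : Type*} [NormedAddCommGroup E] [NormedSpace ℝ E]
    {f : Fin p → ℝ → E} {s : Set ℝ}
    (hf : ∀ k, ContinuousOn (f k) s) (h : EuclideanSpace ℝ (Fin p)) :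
    ContinuousOn (fun t => ∑ k, h k • f k t) s :=
  continuousOn_finsetSum _ fun k _ => (hf k).const_smul (h k)

lemma exists_bound_sum {E : Type*} [NormedAddCommGroup E] [NormedSpace ℝ E] {T : ℝ}
    {f : Fin p → ℝ → E} (hf : ∀ k, ContinuousOn (f k) (Icc 0 T)) :
    ∃ K, 0 ≤ K ∧ ∀ (h : EuclideanSpace ℝ (Fin p)), ∀ t ∈ Icc 0 T,
      ‖∑ k, h k • f k t‖ ≤ K * ‖h‖ := by
  choose K hK0 hK using fun k => ContinuousOn.exists_bound (hf k)
  refine ⟨∑ k, K k, Finset.sum_nonneg fun k _ => hK0 k, fun h t ht => ?_⟩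
  rw [Finset.sum_mul]
  refine (norm_sum_le _ _).trans (Finset.sum_le_sum fun k _ => ?_)
  rw [norm_smul, mul_comm]
  exact mul_le_mul (hK k t ht) (PiLp.norm_apply_le h k) (norm_nonneg _) (hK0 k)

lemma exists_coeff_bound : ∃ K, 0 ≤ K ∧ ∀ (h : EuclideanSpace ℝ (Fin p)), ∀ t ∈ Icc 0 M.T,
    entrySum (S.coeff h t) ≤ K * ‖h‖ := by
  choose K hK0 hK using fun i j => exists_bound_sum (f := fun k t => S.G k t i j)
    fun k => S.G_cont k i j
  refine ⟨∑ i, ∑ j, K i j, Finset.sum_nonneg fun i _ => Finset.sum_nonneg fun j _ => hK0 i j,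
    fun h t ht => ?_⟩
  rw [Finset.sum_mul]
  refine Finset.sum_le_sum fun i _ => ?_
  rw [Finset.sum_mul]
  refine Finset.sum_le_sum fun j _ => ?_
  have := hK i j h t ht
  simpa [coeff, Matrix.sum_apply] using this

lemma exists_A_lipschitz_at (S : Sensitivity M θs Xs) : ∃ L, 0 ≤ L ∧ ∀ᶠ h : EuclideanSpace ℝ (Fin p) in 𝓝 0,
    ∀ t ∈ Icc 0 M.T, entrySum (M.A (θs + h) t - M.A θs t) ≤ L * ‖h‖ := by
  obtain ⟨K, hK0, hK⟩ := S.exists_coeff_bound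
  refine ⟨1 + K, by positivity, ?_⟩
  filter_upwards [S.G_deriv 1 one_pos] with h hh t ht
  have h1 := entrySum_add_le (M.A (θs + h) t - M.A θs t - S.coeff h t) (S.coeff h t)
  rw [sub_add_cancel] at h1
  have h2 : entrySum (M.A (θs + h) t - M.A θs t - S.coeff h t) ≤ 1 * ‖h‖ := hh t ht
  linarith [hK h t ht]

/-- Half the Hessian of the asymptotic profiled cost: the Gram matrix of the controlled
sensitivities. -/
noncomputable def fisher : Matrix (Fin p) (Fin p) ℝ := Matrix.of fun k l =>
  ∫ t in (0 : ℝ)..M.T, ((M.C *ᵥ S.Ξ k t) ⬝ᵥ (M.C *ᵥ S.Ξ l t) + S.w k t ⬝ᵥ (M.U *ᵥ S.w l t))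

/-- The Gram matrix of the observed controlled sensitivities. -/
noncomputable def gram : Matrix (Fin p) (Fin p) ℝ := Matrix.of fun k l =>
  ∫ t in (0 : ℝ)..M.T, (M.C *ᵥ S.Ξ k t) ⬝ᵥ (M.C *ᵥ S.Ξ l t)

lemma continuousOn_CΞ (k : Fin p) : ContinuousOn (fun t => M.C *ᵥ S.Ξ k t) (Icc 0 M.T) :=
  ContinuousOn.const_mulVec _ (S.continuousOn_Ξ k)

lemma continuousOn_gram_integrand (k l : Fin p) :
    ContinuousOn (fun t => (M.C *ᵥ S.Ξ k t) ⬝ᵥ (M.C *ᵥ S.Ξ l t)) (Icc 0 M.T) :=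
  ContinuousOn.dotProd (S.continuousOn_CΞ k) (S.continuousOn_CΞ l)

lemma continuousOn_control_integrand (k l : Fin p) :
    ContinuousOn (fun t => S.w k t ⬝ᵥ (M.U *ᵥ S.w l t)) (Icc 0 M.T) :=
  ContinuousOn.dotProd (S.continuousOn_w k) (ContinuousOn.const_mulVec _ (S.continuousOn_w l))

lemma gram_pointwise (h : EuclideanSpace ℝ (Fin p)) (t : ℝ) :
    (M.C *ᵥ S.state h t) ⬝ᵥ (M.C *ᵥ S.state h t)
      = ∑ k, ∑ l, h k * h l * ((M.C *ᵥ S.Ξ k t) ⬝ᵥ (M.C *ᵥ S.Ξ l t)) := by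
  simp only [state, Matrix.mulVec_sum, Matrix.mulVec_smul, sum_dotProduct, dotProduct_sum,
    smul_dotProduct, dotProduct_smul, smul_eq_mul, Finset.mul_sum]
  rw [Finset.sum_comm]
  exact Finset.sum_congr rfl fun k _ => Finset.sum_congr rfl fun l _ => by ring

lemma control_pointwise (h : EuclideanSpace ℝ (Fin p)) (t : ℝ) :
    S.control h t ⬝ᵥ (M.U *ᵥ S.control h t)
      = ∑ k, ∑ l, h k * h l * (S.w k t ⬝ᵥ (M.U *ᵥ S.w l t)) := by
  simp only [control, Matrix.mulVec_sum, Matrix.mulVec_smul, sum_dotProduct, dotProduct_sum,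
    smul_dotProduct, dotProduct_smul, smul_eq_mul, Finset.mul_sum]
  rw [Finset.sum_comm]
  exact Finset.sum_congr rfl fun k _ => Finset.sum_congr rfl fun l _ => by ring

lemma quadratic_eq_sum (A : Matrix (Fin p) (Fin p) ℝ) (h : Fin p → ℝ) :
    h ⬝ᵥ (A *ᵥ h) = ∑ k, ∑ l, h k * h l * A k l := by
  simp only [dotProduct, Matrix.mulVec, Finset.mul_sum]
  exact Finset.sum_congr rfl fun k _ => Finset.sum_congr rfl fun l _ => by ring

lemma integral_quadratic {φ : Fin p → Fin p → ℝ → ℝ}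
    (hφ : ∀ k l, ContinuousOn (φ k l) (Icc 0 M.T)) (h : Fin p → ℝ) :
    h ⬝ᵥ ((Matrix.of fun k l => ∫ t in (0 : ℝ)..M.T, φ k l t) *ᵥ h)
      = ∫ t in (0 : ℝ)..M.T, ∑ k, ∑ l, h k * h l * φ k l t := by
  have hi : ∀ k l, IntervalIntegrable (fun t => h k * h l * φ k l t) volume 0 M.T := fun k l => by
    refine ContinuousOn.intervalIntegrable ?_
    rw [uIcc_of_le M.T_pos.le]
    exact (hφ k l).const_smul (h k * h l)
  have hi' : ∀ k, IntervalIntegrable (fun t => ∑ l, h k * h l * φ k l t) volume 0 M.T :=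
    fun k => by
      refine ContinuousOn.intervalIntegrable ?_
      rw [uIcc_of_le M.T_pos.le]
      exact continuousOn_finsetSum _ fun l _ => (hφ k l).const_smul (h k * h l)
  rw [quadratic_eq_sum, intervalIntegral.integral_finsetSum fun k _ => hi' k]
  refine Finset.sum_congr rfl fun k _ => ?_
  rw [intervalIntegral.integral_finsetSum fun l _ => hi k l]
  refine Finset.sum_congr rfl fun l _ => ?_
  rw [intervalIntegral.integral_const_mul]
  rfl

lemma fisher_quadratic (h : EuclideanSpace ℝ (Fin p)) :
    (h : Fin p → ℝ) ⬝ᵥ (S.fisher *ᵥ h) = ∫ t in (0 : ℝ)..M.T,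
      ((M.C *ᵥ S.state h t) ⬝ᵥ (M.C *ᵥ S.state h t)
        + S.control h t ⬝ᵥ (M.U *ᵥ S.control h t)) := by
  rw [fisher, integral_quadratic (φ := fun k l t => (M.C *ᵥ S.Ξ k t) ⬝ᵥ (M.C *ᵥ S.Ξ l t)
    + S.w k t ⬝ᵥ (M.U *ᵥ S.w l t)) fun k l =>
    (S.continuousOn_gram_integrand k l).add (S.continuousOn_control_integrand k l)]
  simp only [gram_pointwise, control_pointwise, mul_add, Finset.sum_add_distrib]

lemma gram_quadratic (h : EuclideanSpace ℝ (Fin p)) :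
    (h : Fin p → ℝ) ⬝ᵥ (S.gram *ᵥ h) = ∫ t in (0 : ℝ)..M.T,
      (M.C *ᵥ S.state h t) ⬝ᵥ (M.C *ᵥ S.state h t) := by
  rw [gram, integral_quadratic fun k l => S.continuousOn_gram_integrand k l]
  simp only [gram_pointwise]

lemma eq_zero_of_integral_eq_zero {T : ℝ} (hT : 0 < T) {φ : ℝ → ℝ} (hφ : ContinuousOn φ (Icc 0 T))
    (h0 : ∀ t, 0 ≤ φ t) (hi : ∫ t in (0 : ℝ)..T, φ t = 0) : ∀ t ∈ Icc 0 T, φ t = 0 := by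
  by_contra! hne
  obtain ⟨t, ht, hne⟩ := hne
  have := intervalIntegral.integral_pos hT hφ (fun t _ => h0 t)
    ⟨t, ht, lt_of_le_of_ne (h0 t) (Ne.symm hne)⟩
  exact this.ne' hi

lemma continuousOn_state (h : EuclideanSpace ℝ (Fin p)) : ContinuousOn (S.state h) (Icc 0 M.T) :=
  continuousOn_sum S.continuousOn_Ξ h

lemma continuousOn_control (h : EuclideanSpace ℝ (Fin p)) :
    ContinuousOn (S.control h) (Icc 0 M.T) := continuousOn_sum S.continuousOn_w h

lemma of_fisher_quadratic_eq_zero {h : EuclideanSpace ℝ (Fin p)}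
    (h0 : (h : Fin p → ℝ) ⬝ᵥ (S.fisher *ᵥ h) = 0) :
    ∀ t ∈ Icc 0 M.T, M.C *ᵥ S.state h t = 0 ∧ S.control h t = 0 := by
  rw [fisher_quadratic] at h0
  intro t ht
  have hC := ContinuousOn.const_mulVec M.C (S.continuousOn_state h)
  have h1 : (M.C *ᵥ S.state h t) ⬝ᵥ (M.C *ᵥ S.state h t)
      + S.control h t ⬝ᵥ (M.U *ᵥ S.control h t) = 0 := eq_zero_of_integral_eq_zero M.T_pos ((ContinuousOn.dotProd hC hC).add
    (ContinuousOn.dotProd (S.continuousOn_control h)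
      (ContinuousOn.const_mulVec M.U (S.continuousOn_control h))))
    (fun t => add_nonneg (dotProduct_self_nonneg' _) (M.U_quadratic_nonneg _)) h0 t ht
  obtain ⟨c, hc, hU⟩ := M.exists_U_lower_bound
  have h2 := sq_norm_le_dotProduct (M.C *ᵥ S.state h t)
  have h3 := hU (S.control h t)
  have h4 := sq_nonneg ‖M.C *ᵥ S.state h t‖
  have h5 : 0 ≤ c * ‖S.control h t‖ ^ 2 := by positivity
  constructor
  · rw [← norm_eq_zero]
    exact pow_eq_zero_iff two_ne_zero |>.1 (by linarith)
  · rw [← norm_eq_zero]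
    have : c * ‖S.control h t‖ ^ 2 = 0 := by linarith
    exact pow_eq_zero_iff two_ne_zero |>.1 ((mul_eq_zero.1 this).resolve_left hc.ne')

end Sensitivity

end TrackedLinearODE

/-! ### Positive definiteness of the Fisher and Gram matrices. -/

namespace TrackedLinearODE

variable {p d q m : ℕ} {M : Model p d q m} {Θ : Set (EuclideanSpace ℝ (Fin p))} {σ : ℝ}
  {θs : EuclideanSpace ℝ (Fin p)} {x₀s : Fin d → ℝ} {Xs : ℝ → Fin d → ℝ}

lemma norm_le_of_forced {T K ε : ℝ} (hK : 0 < K) (hε : 0 ≤ ε)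
    {a : ℝ → Matrix (Fin d) (Fin d) ℝ} (ha : ∀ t ∈ Icc 0 T, entrySum (a t) ≤ K)
    {D φ : ℝ → Fin d → ℝ} (hD : ∀ t ∈ Icc 0 T, HasDerivWithinAt D (a t *ᵥ D t + φ t) (Icc 0 T) t)
    (hφ : ∀ t ∈ Icc 0 T, ‖φ t‖ ≤ ε) (hD0 : D 0 = 0) :
    ∀ t ∈ Icc 0 T, ‖D t‖ ≤ Real.exp (K * T) / K * ε := by
  intro t ht
  have := norm_le_of_linear_ode hK hε hD (fun t ht => (norm_add_le _ _).trans (add_le_add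
    ((norm_mulVec_le _ _).trans (mul_le_mul_of_nonneg_right (ha t ht) (norm_nonneg _)))
    (hφ t ht))) t ht
  rw [hD0, norm_zero, zero_add] at this
  exact this.trans (le_of_eq (by ring))

namespace Conditions

lemma eventually_mem (hLC : Conditions M Θ σ θs x₀s Xs) :
    ∀ᶠ h : EuclideanSpace ℝ (Fin p) in 𝓝 0, θs + h ∈ Θ := by
  have : Tendsto (fun h : EuclideanSpace ℝ (Fin p) => θs + h) (𝓝 0) (𝓝 θs) := by
    have h : Continuous fun h : EuclideanSpace ℝ (Fin p) => θs + h := by fun_prop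
    simpa using h.tendsto 0
  exact this (mem_interior_iff_mem_nhds.1 hLC.lc4)

lemma profileCI_true (hLC : Conditions M Θ σ θs x₀s Xs) (hXs : M.IsSolution θs x₀s Xs) :
    M.profileCI σ (fun t => M.C *ᵥ Xs t) θs = q * σ ^ 2 := by
  refine le_antisymm ?_ (hLC.le_profileCI hLC.mem _)
  have := hLC.profileCI_le hLC.mem hXs (Y := fun t => M.C *ᵥ Xs t) (b := 0) (by simp)
  simpa using this

/-- The competitor keeps the initial value `x₀s` with no control; by Gronwall its trajectory is
within `O(‖h‖)` of the true one. -/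
lemma exists_profileCI_quadratic_bound (hLC : Conditions M Θ σ θs x₀s Xs) (hΘ : IsCompact Θ)
    (hXs : M.IsSolution θs x₀s Xs) (S : Sensitivity M θs Xs) :
    ∃ K, ∀ᶠ h : EuclideanSpace ℝ (Fin p) in 𝓝 0,
      M.profileCI σ (fun t => M.C *ᵥ Xs t) (θs + h) ≤ q * σ ^ 2 + K * ‖h‖ ^ 2 := by
  obtain ⟨K, hK0, hK⟩ := hLC.exists_bound_A hΘ
  obtain ⟨L, hL0, hL⟩ := S.exists_A_lipschitz_at
  obtain ⟨b, hb0, hb⟩ := ContinuousOn.exists_bound hXs.continuousOn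
  set c := entrySum M.C * (Real.exp (K * M.T) / K * (L * b)) with hc
  refine ⟨q * M.T * c ^ 2, ?_⟩
  filter_upwards [hLC.eventually_mem, hL] with h hh hLh
  obtain ⟨X, hX⟩ := hLC.exists_solution hh x₀s
  have hD := norm_le_of_forced (a := M.A (θs + h)) (D := fun t => X t - Xs t)
    (φ := fun t => (M.A (θs + h) t - M.A θs t) *ᵥ Xs t) hK0 (ε := L * ‖h‖ * b) (by positivity)
    (fun t ht => hK _ hh t ht) (fun t ht => by
      refine ((hX.2 t ht).sub (hXs.2 t ht)).congr_deriv ?_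
      rw [Matrix.mulVec_sub, Matrix.sub_mulVec]; abel)
    (fun t ht => (norm_mulVec_le _ _).trans
      (mul_le_mul (hLh t ht) (hb t ht) (norm_nonneg _) (by positivity)))
    (by simp [hX.1, hXs.1])
  have := hLC.profileCI_le hh hX (Y := fun t => M.C *ᵥ Xs t) (b := c * ‖h‖) (fun t ht => by
    rw [← Matrix.mulVec_sub]
    refine (norm_mulVec_le _ _).trans ((mul_le_mul_of_nonneg_left (hD t ht)
      (entrySum_nonneg _)).trans (le_of_eq ?_))
    rw [hc]; ring)
  exact this.trans (le_of_eq (by ring))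

/-- The competitor starts at `x₀s + S.state h 0`, with no control. As the sensitivity control
vanishes along `v`, its trajectory is `Xs + S.state h + o(r)`; as `C *ᵥ S.state v = 0`, the observed
error is `o(r)` and the cost increases by `o(r ^ 2)` only. -/
lemma profileCI_degenerate (hLC : Conditions M Θ σ θs x₀s Xs) (hΘ : IsCompact Θ)
    (hXs : M.IsSolution θs x₀s Xs) (S : Sensitivity M θs Xs) {v : EuclideanSpace ℝ (Fin p)}
    (hv : ∀ t ∈ Icc 0 M.T, M.C *ᵥ S.state v t = 0 ∧ S.control v t = 0) :
    (fun r : ℝ => M.profileCI σ (fun t => M.C *ᵥ Xs t) (θs + r • v) - q * σ ^ 2)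
      =o[𝓝 0] fun r : ℝ => r ^ 2 := by
  obtain ⟨K, hK0, hK⟩ := hLC.exists_bound_A hΘ
  obtain ⟨L, hL0, hL⟩ := S.exists_A_lipschitz_at
  obtain ⟨b, hb0, hb⟩ := ContinuousOn.exists_bound hXs.continuousOn
  obtain ⟨z, hz0, hz⟩ := Sensitivity.exists_bound_sum S.continuousOn_Ξ
  set c := entrySum M.C * (Real.exp (K * M.T) / K * (b + 1) * ‖v‖) with hc
  have hcr : Tendsto (fun r : ℝ => r • v) (𝓝 0) (𝓝 0) := by
    have : Continuous fun r : ℝ => r • v := by fun_prop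
    simpa using this.tendsto 0
  rw [Asymptotics.isLittleO_iff]
  intro η hη
  -- `ε ≤ 1` gives `ε * ε ≤ ε`, so one factor `ε` is enough to absorb the constant into `η`.
  set ε := min 1 (η / (q * M.T * c ^ 2 + 1)) with hεdef
  have hTp := M.T_pos
  have hε : 0 < ε := lt_min one_pos (by positivity)
  have hsmall : ∀ᶠ h : EuclideanSpace ℝ (Fin p) in 𝓝 0, L * z * ‖h‖ ≤ ε := by
    have : Tendsto (fun h : EuclideanSpace ℝ (Fin p) => L * z * ‖h‖) (𝓝 0) (𝓝 0) := by
      have h : Continuous fun h : EuclideanSpace ℝ (Fin p) => L * z * ‖h‖ := by fun_prop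
      simpa using h.tendsto 0
    exact this.eventually_le_const hε
  filter_upwards [hcr.eventually hLC.eventually_mem, hcr.eventually hL,
    hcr.eventually (S.G_deriv ε hε), hcr.eventually hsmall] with r hr hLr hGr hsr
  have hstate : ∀ t, S.state (r • v) t = r • S.state v t := fun t => by
    simp [Sensitivity.state, Finset.smul_sum, smul_smul]
  have hcontrol : ∀ t, S.control (r • v) t = r • S.control v t := fun t => by
    simp [Sensitivity.control, Finset.smul_sum, smul_smul]
  set h := r • v with hh
  obtain ⟨X, hX⟩ := hLC.exists_solution hr (x₀s + S.state h 0)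
  have hD := norm_le_of_forced (a := M.A (θs + h)) (D := fun t => X t - Xs t - S.state h t)
    (φ := fun t => (M.A (θs + h) t - M.A θs t - S.coeff h t) *ᵥ Xs t
      + (M.A (θs + h) t - M.A θs t) *ᵥ S.state h t) hK0 (ε := ε * ‖h‖ * (b + 1)) (by positivity)
    (fun t ht => hK _ hr t ht) (fun t ht => by
      refine (((hX.2 t ht).sub (hXs.2 t ht)).sub (S.state_deriv h t ht)).congr_deriv ?_
      rw [hcontrol, (hv t ht).2]
      simp only [smul_zero, Matrix.mulVec_zero, Matrix.mulVec_sub, Matrix.sub_mulVec]; abel)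
    (fun t ht => by
      have h1 : ‖(M.A (θs + h) t - M.A θs t - S.coeff h t) *ᵥ Xs t‖ ≤ ε * ‖h‖ * b :=
        (norm_mulVec_le _ _).trans (mul_le_mul (hGr t ht) (hb t ht) (norm_nonneg _)
          (by positivity))
      have h2 : ‖(M.A (θs + h) t - M.A θs t) *ᵥ S.state h t‖ ≤ L * ‖h‖ * (z * ‖h‖) :=
        (norm_mulVec_le _ _).trans (mul_le_mul (hLr t ht) (hz h t ht) (norm_nonneg _)
          (by positivity))
      have h3 : L * ‖h‖ * (z * ‖h‖) ≤ ε * ‖h‖ := by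
        calc _ = L * z * ‖h‖ * ‖h‖ := by ring
          _ ≤ _ := mul_le_mul_of_nonneg_right hsr (norm_nonneg _)
      linarith [norm_add_le ((M.A (θs + h) t - M.A θs t - S.coeff h t) *ᵥ Xs t)
        ((M.A (θs + h) t - M.A θs t) *ᵥ S.state h t)])
    (by simp [hX.1, hXs.1])
  have hup := hLC.profileCI_le hr hX (Y := fun t => M.C *ᵥ Xs t) (b := c * (ε * |r|))
    (fun t ht => by
      have h0 : M.C *ᵥ X t - M.C *ᵥ Xs t = M.C *ᵥ (X t - Xs t - S.state h t) := by
        rw [hstate, Matrix.mulVec_sub, Matrix.mulVec_sub, Matrix.mulVec_smul, (hv t ht).1]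
        simp
      rw [h0]
      refine (norm_mulVec_le _ _).trans ((mul_le_mul_of_nonneg_left (hD t ht)
        (entrySum_nonneg _)).trans (le_of_eq ?_))
      rw [hc, hh, norm_smul, Real.norm_eq_abs]; ring)
  have hlow := hLC.le_profileCI hr (fun t => M.C *ᵥ Xs t)
  rw [Real.norm_of_nonneg (sub_nonneg.2 hlow), Real.norm_of_nonneg (sq_nonneg r)]
  have hε1 : ε ≤ 1 := min_le_left _ _
  have hε2 : (q * M.T * c ^ 2 + 1) * ε ≤ η := by
    have := min_le_right 1 (η / (q * M.T * c ^ 2 + 1))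
    rw [le_div_iff₀ (by positivity)] at this
    linarith
  have hqc : 0 ≤ q * M.T * c ^ 2 := by positivity
  calc _ ≤ q * M.T * (c * (ε * |r|)) ^ 2 := by linarith
    _ = q * M.T * c ^ 2 * (ε * ε) * r ^ 2 := by rw [← sq_abs r]; ring
    _ ≤ η * r ^ 2 := by
      refine mul_le_mul_of_nonneg_right ?_ (sq_nonneg r)
      have : ε * ε ≤ ε := mul_le_of_le_one_right hε.le hε1
      nlinarith

/-- A null vector of `fisher` has unobserved sensitivity and zero control, so the profiled cost is
flat to second order in that direction; a nonsingular Hessian forbids this. -/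
lemma fisher_pos (hLC : Conditions M Θ σ θs x₀s Xs) (hΘ : IsCompact Θ)
    (hXs : M.IsSolution θs x₀s Xs) (S : Sensitivity M θs Xs) (v : Fin p → ℝ) (hv : v ≠ 0) :
    0 < v ⬝ᵥ (S.fisher *ᵥ v) := by
  set w : EuclideanSpace ℝ (Fin p) := WithLp.toLp 2 v with hw
  have h0 : 0 ≤ v ⬝ᵥ (S.fisher *ᵥ v) := by
    have := S.fisher_quadratic w
    refine le_of_le_of_eq ?_ this.symm
    exact intervalIntegral.integral_nonneg M.T_pos.le fun _ _ =>
      add_nonneg (dotProduct_self_nonneg' _) (M.U_quadratic_nonneg _)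
  refine lt_of_le_of_ne h0 fun heq => hv ?_
  obtain ⟨K, hK⟩ := hLC.exists_profileCI_quadratic_bound hΘ hXs S
  have hf := hLC.profileCI_true hXs
  have hw0 : w = 0 := eq_zero_of_isUnit_hessian (K := K) hLC.lc7
    (by
      filter_upwards [hLC.eventually_mem] with h hh
      rw [hf]
      exact hLC.le_profileCI hh _)
    (by
      filter_upwards [hK] with h hh
      rw [hf]; linarith)
    (by
      rw [hf]
      exact hLC.profileCI_degenerate hΘ hXs S (S.of_fisher_quadratic_eq_zero heq.symm))
  have := congrArg WithLp.ofLp hw0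
  simpa [hw] using this

/-- If `C *ᵥ S.state w` vanishes, the adjoint equation is homogeneous with zero final value, so the
adjoint and with it the control vanish. Then `v` is also a null vector of `fisher`. -/
lemma gram_pos (hLC : Conditions M Θ σ θs x₀s Xs) (hΘ : IsCompact Θ)
    (hXs : M.IsSolution θs x₀s Xs) (S : Sensitivity M θs Xs) (v : Fin p → ℝ) (hv : v ≠ 0) :
    0 < v ⬝ᵥ (S.gram *ᵥ v) := by
  set w : EuclideanSpace ℝ (Fin p) := WithLp.toLp 2 v with hw
  have hg := S.gram_quadratic w
  have h0 : 0 ≤ v ⬝ᵥ (S.gram *ᵥ v) := by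
    refine le_of_le_of_eq ?_ hg.symm
    exact intervalIntegral.integral_nonneg M.T_pos.le fun _ _ => dotProduct_self_nonneg' _
  refine lt_of_le_of_ne h0 fun heq => ?_
  have hC := ContinuousOn.const_mulVec M.C (S.continuousOn_state w)
  have hC0 : ∀ t ∈ Icc 0 M.T, M.C *ᵥ S.state w t = 0 := fun t ht => by
    have h1 := Sensitivity.eq_zero_of_integral_eq_zero M.T_pos (ContinuousOn.dotProd hC hC)
      (fun t => dotProduct_self_nonneg' _) (hg.symm.trans heq.symm) t ht
    have h2 := sq_norm_le_dotProduct (M.C *ᵥ S.state w t)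
    rw [h1] at h2
    exact norm_eq_zero.1 (pow_eq_zero_iff two_ne_zero |>.1 (le_antisymm h2 (sq_nonneg _)))
  have hP := linear_ode_eq_zero_backward (a := fun t => -(M.A θs t)ᵀ)
    (fun i j => (hLC.continuousOn_A hLC.mem j i).neg) (X := S.adjoint w)
    (fun t ht => (S.adjoint_deriv w t ht).congr_deriv
      (by rw [hC0 t ht, Matrix.mulVec_zero, sub_zero, Matrix.neg_mulVec]))
    (S.adjoint_last w)
  have hfz : v ⬝ᵥ (S.fisher *ᵥ v) = 0 := by
    have hfq := S.fisher_quadratic w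
    refine hfq.trans ?_
    rw [intervalIntegral.integral_congr (g := fun _ => 0)]
    · simp
    · intro t ht
      rw [uIcc_of_le M.T_pos.le] at ht
      simp [hC0 t ht, S.U_mulVec_control, hP t ht]
  exact (hLC.fisher_pos hΘ hXs S v hv).ne' hfz

end Conditions

end TrackedLinearODE

namespace TrackedLinearODE

namespace Model

variable {p d q m : ℕ} (M : Model p d q m)

/-! ### The discretized problem -/

/-- The control part `Δ ∑_{i < n} u_iᵀ U u_i` of the discretized cost. -/
noncomputable def energy (n : ℕ) (u : ℕ → Fin m → ℝ) : ℝ :=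
  ∑ i ∈ Finset.range n, M.mesh n * (u i ⬝ᵥ (M.U *ᵥ u i))

/-- The part of the discretized cost which depends on the parameters. -/
noncomputable def excess (n : ℕ) (Xs : ℝ → Fin d → ℝ) (e : ℕ → Fin q → ℝ)
    (θ : EuclideanSpace ℝ (Fin p)) (x : Fin d → ℝ) (u : ℕ → Fin m → ℝ) : ℝ :=
  M.pair n (fun i => M.C *ᵥ M.discreteState n θ x u i - M.C *ᵥ Xs (M.time n i))
      (fun i => M.C *ᵥ M.discreteState n θ x u i - M.C *ᵥ Xs (M.time n i))
    - 2 * M.pair n (fun i => M.C *ᵥ M.discreteState n θ x u i - M.C *ᵥ Xs (M.time n i)) e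
    + M.energy n u

lemma pair_add_left (n : ℕ) (x y z : ℕ → Fin q → ℝ) :
    M.pair n (fun i => x i + y i) z = M.pair n x z + M.pair n y z := by
  simp [pair, add_dotProduct, mul_add, Finset.sum_add_distrib]

lemma pair_sub_left (n : ℕ) (x y z : ℕ → Fin q → ℝ) :
    M.pair n (fun i => x i - y i) z = M.pair n x z - M.pair n y z := by
  simp [pair, sub_dotProduct, mul_sub, Finset.sum_sub_distrib]

lemma pair_add_right (n : ℕ) (x y z : ℕ → Fin q → ℝ) :
    M.pair n z (fun i => x i + y i) = M.pair n z x + M.pair n z y := by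
  simp [pair, dotProduct_add, mul_add, Finset.sum_add_distrib]

lemma pair_sub_right (n : ℕ) (x y z : ℕ → Fin q → ℝ) :
    M.pair n z (fun i => x i - y i) = M.pair n z x - M.pair n z y := by
  simp [pair, dotProduct_sub, mul_sub, Finset.sum_sub_distrib]

lemma pair_comm (n : ℕ) (x y : ℕ → Fin q → ℝ) : M.pair n x y = M.pair n y x := by
  simp [pair, dotProduct_comm]

lemma pair_add_self (n : ℕ) (x y : ℕ → Fin q → ℝ) :
    M.pair n (fun i => x i + y i) (fun i => x i + y i)
      = M.pair n x x + 2 * M.pair n x y + M.pair n y y := by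
  rw [pair_add_left, pair_add_right, pair_add_right, M.pair_comm n y x]
  ring

lemma pair_sub_self (n : ℕ) (x y : ℕ → Fin q → ℝ) :
    M.pair n (fun i => x i - y i) (fun i => x i - y i)
      = M.pair n x x - 2 * M.pair n x y + M.pair n y y := by
  rw [pair_sub_left, pair_sub_right, pair_sub_right, M.pair_comm n y x]
  ring

lemma pair_self_nonneg (n : ℕ) (x : ℕ → Fin q → ℝ) : 0 ≤ M.pair n x x :=
  Finset.sum_nonneg fun _ _ => mul_nonneg (M.mesh_nonneg n) (dotProduct_self_nonneg' _)

/-- The last term does not involve the unknowns, so cost and excess have the same near minimizers.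
-/
lemma discreteCost_eq_excess (n : ℕ) (Xs : ℝ → Fin d → ℝ) (e : ℕ → Fin q → ℝ)
    (θ : EuclideanSpace ℝ (Fin p)) (x : Fin d → ℝ) (u : ℕ → Fin m → ℝ) :
    M.discreteCost n (fun i => M.C *ᵥ Xs (M.time n i) + e i) θ x u
      = M.excess n Xs e θ x u + M.pair n e e := by
  have h : M.pair n (fun i => M.C *ᵥ M.discreteState n θ x u i
        - (M.C *ᵥ Xs (M.time n i) + e i))
      (fun i => M.C *ᵥ M.discreteState n θ x u i - (M.C *ᵥ Xs (M.time n i) + e i))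
      = M.pair n (fun i => M.C *ᵥ M.discreteState n θ x u i - M.C *ᵥ Xs (M.time n i))
      (fun i => M.C *ᵥ M.discreteState n θ x u i - M.C *ᵥ Xs (M.time n i))
      - 2 * M.pair n (fun i => M.C *ᵥ M.discreteState n θ x u i - M.C *ᵥ Xs (M.time n i)) e
      + M.pair n e e := by
    simp only [← sub_sub]
    exact M.pair_sub_self n _ e
  unfold excess
  change M.pair n _ _ + M.energy n u = _
  rw [h]
  ring

lemma energy_nonneg (n : ℕ) (u : ℕ → Fin m → ℝ) : 0 ≤ M.energy n u :=
  Finset.sum_nonneg fun _ _ => mul_nonneg (M.mesh_nonneg n) (M.U_quadratic_nonneg _)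

lemma exists_energy_lower_bound : ∃ c, 0 < c ∧ ∀ n u, c * M.l2 n u ^ 2 ≤ M.energy n u := by
  obtain ⟨c, hc, h⟩ := M.exists_U_lower_bound
  refine ⟨c, hc, fun n u => ?_⟩
  rw [M.sq_l2, Finset.mul_sum]
  refine Finset.sum_le_sum fun i _ => ?_
  calc _ = M.mesh n * (c * ‖u i‖ ^ 2) := by ring
    _ ≤ _ := mul_le_mul_of_nonneg_left (h _) (M.mesh_nonneg n)

lemma discreteState_succ (n : ℕ) (θ : EuclideanSpace ℝ (Fin p)) (x : Fin d → ℝ)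
    (u : ℕ → Fin m → ℝ) (i : ℕ) : M.discreteState n θ x u (i + 1) = M.discreteState n θ x u i
      + M.mesh n • (M.A θ (M.time n i) *ᵥ M.discreteState n θ x u i + M.B *ᵥ u i) := by
  rw [discreteState, Matrix.add_mulVec, Matrix.one_mulVec, Matrix.smul_mulVec, smul_add, add_assoc]

/-- Homogeneity permits the normalizations in the compactness arguments. -/
lemma discreteState_smul (n : ℕ) (θ : EuclideanSpace ℝ (Fin p)) (x : Fin d → ℝ)
    (u : ℕ → Fin m → ℝ) (c : ℝ) (i : ℕ) :
    M.discreteState n θ (c • x) (fun i => c • u i) i = c • M.discreteState n θ x u i := by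
  induction i with
  | zero => rfl
  | succ i ih =>
    simp only [discreteState_succ, ih, Matrix.mulVec_smul, smul_add, smul_comm c (M.mesh n)]

lemma l2_smul {a : ℕ} (n : ℕ) (u : ℕ → Fin a → ℝ) {c : ℝ} (hc : 0 ≤ c) :
    M.l2 n (fun i => c • u i) = c * M.l2 n u := by
  unfold l2
  rw [← Real.sqrt_sq hc, ← Real.sqrt_mul (sq_nonneg _), Real.sqrt_sq hc, Finset.mul_sum]
  congr 1
  refine Finset.sum_congr rfl fun i _ => ?_
  rw [norm_smul, mul_pow, Real.norm_eq_abs, sq_abs]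
  ring

lemma energy_smul (n : ℕ) (u : ℕ → Fin m → ℝ) (c : ℝ) :
    M.energy n (fun i => c • u i) = c ^ 2 * M.energy n u := by
  simp only [energy, Finset.mul_sum, Matrix.mulVec_smul, dotProduct_smul, smul_dotProduct,
    smul_eq_mul]
  exact Finset.sum_congr rfl fun i _ => by ring

lemma pair_smul_self (n : ℕ) (x : ℕ → Fin q → ℝ) (c : ℝ) :
    M.pair n (fun i => c • x i) (fun i => c • x i) = c ^ 2 * M.pair n x x := by
  simp only [pair, Finset.mul_sum, dotProduct_smul, smul_dotProduct, smul_eq_mul]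
  exact Finset.sum_congr rfl fun i _ => by ring

lemma abs_pair_le (n : ℕ) {x y : ℕ → Fin q → ℝ} {a b : ℝ} (hx : ∀ i ≤ n, ‖x i‖ ≤ a)
    (hy : ∀ i ≤ n, ‖y i‖ ≤ b) : |M.pair n x y| ≤ q * (M.T + M.mesh n) * (a * b) := by
  have ha : 0 ≤ a := (norm_nonneg _).trans (hx 0 n.zero_le)
  have hb : 0 ≤ b := (norm_nonneg _).trans (hy 0 n.zero_le)
  calc |M.pair n x y| ≤ ∑ i ∈ Finset.range (n + 1), M.mesh n * (q * (a * b)) := by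
        refine (Finset.abs_sum_le_sum_abs _ _).trans (Finset.sum_le_sum fun i hi => ?_)
        have hi' : i ≤ n := Nat.lt_succ_iff.1 (Finset.mem_range.1 hi)
        rw [abs_mul, abs_of_nonneg (M.mesh_nonneg n)]
        refine mul_le_mul_of_nonneg_left ((abs_dotProduct_le _ _).trans ?_) (M.mesh_nonneg n)
        exact mul_le_mul_of_nonneg_left (mul_le_mul (hx i hi') (hy i hi') (norm_nonneg _) ha)
          q.cast_nonneg
    _ ≤ M.T * (q * (a * b)) + M.mesh n * (q * (a * b)) := by
        rw [Finset.sum_range_succ]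
        exact add_le_add (M.sum_mesh_le n _ (by positivity)) le_rfl
    _ = _ := by ring

lemma mesh_le {n : ℕ} (hn : 0 < n) : M.mesh n ≤ M.T := by
  have h := M.natCast_mul_mesh hn
  have h1 : (1 : ℝ) ≤ n := Nat.one_le_cast.2 hn
  nlinarith [M.mesh_nonneg n]

lemma pair_self_add_le (n : ℕ) (x y : ℕ → Fin q → ℝ) :
    M.pair n (fun i => x i + y i) (fun i => x i + y i) ≤ 2 * M.pair n x x + 2 * M.pair n y y := by
  have h1 := M.pair_add_self n x y
  have h2 := M.pair_sub_self n x y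
  linarith [M.pair_self_nonneg n fun i => x i - y i]

lemma norm_discreteState_le {K : ℝ} (hK : 0 ≤ K) {θ : EuclideanSpace ℝ (Fin p)}
    (hA : ∀ t ∈ Icc 0 M.T, entrySum (M.A θ t) ≤ K) (n : ℕ) (x : Fin d → ℝ) (u : ℕ → Fin m → ℝ) :
    ∀ i ≤ n, ‖M.discreteState n θ x u i‖
      ≤ Real.exp (K * M.T) * (1 + entrySum M.B * √M.T) * (‖x‖ + M.l2 n u) := by
  intro i hi
  have h := norm_le_of_discrete_linear (M.mesh_nonneg n) hK
    (fun i _ => M.discreteState_succ n θ x u i) (n := n)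
    (fun i hi => hA _ (M.time_mem n hi.le)) i hi
  refine h.trans ?_
  have hB := entrySum_nonneg M.B
  have hl := M.l2_nonneg n u
  have hm := M.mesh_nonneg n
  have h1 : ∑ j ∈ Finset.range n, M.mesh n * ‖M.B *ᵥ u j‖
      ≤ entrySum M.B * (√M.T * M.l2 n u) := by
    refine le_trans ?_ (mul_le_mul_of_nonneg_left (M.sum_mesh_mul_norm_le n u) hB)
    rw [Finset.mul_sum]
    refine Finset.sum_le_sum fun j _ => ?_
    calc _ ≤ M.mesh n * (entrySum M.B * ‖u j‖) :=
          mul_le_mul_of_nonneg_left (norm_mulVec_le _ _) (M.mesh_nonneg n)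
      _ = _ := by ring
  have h2 : Real.exp (K * (n * M.mesh n)) ≤ Real.exp (K * M.T) :=
    Real.exp_le_exp.2 (mul_le_mul_of_nonneg_left (M.natCast_mul_mesh_le n) hK)
  calc _ ≤ Real.exp (K * M.T) * (‖x‖ + entrySum M.B * (√M.T * M.l2 n u)) := by
        refine mul_le_mul h2 (add_le_add le_rfl h1) (by positivity) (Real.exp_pos _).le
    _ ≤ Real.exp (K * M.T) * ((1 + entrySum M.B * √M.T) * (‖x‖ + M.l2 n u)) := by
        refine mul_le_mul_of_nonneg_left ?_ (Real.exp_pos _).le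
        have : 0 ≤ entrySum M.B * √M.T * ‖x‖ := by positivity
        nlinarith
    _ = _ := by ring

lemma exists_pair_state_noise_bound {K : ℝ} (hK : 0 ≤ K) : ∃ c, 0 ≤ c ∧
    ∀ θ, (∀ t ∈ Icc 0 M.T, entrySum (M.A θ t) ≤ K) → ∀ n x u e,
    |M.pair n (fun i => M.C *ᵥ M.discreteState n θ x u i) e|
      ≤ c * ((‖x‖ + M.l2 n u) * M.noiseSize n e) := by
  set K₁ := Real.exp (K * M.T) * (1 + entrySum M.B * √M.T) with hK₁
  have hB := entrySum_nonneg M.B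
  have hC := entrySum_nonneg M.C
  have hK₁0 : 0 ≤ K₁ := by positivity
  refine ⟨q * (entrySum M.C * (K₁ + K * K₁ * √M.T + entrySum M.B)), by positivity,
    fun θ hA n x u e => ?_⟩
  have hx := M.norm_discreteState_le hK hA n x u
  rw [← hK₁] at hx
  have hl := M.l2_nonneg n u
  have hN := M.noiseSize_nonneg n e
  set b := ‖x‖ + M.l2 n u with hb
  have hb0 : 0 ≤ b := by positivity
  have hlb : M.l2 n u ≤ b := le_add_of_nonneg_left (norm_nonneg _)
  have h := M.abs_pair_noise_le n (fun i => M.C *ᵥ M.discreteState n θ x u i) e u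
    (b₀ := entrySum M.C * (K₁ * b)) (b₁ := entrySum M.C * (K * (K₁ * b)))
    (b₂ := entrySum M.C * entrySum M.B) (by positivity) (by positivity)
    ((norm_mulVec_le _ _).trans (mul_le_mul_of_nonneg_left (hx n le_rfl) hC))
    (fun i hi => by
      rw [← Matrix.mulVec_sub, M.discreteState_succ, add_sub_cancel_left, Matrix.mulVec_smul,
        norm_smul, Real.norm_of_nonneg (M.mesh_nonneg n)]
      refine mul_le_mul_of_nonneg_left ((norm_mulVec_le _ _).trans ?_) (M.mesh_nonneg n)
      have h1 : ‖M.A θ (M.time n i) *ᵥ M.discreteState n θ x u i‖ ≤ K * (K₁ * b) :=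
        (norm_mulVec_le _ _).trans (mul_le_mul (hA _ (M.time_mem n hi.le)) (hx i hi.le)
          (norm_nonneg _) hK)
      refine (mul_le_mul_of_nonneg_left ((norm_add_le _ _).trans (add_le_add h1
        (norm_mulVec_le _ _))) hC).trans (le_of_eq (by ring)))
  refine h.trans ?_
  have h2 : entrySum M.C * entrySum M.B * M.l2 n u ≤ entrySum M.C * entrySum M.B * b := by gcongr
  calc _ ≤ q * ((entrySum M.C * (K₁ * b) + entrySum M.C * (K * (K₁ * b)) * √M.T
        + entrySum M.C * entrySum M.B * b) * M.noiseSize n e) := by gcongr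
    _ = _ := by ring

lemma abs_pair_curve_noise_le {Z Z' : ℝ → Fin d → ℝ} {b₀ b₁ : ℝ} (hb₁ : 0 ≤ b₁)
    (hZ : ∀ t ∈ Icc 0 M.T, HasDerivWithinAt Z (Z' t) (Icc 0 M.T) t)
    (hZ₀ : ∀ t ∈ Icc 0 M.T, ‖Z t‖ ≤ b₀) (hZ₁ : ∀ t ∈ Icc 0 M.T, ‖Z' t‖ ≤ b₁) (n : ℕ)
    (e : ℕ → Fin q → ℝ) :
    |M.pair n (fun i => M.C *ᵥ Z (M.time n i)) e|
      ≤ q * (entrySum M.C * (b₀ + b₁ * √M.T)) * M.noiseSize n e := by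
  have hC := entrySum_nonneg M.C
  -- A differentiable curve has no control part: a dummy control with values in `ℝ⁰` and `b₂ = 0` is
  -- used.
  have h := M.abs_pair_noise_le (a := 0) n (fun i => M.C *ᵥ Z (M.time n i)) e 0
    (b₀ := entrySum M.C * b₀) (b₁ := entrySum M.C * b₁) (b₂ := 0) (by positivity) le_rfl
    ((norm_mulVec_le _ _).trans (mul_le_mul_of_nonneg_left (hZ₀ _ (M.time_mem n le_rfl)) hC))
    (fun i hi => by
      rw [← Matrix.mulVec_sub, zero_mul, add_zero]
      refine (norm_mulVec_le _ _).trans ?_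
      have h1 := (convex_Icc 0 M.T).norm_image_sub_le_of_norm_hasDerivWithin_le hZ hZ₁
        (M.time_mem n hi.le) (M.time_mem n (Nat.succ_le_of_lt hi))
      rw [M.time_succ, add_sub_cancel_left, Real.norm_of_nonneg (M.mesh_nonneg n)] at h1
      rw [M.time_succ]
      calc _ ≤ entrySum M.C * (b₁ * M.mesh n) := mul_le_mul_of_nonneg_left h1 hC
        _ = _ := by ring)
  refine h.trans (le_of_eq ?_)
  ring

end Model

variable {p d q m : ℕ} {M : Model p d q m} {Θ : Set (EuclideanSpace ℝ (Fin p))} {σ : ℝ}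
  {θs : EuclideanSpace ℝ (Fin p)} {x₀s : Fin d → ℝ} {Xs : ℝ → Fin d → ℝ}

/-! ### Limits of discretized trajectories and of their residuals. -/

namespace Conditions

/-- Stability of the scheme: the discrete Gronwall bound is applied to the difference, which is
forced by the change of coefficients, the vanishing control and the Euler defect of the limit. -/
lemma eventually_discreteState_close (hLC : Conditions M Θ σ θs x₀s Xs) (hΘ : IsCompact Θ)
    {n : ℕ → ℕ} (hn : Tendsto n atTop atTop) {θ : ℕ → EuclideanSpace ℝ (Fin p)}
    (hθ : ∀ k, θ k ∈ Θ) {θ' : EuclideanSpace ℝ (Fin p)} (hθ' : θ' ∈ Θ)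
    (hθθ' : Tendsto θ atTop (𝓝 θ')) {x : ℕ → Fin d → ℝ} {x' : Fin d → ℝ}
    (hx : Tendsto x atTop (𝓝 x')) {u : ℕ → ℕ → Fin m → ℝ}
    (hu : Tendsto (fun k => M.l2 (n k) (u k)) atTop (𝓝 0)) {X : ℝ → Fin d → ℝ}
    (hX : M.IsSolution θ' x' X) {ε : ℝ} (hε : 0 < ε) :
    ∀ᶠ k in atTop, ∀ i ≤ n k,
      ‖M.discreteState (n k) (θ k) (x k) (u k) i - X (M.time (n k) i)‖ ≤ ε := by
  obtain ⟨K, hK0, hK⟩ := hLC.exists_bound_A hΘ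
  obtain ⟨b, hb0, hb⟩ := ContinuousOn.exists_bound hX.continuousOn
  have hTp := M.T_pos
  have hB := entrySum_nonneg M.B
  have hXc : ContinuousOn (fun t => M.A θ' t *ᵥ X t) (Icc 0 M.T) :=
    ContinuousOn.matrix_mulVec (hLC.continuousOn_A hθ') hX.continuousOn
  -- Gronwall factor times the weights of the four errors, each of size `η`: initial value (`1`),
  -- coefficients (`T * b`), Euler defect (`T`) and control (`entrySum M.B * √T`). The total is `κ *
  -- η = ε`.
  set κ := Real.exp (K * M.T) * (1 + M.T * (b + 1) + entrySum M.B * √M.T) with hκ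
  have hκ0 : 0 < κ := by positivity
  set η := ε / κ with hη
  have hη0 : 0 < η := by positivity
  have hθw : Tendsto θ atTop (𝓝[Θ] θ') :=
    tendsto_nhdsWithin_iff.2 ⟨hθθ', Eventually.of_forall hθ⟩
  filter_upwards [hθw.eventually (hLC.eventually_A_close hθ' hη0),
    hn.eventually (M.eventually_euler_consistent hX.2 hXc hη0),
    hn.eventually (eventually_gt_atTop 0),
    hu.eventually_le_const hη0,
    (tendsto_iff_norm_sub_tendsto_zero.1 hx).eventually_le_const hη0] with k hA hτ hnk huk hxk i hi
  have hmesh := M.mesh_pos hnk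
  set δ := M.mesh (n k) with hδ
  set τ : ℕ → Fin d → ℝ := fun i => X (M.time (n k) (i + 1)) - X (M.time (n k) i)
    - δ • (M.A θ' (M.time (n k) i) *ᵥ X (M.time (n k) i)) with hτdef
  have hrec := norm_le_of_discrete_linear (n := n k) hmesh.le hK0.le
    (a := fun i => M.A (θ k) (M.time (n k) i))
    (x := fun i => M.discreteState (n k) (θ k) (x k) (u k) i - X (M.time (n k) i))
    (f := fun i => (M.A (θ k) (M.time (n k) i) - M.A θ' (M.time (n k) i)) *ᵥ X (M.time (n k) i)
      + M.B *ᵥ u k i - δ⁻¹ • τ i)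
    (fun i hi => by
      have hτ' : δ • δ⁻¹ • τ i = τ i := smul_inv_smul₀ hmesh.ne' _
      rw [M.discreteState_succ, ← hδ]
      simp only [smul_add, smul_sub, Matrix.mulVec_sub, Matrix.sub_mulVec, hτ']
      simp only [hτdef]
      abel)
    (fun i hi => hK _ (hθ k) _ (M.time_mem _ hi.le)) i hi
  refine hrec.trans ?_
  have hexp : Real.exp (K * (n k * δ)) = Real.exp (K * M.T) := by rw [M.natCast_mul_mesh hnk]
  rw [hexp]
  have h0 : ‖M.discreteState (n k) (θ k) (x k) (u k) 0 - X (M.time (n k) 0)‖ ≤ η := by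
    rw [M.time_zero, hX.1]; exact hxk
  have hsum : ∑ j ∈ Finset.range (n k), δ * ‖(M.A (θ k) (M.time (n k) j)
      - M.A θ' (M.time (n k) j)) *ᵥ X (M.time (n k) j) + M.B *ᵥ u k j - δ⁻¹ • τ j‖
      ≤ M.T * (η * (b + 1)) + entrySum M.B * (√M.T * η) := by
    have hs1 : ∀ j ∈ Finset.range (n k), δ * ‖(M.A (θ k) (M.time (n k) j)
        - M.A θ' (M.time (n k) j)) *ᵥ X (M.time (n k) j) + M.B *ᵥ u k j - δ⁻¹ • τ j‖
        ≤ δ * (η * (b + 1)) + entrySum M.B * (δ * ‖u k j‖) := fun j hj => by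
      have hj' := Finset.mem_range.1 hj
      have h1 : ‖(M.A (θ k) (M.time (n k) j) - M.A θ' (M.time (n k) j)) *ᵥ X (M.time (n k) j)‖
          ≤ η * b := (norm_mulVec_le _ _).trans (mul_le_mul (hA _ (M.time_mem _ hj'.le))
            (hb _ (M.time_mem _ hj'.le)) (norm_nonneg _) hη0.le)
      have h2 : ‖M.B *ᵥ u k j‖ ≤ entrySum M.B * ‖u k j‖ := norm_mulVec_le _ _
      have h3 : ‖δ⁻¹ • τ j‖ ≤ η := by
        rw [norm_smul, norm_inv, Real.norm_of_nonneg hmesh.le, inv_mul_le_iff₀ hmesh]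
        exact hτ j hj'
      calc _ ≤ δ * (η * b + entrySum M.B * ‖u k j‖ + η) := by
            refine mul_le_mul_of_nonneg_left ((norm_sub_le _ _).trans (add_le_add
              ((norm_add_le _ _).trans (add_le_add h1 h2)) h3)) hmesh.le
        _ = _ := by ring
    refine (Finset.sum_le_sum hs1).trans ?_
    rw [Finset.sum_add_distrib]
    refine add_le_add (M.sum_mesh_le _ _ (by positivity)) ?_
    rw [← Finset.mul_sum]
    refine mul_le_mul_of_nonneg_left ?_ hB
    exact (M.sum_mesh_mul_norm_le _ _).trans
      (mul_le_mul_of_nonneg_left huk (Real.sqrt_nonneg _))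
  calc _ ≤ Real.exp (K * M.T) * (η + (M.T * (η * (b + 1)) + entrySum M.B * (√M.T * η))) :=
        mul_le_mul_of_nonneg_left (add_le_add h0 hsum) (Real.exp_pos _).le
    _ = κ * η := by rw [hκ]; ring
    _ = ε := by rw [hη]; field_simp
    _ ≤ ε := le_rfl

/-- The factor `y k` in front of the signal makes the lemma fit for rescaled sequences: `y' = 0`
yields an unobserved limit trajectory, `y' ≠ 0` a multiple of the true signal. -/
lemma observed_eq_of_tendsto (hLC : Conditions M Θ σ θs x₀s Xs) (hΘ : IsCompact Θ)
    (hXs : M.IsSolution θs x₀s Xs)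
    {n : ℕ → ℕ} (hn : Tendsto n atTop atTop) {θ : ℕ → EuclideanSpace ℝ (Fin p)}
    (hθ : ∀ k, θ k ∈ Θ) {θ' : EuclideanSpace ℝ (Fin p)} (hθ' : θ' ∈ Θ)
    (hθθ' : Tendsto θ atTop (𝓝 θ')) {x : ℕ → Fin d → ℝ} {x' : Fin d → ℝ}
    (hx : Tendsto x atTop (𝓝 x')) {u : ℕ → ℕ → Fin m → ℝ}
    (hu : Tendsto (fun k => M.l2 (n k) (u k)) atTop (𝓝 0)) {y : ℕ → ℝ} {y' : ℝ}
    (hy : Tendsto y atTop (𝓝 y')) {X : ℝ → Fin d → ℝ} (hX : M.IsSolution θ' x' X)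
    (hres : Tendsto (fun k => M.pair (n k)
      (fun i => M.C *ᵥ M.discreteState (n k) (θ k) (x k) (u k) i
        - y k • (M.C *ᵥ Xs (M.time (n k) i)))
      (fun i => M.C *ᵥ M.discreteState (n k) (θ k) (x k) (u k) i
        - y k • (M.C *ᵥ Xs (M.time (n k) i)))) atTop (𝓝 0)) :
    ∀ t ∈ Icc 0 M.T, M.C *ᵥ X t = y' • (M.C *ᵥ Xs t) := by
  have hTp := M.T_pos
  obtain ⟨b, hb0, hb⟩ := ContinuousOn.exists_bound
    (ContinuousOn.const_mulVec M.C hXs.continuousOn)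
  set v : ℝ → Fin q → ℝ := fun t => M.C *ᵥ X t - y' • (M.C *ᵥ Xs t) with hv
  have hvc : ContinuousOn v (Icc 0 M.T) := (ContinuousOn.const_mulVec M.C hX.continuousOn).sub
    ((ContinuousOn.const_mulVec M.C hXs.continuousOn).const_smul y')
  have hR := (M.tendsto_riemann_sum_succ (ContinuousOn.dotProd hvc hvc)).comp hn
  have hC := entrySum_nonneg M.C
  have hzero : ∫ t in (0 : ℝ)..M.T, v t ⬝ᵥ v t = 0 := by
    refine le_antisymm (le_of_forall_pos_le_add fun η hη => ?_)
      (intervalIntegral.integral_nonneg hTp.le fun _ _ => dotProduct_self_nonneg' _)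
    -- a uniform closeness level for the residuals
    obtain ⟨ε, hε, hεη⟩ : ∃ ε : ℝ, 0 < ε ∧
        2 * (q * (M.T + M.T) * ((entrySum M.C + b) * ε * ((entrySum M.C + b) * ε))) ≤ η / 2 := by
      have hc : Tendsto (fun ε : ℝ => 2 * (q * (M.T + M.T) *
          ((entrySum M.C + b) * ε * ((entrySum M.C + b) * ε)))) (𝓝[>] 0) (𝓝 0) := by
        have h : Continuous fun ε : ℝ => 2 * (q * (M.T + M.T) *
          ((entrySum M.C + b) * ε * ((entrySum M.C + b) * ε))) := by fun_prop
        have := h.tendsto 0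
        simp only [mul_zero] at this
        exact this.mono_left nhdsWithin_le_nhds
      obtain ⟨ε, h1, h2⟩ := ((hc.eventually_le_const (half_pos hη)).and
        self_mem_nhdsWithin).exists
      exact ⟨ε, h2, h1⟩
    rw [zero_add]
    refine le_of_tendsto hR ?_
    filter_upwards [hLC.eventually_discreteState_close hΘ hn hθ hθ' hθθ' hx hu hX hε,
      hres.eventually_le_const (show (0 : ℝ) < η / 4 by linarith),
      (tendsto_iff_norm_sub_tendsto_zero.1 hy).eventually_le_const hε,
      hn.eventually (eventually_gt_atTop 0)] with k hk1 hk2 hk3 hk4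
    -- At each grid point `v` is the residual, small in mean square, plus a uniformly small
    -- correction.
    have hle := M.pair_self_add_le (n k) (fun i => M.C *ᵥ M.discreteState (n k) (θ k) (x k) (u k) i
        - y k • (M.C *ᵥ Xs (M.time (n k) i)))
      (fun i => -(M.C *ᵥ (M.discreteState (n k) (θ k) (x k) (u k) i - X (M.time (n k) i)))
        + (y k - y') • (M.C *ᵥ Xs (M.time (n k) i)))
    have heq : M.pair (n k) (fun i => (M.C *ᵥ M.discreteState (n k) (θ k) (x k) (u k) i
        - y k • (M.C *ᵥ Xs (M.time (n k) i))) +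
        (-(M.C *ᵥ (M.discreteState (n k) (θ k) (x k) (u k) i - X (M.time (n k) i)))
        + (y k - y') • (M.C *ᵥ Xs (M.time (n k) i))))
        (fun i => (M.C *ᵥ M.discreteState (n k) (θ k) (x k) (u k) i
        - y k • (M.C *ᵥ Xs (M.time (n k) i))) +
        (-(M.C *ᵥ (M.discreteState (n k) (θ k) (x k) (u k) i - X (M.time (n k) i)))
        + (y k - y') • (M.C *ᵥ Xs (M.time (n k) i))))
        = ∑ i ∈ Finset.range (n k + 1), M.mesh (n k) *
          (v (M.time (n k) i) ⬝ᵥ v (M.time (n k) i)) := by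
      refine Finset.sum_congr rfl fun i _ => ?_
      have : (M.C *ᵥ M.discreteState (n k) (θ k) (x k) (u k) i
        - y k • (M.C *ᵥ Xs (M.time (n k) i))) +
        (-(M.C *ᵥ (M.discreteState (n k) (θ k) (x k) (u k) i - X (M.time (n k) i)))
        + (y k - y') • (M.C *ᵥ Xs (M.time (n k) i))) = v (M.time (n k) i) := by
        simp only [hv, Matrix.mulVec_sub, sub_smul]; abel
      beta_reduce
      rw [this]
    rw [heq] at hle
    have hsmall := M.abs_pair_le (n k) (x := fun i =>
        -(M.C *ᵥ (M.discreteState (n k) (θ k) (x k) (u k) i - X (M.time (n k) i)))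
        + (y k - y') • (M.C *ᵥ Xs (M.time (n k) i))) (y := fun i =>
        -(M.C *ᵥ (M.discreteState (n k) (θ k) (x k) (u k) i - X (M.time (n k) i)))
        + (y k - y') • (M.C *ᵥ Xs (M.time (n k) i))) (a := (entrySum M.C + b) * ε)
        (b := (entrySum M.C + b) * ε)
    have hb' : ∀ i ≤ n k,
        ‖-(M.C *ᵥ (M.discreteState (n k) (θ k) (x k) (u k) i - X (M.time (n k) i)))
        + (y k - y') • (M.C *ᵥ Xs (M.time (n k) i))‖ ≤ (entrySum M.C + b) * ε := fun i hi => by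
      refine (norm_add_le _ _).trans ?_
      rw [norm_neg, norm_smul]
      have h1 := (norm_mulVec_le M.C (M.discreteState (n k) (θ k) (x k) (u k) i
        - X (M.time (n k) i))).trans (mul_le_mul_of_nonneg_left (hk1 i hi) hC)
      have h2 := mul_le_mul hk3 (hb _ (M.time_mem (n k) hi)) (norm_nonneg _) hε.le
      linarith
    have h3 := (le_abs_self _).trans (hsmall hb' hb')
    have h4 : q * (M.T + M.mesh (n k)) * ((entrySum M.C + b) * ε * ((entrySum M.C + b) * ε))
        ≤ q * (M.T + M.T) * ((entrySum M.C + b) * ε * ((entrySum M.C + b) * ε)) := by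
      have := M.mesh_le hk4
      gcongr
    change ∑ i ∈ Finset.range (n k + 1), M.mesh (n k) *
          (v (M.time (n k) i) ⬝ᵥ v (M.time (n k) i)) ≤ η
    linarith
  intro t ht
  have h1 := Sensitivity.eq_zero_of_integral_eq_zero hTp (ContinuousOn.dotProd hvc hvc)
    (fun t => dotProduct_self_nonneg' _) hzero t ht
  have h2 := sq_norm_le_dotProduct (v t)
  rw [h1] at h2
  have h3 : v t = 0 :=
    norm_eq_zero.1 (pow_eq_zero_iff two_ne_zero |>.1 (le_antisymm h2 (sq_nonneg _)))
  exact sub_eq_zero.1 h3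

end Conditions

end TrackedLinearODE

namespace TrackedLinearODE

variable {p d q m : ℕ} {M : Model p d q m} {Θ : Set (EuclideanSpace ℝ (Fin p))} {σ : ℝ}
  {θs : EuclideanSpace ℝ (Fin p)} {x₀s : Fin d → ℝ} {Xs : ℝ → Fin d → ℝ}

lemma tendsto_zero_of_mul_sq_le {a b : ℕ → ℝ} {c : ℝ} (hc : 0 < c) (ha : ∀ k, 0 ≤ a k)
    (h : ∀ᶠ k in atTop, c * a k ^ 2 ≤ b k) (hb : Tendsto b atTop (𝓝 0)) :
    Tendsto a atTop (𝓝 0) := by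
  have h1 : Tendsto (fun k => √(b k / c)) atTop (𝓝 0) := by
    have := (Real.continuous_sqrt.tendsto 0).comp (by simpa using hb.div_const c :
      Tendsto (fun k => b k / c) atTop (𝓝 0))
    simpa [Function.comp_def] using this
  refine squeeze_zero' (Eventually.of_forall ha) ?_ h1
  filter_upwards [h] with k hk
  refine Real.le_sqrt_of_sq_le ?_
  rw [le_div_iff₀ hc]
  linarith

namespace Model

lemma observed_smul (n : ℕ) (θ : EuclideanSpace ℝ (Fin p)) (x : Fin d → ℝ)
    (u : ℕ → Fin m → ℝ) (c : ℝ) (i : ℕ) :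
    M.C *ᵥ M.discreteState n θ (c • x) (fun i => c • u i) i
      = c • (M.C *ᵥ M.discreteState n θ x u i) := by
  rw [M.discreteState_smul, Matrix.mulVec_smul]

end Model

namespace Conditions

/-! ### Coercivity and consistency -/

/-- Otherwise, after normalization to `‖x‖ + l2 u = 1`, the energy forces `l2 u → 0`, and a limit of
the initial values is unobserved. It is therefore `0`, which contradicts the normalization. -/
lemma exists_coercive (hLC : Conditions M Θ σ θs x₀s Xs) (hΘ : IsCompact Θ)
    (hXs : M.IsSolution θs x₀s Xs) :
    ∃ c, 0 < c ∧ ∀ᶠ n in atTop, ∀ (x : Fin d → ℝ) (u : ℕ → Fin m → ℝ),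
      c * (‖x‖ + M.l2 n u) ^ 2 ≤
        M.pair n (fun i => M.C *ᵥ M.discreteState n θs x u i)
          (fun i => M.C *ᵥ M.discreteState n θs x u i) + M.energy n u := by
  by_contra! hcon
  obtain ⟨lam, hlam, hen⟩ := M.exists_energy_lower_bound
  have hseq : ∀ k : ℕ, ∃ n, k ≤ n ∧ ∃ (x : Fin d → ℝ) (u : ℕ → Fin m → ℝ),
      M.pair n (fun i => M.C *ᵥ M.discreteState n θs x u i)
          (fun i => M.C *ᵥ M.discreteState n θs x u i) + M.energy n u
        < 1 / ((k : ℝ) + 1) * (‖x‖ + M.l2 n u) ^ 2 := fun k => by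
    obtain ⟨n, hn, hnk⟩ := ((hcon (1 / ((k : ℝ) + 1)) (by positivity)).and_eventually
      (eventually_ge_atTop k)).exists
    exact ⟨n, hnk, hn⟩
  choose n hnk x u hlt using hseq
  set s : ℕ → ℝ := fun k => ‖x k‖ + M.l2 (n k) (u k) with hs
  have hs0 : ∀ k, 0 < s k := fun k => by
    have h0 : 0 ≤ s k := add_nonneg (norm_nonneg _) (M.l2_nonneg _ _)
    refine lt_of_le_of_ne h0 fun h => ?_
    have h1 := hlt k
    have h2 : ‖x k‖ + M.l2 (n k) (u k) = 0 := h.symm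
    rw [h2] at h1
    have := M.pair_self_nonneg (n k) fun i => M.C *ᵥ M.discreteState (n k) θs (x k) (u k) i
    have := M.energy_nonneg (n k) (u k)
    norm_num at h1
    linarith
  set xt : ℕ → Fin d → ℝ := fun k => (s k)⁻¹ • x k with hxt
  set ut : ℕ → ℕ → Fin m → ℝ := fun k i => (s k)⁻¹ • u k i with hut
  have hsum : ∀ k, ‖xt k‖ + M.l2 (n k) (ut k) = 1 := fun k => by
    have h1 : M.l2 (n k) (ut k) = (s k)⁻¹ * M.l2 (n k) (u k) :=
      M.l2_smul _ _ (inv_nonneg.2 (hs0 k).le)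
    rw [h1, hxt]
    simp only [norm_smul, norm_inv, Real.norm_of_nonneg (hs0 k).le]
    rw [← mul_add]
    exact inv_mul_cancel₀ (hs0 k).ne'
  have hq : ∀ k, M.pair (n k) (fun i => M.C *ᵥ M.discreteState (n k) θs (xt k) (ut k) i)
      (fun i => M.C *ᵥ M.discreteState (n k) θs (xt k) (ut k) i) + M.energy (n k) (ut k)
      ≤ 1 / ((k : ℝ) + 1) := fun k => by
    simp only [hxt, hut, Model.observed_smul, M.pair_smul_self, M.energy_smul]
    rw [← mul_add]
    have h1 := mul_le_mul_of_nonneg_left (hlt k).le (sq_nonneg (s k)⁻¹)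
    refine h1.trans (le_of_eq ?_)
    change (s k)⁻¹ ^ 2 * (1 / ((k : ℝ) + 1) * (s k) ^ 2) = _
    have := (hs0 k).ne'
    field_simp
  have hlim := tendsto_one_div_add_atTop_nhds_zero_nat (𝕜 := ℝ)
  have hl2 : Tendsto (fun k => M.l2 (n k) (ut k)) atTop (𝓝 0) :=
    tendsto_zero_of_mul_sq_le hlam (fun k => M.l2_nonneg _ _) (Eventually.of_forall fun k => by
      have := M.pair_self_nonneg (n k) fun i => M.C *ᵥ M.discreteState (n k) θs (xt k) (ut k) i
      linarith [hq k, hen (n k) (ut k)]) hlim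
  have hres : Tendsto (fun k => M.pair (n k)
      (fun i => M.C *ᵥ M.discreteState (n k) θs (xt k) (ut k) i)
      (fun i => M.C *ᵥ M.discreteState (n k) θs (xt k) (ut k) i)) atTop (𝓝 0) :=
    squeeze_zero (fun k => M.pair_self_nonneg _ _)
      (fun k => by linarith [hq k, M.energy_nonneg (n k) (ut k)]) hlim
  have hxball : ∀ k, xt k ∈ Metric.closedBall (0 : Fin d → ℝ) 1 := fun k => by
    rw [mem_closedBall_zero_iff]
    linarith [hsum k, M.l2_nonneg (n k) (ut k)]
  obtain ⟨x', -, φ, hφ, hx'⟩ := (isCompact_closedBall (0 : Fin d → ℝ) 1).tendsto_subseq hxball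
  have hn : Tendsto n atTop atTop := tendsto_atTop_mono hnk tendsto_id
  obtain ⟨X, hX⟩ := hLC.exists_solution hLC.mem x'
  have hobs := hLC.observed_eq_of_tendsto hΘ hXs (n := n ∘ φ) (hn.comp hφ.tendsto_atTop)
    (θ := fun _ => θs) (fun _ => hLC.mem) hLC.mem tendsto_const_nhds (x := xt ∘ φ) hx'
    (u := fun k => ut (φ k)) (hl2.comp hφ.tendsto_atTop) (y := fun _ => 0) tendsto_const_nhds hX
    (by simpa [Function.comp_def] using hres.comp hφ.tendsto_atTop)
  have hx0 : x' = 0 := hLC.eq_zero_of_unobserved hLC.mem hX fun t ht => by simpa using hobs t ht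
  have h1 : Tendsto (fun k => ‖xt (φ k)‖ + M.l2 (n (φ k)) (ut (φ k))) atTop (𝓝 (‖x'‖ + 0)) :=
    hx'.norm.add (hl2.comp hφ.tendsto_atTop)
  simp only [hsum, hx0, norm_zero, add_zero] at h1
  exact one_ne_zero (tendsto_nhds_unique tendsto_const_nhds h1)

lemma exists_pair_curve_bound (hLC : Conditions M Θ σ θs x₀s Xs)
    (hXs : M.IsSolution θs x₀s Xs) : ∃ c, 0 ≤ c ∧ ∀ n (e : ℕ → Fin q → ℝ),
      |M.pair n (fun i => M.C *ᵥ Xs (M.time n i)) e| ≤ c * M.noiseSize n e := by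
  obtain ⟨b₀, hb₀, h₀⟩ := ContinuousOn.exists_bound hXs.continuousOn
  obtain ⟨b₁, hb₁, h₁⟩ := ContinuousOn.exists_bound
    (ContinuousOn.matrix_mulVec (hLC.continuousOn_A hLC.mem) hXs.continuousOn)
  have hC := entrySum_nonneg M.C
  exact ⟨_, by positivity, fun n e => M.abs_pair_curve_noise_le hb₁ hXs.2 h₀ h₁ n e⟩

lemma tendsto_excess_true (hLC : Conditions M Θ σ θs x₀s Xs) (hΘ : IsCompact Θ)
    (hXs : M.IsSolution θs x₀s Xs) {n : ℕ → ℕ} (hn : Tendsto n atTop atTop)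
    {e : ℕ → ℕ → Fin q → ℝ} (he : Tendsto (fun k => M.noiseSize (n k) (e k)) atTop (𝓝 0)) :
    Tendsto (fun k => M.excess (n k) Xs (e k) θs x₀s 0) atTop (𝓝 0) := by
  obtain ⟨K, hK0, hK⟩ := hLC.exists_bound_A hΘ
  obtain ⟨c₁, hc₁, h₁⟩ := M.exists_pair_state_noise_bound hK0.le
  obtain ⟨c₂, hc₂, h₂⟩ := hLC.exists_pair_curve_bound hXs
  have hC := entrySum_nonneg M.C
  have hTp := M.T_pos
  have hl2z : ∀ n, M.l2 n (0 : ℕ → Fin m → ℝ) = 0 := fun n => by simp [Model.l2]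
  have hpair : Tendsto (fun k => M.pair (n k)
      (fun i => M.C *ᵥ M.discreteState (n k) θs x₀s 0 i - M.C *ᵥ Xs (M.time (n k) i))
      (fun i => M.C *ᵥ M.discreteState (n k) θs x₀s 0 i - M.C *ᵥ Xs (M.time (n k) i)))
      atTop (𝓝 0) := by
    rw [Metric.tendsto_nhds]
    intro η hη
    obtain ⟨ε, hε, hεη⟩ : ∃ ε : ℝ, 0 < ε ∧
        q * (M.T + M.T) * (entrySum M.C * ε * (entrySum M.C * ε)) ≤ η / 2 := by
      have hc : Tendsto (fun ε : ℝ => q * (M.T + M.T) *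
          (entrySum M.C * ε * (entrySum M.C * ε))) (𝓝[>] 0) (𝓝 0) := by
        have h : Continuous fun ε : ℝ => q * (M.T + M.T) *
          (entrySum M.C * ε * (entrySum M.C * ε)) := by fun_prop
        have := h.tendsto 0
        simp only [mul_zero] at this
        exact this.mono_left nhdsWithin_le_nhds
      obtain ⟨ε, h1, h2⟩ := ((hc.eventually_le_const (half_pos hη)).and
        self_mem_nhdsWithin).exists
      exact ⟨ε, h2, h1⟩
    filter_upwards [hLC.eventually_discreteState_close hΘ hn (fun _ => hLC.mem) hLC.mem
      tendsto_const_nhds (x := fun _ => x₀s) tendsto_const_nhds (u := fun _ => 0)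
      (by simp [hl2z]) hXs hε, hn.eventually (eventually_gt_atTop 0)] with k hk hk0
    have hb : ∀ i ≤ n k, ‖M.C *ᵥ M.discreteState (n k) θs x₀s 0 i - M.C *ᵥ Xs (M.time (n k) i)‖
        ≤ entrySum M.C * ε := fun i hi => by
      rw [← Matrix.mulVec_sub]
      exact (norm_mulVec_le _ _).trans (mul_le_mul_of_nonneg_left (hk i hi) hC)
    have h3 := M.abs_pair_le (n k) hb hb
    rw [Real.dist_eq, sub_zero]
    have h4 : q * (M.T + M.mesh (n k)) * (entrySum M.C * ε * (entrySum M.C * ε))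
        ≤ q * (M.T + M.T) * (entrySum M.C * ε * (entrySum M.C * ε)) := by
      have := M.mesh_le hk0
      gcongr
    linarith
  have hcross : Tendsto (fun k => M.pair (n k)
      (fun i => M.C *ᵥ M.discreteState (n k) θs x₀s 0 i - M.C *ᵥ Xs (M.time (n k) i)) (e k))
      atTop (𝓝 0) := by
    have hb : Tendsto (fun k => (c₁ * ‖x₀s‖ + c₂) * M.noiseSize (n k) (e k)) atTop (𝓝 0) := by
      simpa using he.const_mul (c₁ * ‖x₀s‖ + c₂)
    refine squeeze_zero_norm (fun k => ?_) hb
    rw [M.pair_sub_left, Real.norm_eq_abs]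
    have h3 := h₁ θs (hK _ hLC.mem) (n k) x₀s 0 (e k)
    rw [hl2z, add_zero] at h3
    refine (abs_sub _ _).trans ((add_le_add h3 (h₂ (n k) (e k))).trans (le_of_eq (by ring)))
  have hen : ∀ k, M.energy (n k) 0 = 0 := fun k => by simp [Model.energy]
  have := (hpair.sub (hcross.const_mul 2))
  simpa [Model.excess, hen] using this

/-- Consistency in deterministic form, uniform over small noise. Initial values and controls are not
bounded a priori, so counterexamples are rescaled by `1 + ‖x‖ + l2 u` before the passage to the
limit. -/
lemma exists_consistent (hLC : Conditions M Θ σ θs x₀s Xs) (hΘ : IsCompact Θ)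
    (hXs : M.IsSolution θs x₀s Xs) {ε : ℝ} (hε : 0 < ε) :
    ∃ η, 0 < η ∧ ∀ᶠ n in atTop, ∀ e : ℕ → Fin q → ℝ, M.noiseSize n e ≤ η →
      ∀ θ ∈ Θ, ∀ (x : Fin d → ℝ) (u : ℕ → Fin m → ℝ),
        M.excess n Xs e θ x u ≤ M.excess n Xs e θs x₀s 0 + η → ‖θ - θs‖ < ε := by
  by_contra! hcon
  obtain ⟨lam, hlam, hen⟩ := M.exists_energy_lower_bound
  obtain ⟨K, hK0, hK⟩ := hLC.exists_bound_A hΘ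
  obtain ⟨c₁, hc₁, h₁⟩ := M.exists_pair_state_noise_bound hK0.le
  obtain ⟨c₂, hc₂, h₂⟩ := hLC.exists_pair_curve_bound hXs
  have hseq : ∀ k : ℕ, ∃ n, k ≤ n ∧ ∃ e : ℕ → Fin q → ℝ,
      M.noiseSize n e ≤ 1 / ((k : ℝ) + 1) ∧ ∃ θ ∈ Θ, ∃ (x : Fin d → ℝ) (u : ℕ → Fin m → ℝ),
        M.excess n Xs e θ x u ≤ M.excess n Xs e θs x₀s 0 + 1 / ((k : ℝ) + 1) ∧
          ε ≤ ‖θ - θs‖ := fun k => by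
    obtain ⟨n, hn, hnk⟩ := ((hcon (1 / ((k : ℝ) + 1)) (by positivity)).and_eventually
      (eventually_ge_atTop k)).exists
    exact ⟨n, hnk, hn⟩
  choose n hnk e he θ hθ x u hle hfar using hseq
  have hlim := tendsto_one_div_add_atTop_nhds_zero_nat (𝕜 := ℝ)
  have hn : Tendsto n atTop atTop := tendsto_atTop_mono hnk tendsto_id
  have heT : Tendsto (fun k => M.noiseSize (n k) (e k)) atTop (𝓝 0) :=
    squeeze_zero (fun k => M.noiseSize_nonneg _ _) he hlim
  have hex := hLC.tendsto_excess_true hΘ hXs hn heT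
  -- The `1` stands for the signal, which is rescaled to `y = 1 / s`. Thus `(y, xt, ut)` has total
  -- size `1` and cannot vanish in the limit.
  set s : ℕ → ℝ := fun k => 1 + (‖x k‖ + M.l2 (n k) (u k)) with hs
  have hs1 : ∀ k, 1 ≤ s k := fun k =>
    le_add_of_nonneg_right (add_nonneg (norm_nonneg _) (M.l2_nonneg _ _))
  have hs0 : ∀ k, 0 < s k := fun k => one_pos.trans_le (hs1 k)
  set xt : ℕ → Fin d → ℝ := fun k => (s k)⁻¹ • x k with hxt
  set ut : ℕ → ℕ → Fin m → ℝ := fun k i => (s k)⁻¹ • u k i with hut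
  set y : ℕ → ℝ := fun k => (s k)⁻¹ with hy
  have hsum : ∀ k, y k + (‖xt k‖ + M.l2 (n k) (ut k)) = 1 := fun k => by
    have h1 : M.l2 (n k) (ut k) = (s k)⁻¹ * M.l2 (n k) (u k) :=
      M.l2_smul _ _ (inv_nonneg.2 (hs0 k).le)
    rw [h1, hxt, hy]
    simp only [norm_smul, norm_inv, Real.norm_of_nonneg (hs0 k).le]
    calc _ = (s k)⁻¹ * (1 + (‖x k‖ + M.l2 (n k) (u k))) := by ring
      _ = 1 := inv_mul_cancel₀ (hs0 k).ne'
  set α : ℕ → ℝ := fun k => |M.excess (n k) Xs (e k) θs x₀s 0| + 1 / ((k : ℝ) + 1)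
    + 2 * (c₁ + c₂) * M.noiseSize (n k) (e k) with hα
  have hαT : Tendsto α atTop (𝓝 0) := by
    have := (hex.abs.add hlim).add (heT.const_mul (2 * (c₁ + c₂)))
    rwa [abs_zero, mul_zero, add_zero, add_zero] at this
  have hq : ∀ k, M.pair (n k)
      (fun i => M.C *ᵥ M.discreteState (n k) (θ k) (xt k) (ut k) i
        - y k • (M.C *ᵥ Xs (M.time (n k) i)))
      (fun i => M.C *ᵥ M.discreteState (n k) (θ k) (xt k) (ut k) i
        - y k • (M.C *ᵥ Xs (M.time (n k) i))) + M.energy (n k) (ut k) ≤ α k := fun k => by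
    have hN := M.noiseSize_nonneg (n k) (e k)
    simp only [hxt, hut, hy, Model.observed_smul, M.energy_smul, ← smul_sub, M.pair_smul_self]
    rw [← mul_add]
    have h3 := h₁ (θ k) (hK _ (hθ k)) (n k) (x k) (u k) (e k)
    have h4 := h₂ (n k) (e k)
    have h5 := hle k
    have h6 := le_abs_self (M.excess (n k) Xs (e k) θs x₀s 0)
    have h6' := abs_nonneg (M.excess (n k) Xs (e k) θs x₀s 0)
    unfold Model.excess at h5
    rw [M.pair_sub_left _ _ _ (e k)] at h5
    have h7 := (abs_le.1 h3).2
    have h8 := (abs_le.1 h4).1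
    set Q := M.pair (n k) (fun i => M.C *ᵥ M.discreteState (n k) (θ k) (x k) (u k) i
        - M.C *ᵥ Xs (M.time (n k) i)) (fun i => M.C *ᵥ M.discreteState (n k) (θ k) (x k) (u k) i
        - M.C *ᵥ Xs (M.time (n k) i)) + M.energy (n k) (u k) with hQ
    have hk1 : (0 : ℝ) ≤ 1 / ((k : ℝ) + 1) := by positivity
    -- The cost is quadratic in the scale `s` while the noise pairing is only linear, so division by
    -- `s ^ 2` leaves at most `α k → 0`.
    have h9 : Q ≤ α k * s k := by
      have hα' : α k = |M.excess (n k) Xs (e k) θs x₀s 0| + 1 / ((k : ℝ) + 1)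
        + 2 * (c₁ + c₂) * M.noiseSize (n k) (e k) := rfl
      have hss : s k = 1 + (‖x k‖ + M.l2 (n k) (u k)) := rfl
      have h10 : |M.excess (n k) Xs (e k) θs x₀s 0| + 1 / ((k : ℝ) + 1)
          ≤ (|M.excess (n k) Xs (e k) θs x₀s 0| + 1 / ((k : ℝ) + 1)) * s k :=
        le_mul_of_one_le_right (by positivity) (hs1 k)
      have h11 : c₁ * ((‖x k‖ + M.l2 (n k) (u k)) * M.noiseSize (n k) (e k))
          + c₂ * M.noiseSize (n k) (e k) ≤ (c₁ + c₂) * M.noiseSize (n k) (e k) * s k := by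
        have hz : 0 ≤ ‖x k‖ + M.l2 (n k) (u k) := by linarith [hs1 k]
        have : 0 ≤ c₁ * M.noiseSize (n k) (e k) := by positivity
        have : 0 ≤ c₂ * M.noiseSize (n k) (e k) * (‖x k‖ + M.l2 (n k) (u k)) := by positivity
        rw [hss]
        nlinarith
      rw [hα', add_mul]
      unfold Model.excess at h6 h10 h6' ⊢
      linarith
    have hα0 : 0 ≤ α k := by
      have : 0 ≤ (c₁ + c₂) * M.noiseSize (n k) (e k) := by positivity
      simp only [hα]; linarith
    calc (s k)⁻¹ ^ 2 * Q ≤ (s k)⁻¹ ^ 2 * (α k * s k) :=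
          mul_le_mul_of_nonneg_left h9 (sq_nonneg _)
      _ = α k * (s k)⁻¹ := by have := (hs0 k).ne'; field_simp
      _ ≤ α k := mul_le_of_le_one_right hα0 (inv_le_one_of_one_le₀ (hs1 k))
  have hl2 : Tendsto (fun k => M.l2 (n k) (ut k)) atTop (𝓝 0) :=
    tendsto_zero_of_mul_sq_le hlam (fun k => M.l2_nonneg _ _) (Eventually.of_forall fun k => by
      have := M.pair_self_nonneg (n k) fun i => M.C *ᵥ M.discreteState (n k) (θ k) (xt k) (ut k) i
        - y k • (M.C *ᵥ Xs (M.time (n k) i))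
      linarith [hq k, hen (n k) (ut k)]) hαT
  have hres := squeeze_zero (fun k => M.pair_self_nonneg (n k)
      (fun i => M.C *ᵥ M.discreteState (n k) (θ k) (xt k) (ut k) i
        - y k • (M.C *ᵥ Xs (M.time (n k) i))))
      (fun k => by linarith [hq k, M.energy_nonneg (n k) (ut k)]) hαT
  have hmem : ∀ k, (θ k, xt k, y k) ∈ Θ ×ˢ (Metric.closedBall (0 : Fin d → ℝ) 1 ×ˢ
      Icc (0 : ℝ) 1) := fun k => by
    have h1 := hsum k
    have h2 := M.l2_nonneg (n k) (ut k)
    have h3 : 0 ≤ y k := inv_nonneg.2 (hs0 k).le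
    have h4 := norm_nonneg (xt k)
    exact ⟨hθ k, by rw [mem_closedBall_zero_iff]; linarith, h3, by linarith⟩
  obtain ⟨⟨θ', x', y'⟩, hmem', φ, hφ, hlimφ⟩ :=
    (hΘ.prod ((isCompact_closedBall (0 : Fin d → ℝ) 1).prod isCompact_Icc)).tendsto_subseq hmem
  have hθT : Tendsto (fun k => θ (φ k)) atTop (𝓝 θ') := (continuous_fst.tendsto _).comp hlimφ
  have hxT : Tendsto (fun k => xt (φ k)) atTop (𝓝 x') :=
    ((continuous_fst.comp continuous_snd).tendsto _).comp hlimφ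
  have hyT : Tendsto (fun k => y (φ k)) atTop (𝓝 y') :=
    ((continuous_snd.comp continuous_snd).tendsto _).comp hlimφ
  have hθ'Θ : θ' ∈ Θ := hmem'.1
  obtain ⟨X, hX⟩ := hLC.exists_solution hθ'Θ x'
  have hobs := hLC.observed_eq_of_tendsto hΘ hXs (n := n ∘ φ) (hn.comp hφ.tendsto_atTop)
    (θ := θ ∘ φ) (fun _ => hθ _) hθ'Θ hθT (x := xt ∘ φ) hxT
    (u := fun k => ut (φ k)) (hl2.comp hφ.tendsto_atTop) (y := y ∘ φ) hyT hX
    (hres.comp hφ.tendsto_atTop)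
  have h1 : Tendsto (fun k => y (φ k) + (‖xt (φ k)‖ + M.l2 (n (φ k)) (ut (φ k)))) atTop
      (𝓝 (y' + (‖x'‖ + 0))) := hyT.add (hxT.norm.add (hl2.comp hφ.tendsto_atTop))
  simp only [hsum, add_zero] at h1
  have hone : 1 = y' + ‖x'‖ := tendsto_nhds_unique tendsto_const_nhds h1
  have hθs : θ' = θs := by
    -- If `y' = 0` the signal is lost in the limit, and observability gives `x' = 0`, against `y' +
    -- ‖x'‖ = 1`. Otherwise `X / y'` has the true output and `lc5` identifies `θ'`.
    by_cases hy0 : y' = 0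
    · have hx0 : x' = 0 := hLC.eq_zero_of_unobserved hθ'Θ hX fun t ht => by
        simpa [hy0] using hobs t ht
      rw [hy0, hx0, norm_zero, add_zero] at hone
      exact absurd hone one_ne_zero
    · refine (hLC.lc5 θ' hθ'Θ (y'⁻¹ • x') (fun t => y'⁻¹ • X t) ⟨by simp [hX.1], fun t ht => ?_⟩
        fun t ht => ?_).1
      · rw [Matrix.mulVec_smul]
        exact (hX.2 t ht).const_smul y'⁻¹
      · rw [Matrix.mulVec_smul, hobs t ht, smul_smul, inv_mul_cancel₀ hy0, one_smul]
  have h2 : Tendsto (fun k => ‖θ (φ k) - θs‖) atTop (𝓝 ‖θ' - θs‖) :=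
    (hθT.sub_const θs).norm
  rw [hθs, sub_self, norm_zero] at h2
  have h3 := ge_of_tendsto' h2 fun k => hfar (φ k)
  linarith

end Conditions

end TrackedLinearODE

/-! ### First order decomposition of the perturbed discrete state. -/

namespace TrackedLinearODE

variable {p d q m : ℕ} {M : Model p d q m} {Θ : Set (EuclideanSpace ℝ (Fin p))} {σ : ℝ}
  {θs : EuclideanSpace ℝ (Fin p)} {x₀s : Fin d → ℝ} {Xs : ℝ → Fin d → ℝ}

lemma sum_abs_le_norm (h : EuclideanSpace ℝ (Fin p)) : ∑ k, |h k| ≤ p * ‖h‖ := by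
  calc ∑ k, |h k| ≤ ∑ _k : Fin p, ‖h‖ := Finset.sum_le_sum fun k _ => PiLp.norm_apply_le h k
    _ = p * ‖h‖ := by simp

lemma eventually_euler_consistent_sum {E : Type*} [NormedAddCommGroup E] [NormedSpace ℝ E]
    {X X' : Fin p → ℝ → E}
    (hX : ∀ k, ∀ r ∈ Icc 0 M.T, HasDerivWithinAt (X k) (X' k r) (Icc 0 M.T) r)
    (hX' : ∀ k, ContinuousOn (X' k) (Icc 0 M.T)) {ε : ℝ} (hε : 0 < ε) :
    ∀ᶠ n in atTop, ∀ h : EuclideanSpace ℝ (Fin p), ∀ i < n,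
      ‖∑ k, h k • X k (M.time n (i + 1)) - ∑ k, h k • X k (M.time n i)
        - M.mesh n • ∑ k, h k • X' k (M.time n i)‖ ≤ M.mesh n * (ε * ‖h‖) := by
  have hε' : 0 < ε / (p + 1) := by positivity
  have hall := eventually_all.2 fun k => M.eventually_euler_consistent (hX k) (hX' k) hε'
  filter_upwards [hall] with n hn h i hi
  have hm := M.mesh_nonneg n
  have h1 : ∑ k, h k • X k (M.time n (i + 1)) - ∑ k, h k • X k (M.time n i)
        - M.mesh n • ∑ k, h k • X' k (M.time n i)
      = ∑ k, h k • (X k (M.time n (i + 1)) - X k (M.time n i)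
        - M.mesh n • X' k (M.time n i)) := by
    rw [Finset.smul_sum, ← Finset.sum_sub_distrib, ← Finset.sum_sub_distrib]
    refine Finset.sum_congr rfl fun k _ => ?_
    rw [smul_sub, smul_sub, smul_comm]
  rw [h1]
  calc _ ≤ ∑ k, ‖h k • (X k (M.time n (i + 1)) - X k (M.time n i)
        - M.mesh n • X' k (M.time n i))‖ := norm_sum_le _ _
    _ ≤ ∑ k, |h k| * (M.mesh n * (ε / (p + 1))) := Finset.sum_le_sum fun k _ => by
        rw [norm_smul]
        exact mul_le_mul_of_nonneg_left (hn k i hi) (norm_nonneg _)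
    _ = (∑ k, |h k|) * (M.mesh n * (ε / (p + 1))) := (Finset.sum_mul _ _ _).symm
    _ ≤ (p * ‖h‖) * (M.mesh n * (ε / (p + 1))) := by
        gcongr
        exact sum_abs_le_norm h
    _ = M.mesh n * ((p / (p + 1)) * ε * ‖h‖) := by ring
    _ ≤ M.mesh n * (ε * ‖h‖) := by
        have : (p : ℝ) / (p + 1) ≤ 1 := (div_le_one (by positivity)).2 (by linarith)
        gcongr
        exact mul_le_of_le_one_left hε.le this

namespace Sensitivity

variable (S : Sensitivity M θs Xs)

/-- The linear statistic driving the asymptotic fluctuations of the estimator. -/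
noncomputable def score (n : ℕ) (e : ℕ → Fin q → ℝ) : Fin p → ℝ := fun k =>
  M.pair n (fun i => M.C *ᵥ S.Ξ k (M.time n i)) e

/-- The state reached from a perturbation of the true data decomposed along the sensitivities. -/
noncomputable def perturbed (n : ℕ) (h : EuclideanSpace ℝ (Fin p)) (x₀s ξ : Fin d → ℝ) (u : ℕ → Fin m → ℝ) :
    ℕ → Fin d → ℝ :=
  M.discreteState n (θs + h) (x₀s + S.state h 0 + ξ) (fun i => S.control h (M.time n i) + u i)

lemma eventually_state_consistent (hLC : Conditions M Θ σ θs x₀s Xs)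
    (hXs : M.IsSolution θs x₀s Xs) {ε : ℝ} (hε : 0 < ε) :
    ∀ᶠ n in atTop, ∀ h, ∀ i < n, ‖S.state h (M.time n (i + 1)) - S.state h (M.time n i)
      - M.mesh n • (M.A θs (M.time n i) *ᵥ S.state h (M.time n i)
        + M.B *ᵥ S.control h (M.time n i) + S.coeff h (M.time n i) *ᵥ Xs (M.time n i))‖
      ≤ M.mesh n * (ε * ‖h‖) := by
  have hc : ∀ k, ContinuousOn (fun t => M.A θs t *ᵥ S.Ξ k t + M.B *ᵥ S.w k t + S.G k t *ᵥ Xs t)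
      (Icc 0 M.T) := fun k =>
    ((ContinuousOn.matrix_mulVec (hLC.continuousOn_A hLC.mem) (S.continuousOn_Ξ k)).add
      (ContinuousOn.const_mulVec _ (S.continuousOn_w k))).add
      (ContinuousOn.matrix_mulVec (S.G_cont k) hXs.continuousOn)
  filter_upwards [eventually_euler_consistent_sum S.Ξ_deriv hc hε] with n hn h i hi
  have key : M.A θs (M.time n i) *ᵥ S.state h (M.time n i)
        + M.B *ᵥ S.control h (M.time n i) + S.coeff h (M.time n i) *ᵥ Xs (M.time n i)
      = ∑ k, h k • (M.A θs (M.time n i) *ᵥ S.Ξ k (M.time n i) + M.B *ᵥ S.w k (M.time n i)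
        + S.G k (M.time n i) *ᵥ Xs (M.time n i)) := by
    simp only [state, control, coeff, smul_add, Finset.sum_add_distrib, Matrix.mulVec_sum,
      Matrix.mulVec_smul, Matrix.sum_mulVec, Matrix.smul_mulVec]
  rw [key]
  exact hn h i hi

lemma eventually_adjoint_consistent (hLC : Conditions M Θ σ θs x₀s Xs) {ε : ℝ} (hε : 0 < ε) :
    ∀ᶠ n in atTop, ∀ h, ∀ i < n, ‖S.adjoint h (M.time n (i + 1)) - S.adjoint h (M.time n i)
      - M.mesh n • (-((M.A θs (M.time n i))ᵀ *ᵥ S.adjoint h (M.time n i))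
        - M.Cᵀ *ᵥ (M.C *ᵥ S.state h (M.time n i)))‖
      ≤ M.mesh n * (ε * ‖h‖) := by
  have hc : ∀ k, ContinuousOn (fun t => -((M.A θs t)ᵀ *ᵥ S.P k t) - M.Cᵀ *ᵥ (M.C *ᵥ S.Ξ k t))
      (Icc 0 M.T) := fun k =>
    (ContinuousOn.matrix_mulVec (fun i j => hLC.continuousOn_A hLC.mem j i)
      (S.continuousOn_P k)).neg.sub (ContinuousOn.const_mulVec _ (S.continuousOn_CΞ k))
  filter_upwards [eventually_euler_consistent_sum S.P_deriv hc hε] with n hn h i hi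
  have key : -((M.A θs (M.time n i))ᵀ *ᵥ S.adjoint h (M.time n i))
        - M.Cᵀ *ᵥ (M.C *ᵥ S.state h (M.time n i))
      = ∑ k, h k • (-((M.A θs (M.time n i))ᵀ *ᵥ S.P k (M.time n i))
        - M.Cᵀ *ᵥ (M.C *ᵥ S.Ξ k (M.time n i))) := by
    simp only [state, adjoint, smul_sub, smul_neg, Finset.sum_sub_distrib, Finset.sum_neg_distrib,
      Matrix.mulVec_sum, Matrix.mulVec_smul]
  rw [key]
  exact hn h i hi

/-- The part of `perturbed` which is not explained by first order perturbations. -/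
noncomputable def remainder (n : ℕ) (h : EuclideanSpace ℝ (Fin p)) (x₀s ξ : Fin d → ℝ)
    (u : ℕ → Fin m → ℝ) (i : ℕ) : Fin d → ℝ :=
  S.perturbed n h x₀s ξ u i - Xs (M.time n i) - S.state h (M.time n i)
    - M.discreteState n θs ξ u i

lemma remainder_zero (hXs : M.IsSolution θs x₀s Xs) (n : ℕ) (h : EuclideanSpace ℝ (Fin p))
    (ξ : Fin d → ℝ) (u : ℕ → Fin m → ℝ) : S.remainder n h x₀s ξ u 0 = 0 := by
  simp only [remainder, perturbed, Model.discreteState, M.time_zero, hXs.1]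
  abel

/-- All first order terms and all controls cancel. What forces the remainder is the change of `A`
acting on the perturbation, the Taylor error of `A` acting on `Xs`, and the Euler defects of `Xs`
and of the sensitivity. -/
lemma remainder_succ {n : ℕ} (hm : M.mesh n ≠ 0) (h : EuclideanSpace ℝ (Fin p))
    (ξ : Fin d → ℝ) (u : ℕ → Fin m → ℝ) (i : ℕ) :
    S.remainder n h x₀s ξ u (i + 1) = S.remainder n h x₀s ξ u i + M.mesh n •
      (M.A (θs + h) (M.time n i) *ᵥ S.remainder n h x₀s ξ u i
        + ((M.A (θs + h) (M.time n i) - M.A θs (M.time n i)) *ᵥ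
            (S.state h (M.time n i) + M.discreteState n θs ξ u i)
          + (M.A (θs + h) (M.time n i) - M.A θs (M.time n i) - S.coeff h (M.time n i)) *ᵥ
            Xs (M.time n i)
          - (M.mesh n)⁻¹ • ((Xs (M.time n (i + 1)) - Xs (M.time n i)
              - M.mesh n • (M.A θs (M.time n i) *ᵥ Xs (M.time n i)))
            + (S.state h (M.time n (i + 1)) - S.state h (M.time n i)
      - M.mesh n • (M.A θs (M.time n i) *ᵥ S.state h (M.time n i)
        + M.B *ᵥ S.control h (M.time n i) + S.coeff h (M.time n i) *ᵥ Xs (M.time n i)))))) := by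
  simp only [remainder, perturbed, M.discreteState_succ]
  simp only [Matrix.sub_mulVec, Matrix.mulVec_sub, Matrix.mulVec_add, smul_add, smul_sub,
    smul_inv_smul₀ hm]
  module

/-- Every forcing term carries a factor `ω` times the perturbation size, except the Euler defect of
`Xs`, which contributes the bare `mesh`. Increments are bounded as well because the remainder is
later summed by parts against the noise. -/
lemma exists_remainder_bound (hLC : Conditions M Θ σ θs x₀s Xs) (hΘ : IsCompact Θ)
    (hXs : M.IsSolution θs x₀s Xs) : ∃ C, 0 ≤ C ∧ ∀ ω, 0 < ω →
    ∀ᶠ (x : ℕ × EuclideanSpace ℝ (Fin p)) in atTop ×ˢ 𝓝 0, ∀ ξ u,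
      (∀ i ≤ x.1, ‖S.remainder x.1 x.2 x₀s ξ u i‖
        ≤ C * (ω * (‖x.2‖ + (‖ξ‖ + M.l2 x.1 u)) + M.mesh x.1)) ∧
      ∀ i < x.1, ‖S.remainder x.1 x.2 x₀s ξ u (i + 1) - S.remainder x.1 x.2 x₀s ξ u i‖
        ≤ M.mesh x.1 * (C * (ω * (‖x.2‖ + (‖ξ‖ + M.l2 x.1 u)) + M.mesh x.1)) := by
  obtain ⟨K, hK0, hK⟩ := hLC.exists_bound_A hΘ
  obtain ⟨b₀, hb₀, h₀⟩ := ContinuousOn.exists_bound hXs.continuousOn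
  obtain ⟨b₁, hb₁, h₁⟩ := ContinuousOn.exists_bound
    (ContinuousOn.matrix_mulVec (hLC.continuousOn_A hLC.mem) hXs.continuousOn)
  obtain ⟨LA, hLA0, hLA⟩ := hLC.exists_lipschitz_A
  obtain ⟨L, hL0, hL⟩ := S.exists_A_lipschitz_at
  obtain ⟨Ks, hKs0, hKs⟩ := exists_bound_sum S.continuousOn_Ξ
  have hB := entrySum_nonneg M.B
  set K' := Real.exp (K * M.T) * (1 + entrySum M.B * √M.T) with hK'
  have hK'0 : 0 ≤ K' := by positivity
  set L' := LA * b₀ + K * b₁ with hL'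
  have hL'0 : 0 ≤ L' := by positivity
  have hlip : ∀ r ∈ Icc 0 M.T, ∀ s ∈ Icc 0 M.T,
      ‖M.A θs r *ᵥ Xs r - M.A θs s *ᵥ Xs s‖ ≤ L' * |r - s| := fun r hr s hs => by
    have hX : ‖Xs r - Xs s‖ ≤ b₁ * ‖r - s‖ :=
      (convex_Icc 0 M.T).norm_image_sub_le_of_norm_hasDerivWithin_le hXs.2 h₁ hs hr
    rw [Real.norm_eq_abs] at hX
    have heq : M.A θs r *ᵥ Xs r - M.A θs s *ᵥ Xs s
        = (M.A θs r - M.A θs s) *ᵥ Xs r + M.A θs s *ᵥ (Xs r - Xs s) := by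
      rw [Matrix.sub_mulVec, Matrix.mulVec_sub]; abel
    rw [heq]
    refine (norm_add_le _ _).trans ?_
    have e1 := norm_mulVec_le (M.A θs r - M.A θs s) (Xs r)
    have e2 := norm_mulVec_le (M.A θs s) (Xs r - Xs s)
    have e3 := mul_le_mul (hLA r hr s hs) (h₀ r hr) (norm_nonneg _) (by positivity)
    have e4 := mul_le_mul (hK θs hLC.mem s hs) hX (norm_nonneg _) hK0.le
    rw [hL']
    linarith
  set C₁ := (Ks + K') + b₀ + L' + 1 with hC₁
  have hC₁0 : 0 ≤ C₁ := by positivity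
  set E := Real.exp (K * M.T) * M.T with hE
  have hE0 : 0 ≤ E := mul_nonneg (Real.exp_pos _).le M.T_pos.le
  -- `E * C₁` serves the remainder itself, the bracket its increments.
  refine ⟨E * C₁ + (K * (E * C₁) + C₁), by positivity, fun ω hω => ?_⟩
  have hsmall : ∀ᶠ h : EuclideanSpace ℝ (Fin p) in 𝓝 0, L * ‖h‖ ≤ ω := by
    have : Tendsto (fun h : EuclideanSpace ℝ (Fin p) => L * ‖h‖) (𝓝 0) (𝓝 (L * ‖(0 : EuclideanSpace ℝ (Fin p))‖)) :=
      (tendsto_norm.const_mul L)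
    rw [norm_zero, mul_zero] at this
    exact this.eventually_le_const hω
  refine (((S.eventually_state_consistent hLC hXs hω).and (eventually_gt_atTop 0)).prod_mk
    ((hL.and (S.G_deriv ω hω)).and (hsmall.and hLC.eventually_mem))).mono ?_
  rintro ⟨n, h⟩ ⟨⟨hcons, hn⟩, ⟨hLh, hGh⟩, hsm, hmem⟩ ξ u
  dsimp only at hcons hn hLh hGh hsm hmem ⊢
  have hm := M.mesh_pos hn
  have hnT := M.natCast_mul_mesh hn
  set b := ‖h‖ + (‖ξ‖ + M.l2 n u) with hb
  have hl2 := M.l2_nonneg n u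
  have hξ := norm_nonneg ξ
  have hh := norm_nonneg h
  have hb0 : 0 ≤ b := by positivity
  set F := C₁ * (ω * b + M.mesh n) with hF
  have hF0 : 0 ≤ F := by positivity
  set f : ℕ → Fin d → ℝ := fun i =>
    ((M.A (θs + h) (M.time n i) - M.A θs (M.time n i)) *ᵥ
            (S.state h (M.time n i) + M.discreteState n θs ξ u i)
          + (M.A (θs + h) (M.time n i) - M.A θs (M.time n i) - S.coeff h (M.time n i)) *ᵥ
            Xs (M.time n i)
          - (M.mesh n)⁻¹ • ((Xs (M.time n (i + 1)) - Xs (M.time n i)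
              - M.mesh n • (M.A θs (M.time n i) *ᵥ Xs (M.time n i)))
            + (S.state h (M.time n (i + 1)) - S.state h (M.time n i)
      - M.mesh n • (M.A θs (M.time n i) *ᵥ S.state h (M.time n i)
        + M.B *ᵥ S.control h (M.time n i) + S.coeff h (M.time n i) *ᵥ Xs (M.time n i))))) with hf
  have hfb : ∀ i < n, ‖f i‖ ≤ F := fun i hi => by
    have ht := M.time_mem n hi.le
    have e1 : ‖(M.A (θs + h) (M.time n i) - M.A θs (M.time n i)) *ᵥ
        (S.state h (M.time n i) + M.discreteState n θs ξ u i)‖ ≤ ω * ((Ks + K') * b) := by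
      refine (norm_mulVec_le _ _).trans (mul_le_mul ((hLh _ ht).trans hsm) ?_ (norm_nonneg _) hω.le)
      refine (norm_add_le _ _).trans ?_
      have a1 : ‖S.state h (M.time n i)‖ ≤ Ks * ‖h‖ := hKs h _ ht
      have a2 := M.norm_discreteState_le hK0.le (hK θs hLC.mem) n ξ u i hi.le
      have a3 : Ks * ‖h‖ ≤ Ks * b := mul_le_mul_of_nonneg_left (by linarith) hKs0
      have a4 : K' * (‖ξ‖ + M.l2 n u) ≤ K' * b := mul_le_mul_of_nonneg_left (by linarith) hK'0
      linarith
    have e2 : ‖(M.A (θs + h) (M.time n i) - M.A θs (M.time n i) - S.coeff h (M.time n i)) *ᵥ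
            Xs (M.time n i)‖ ≤ ω * b * b₀ := by
      refine (norm_mulVec_le _ _).trans (mul_le_mul ?_ (h₀ _ ht) (norm_nonneg _) (by positivity))
      exact (hGh _ ht).trans (mul_le_mul_of_nonneg_left (by linarith) hω.le)
    have e3 := M.euler_consistent_of_lipschitz hXs.2 hL'0 hlip n i hi
    have e4 := hcons h i hi
    have e5 : ‖(M.mesh n)⁻¹ • ((Xs (M.time n (i + 1)) - Xs (M.time n i)
              - M.mesh n • (M.A θs (M.time n i) *ᵥ Xs (M.time n i)))
            + (S.state h (M.time n (i + 1)) - S.state h (M.time n i)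
      - M.mesh n • (M.A θs (M.time n i) *ᵥ S.state h (M.time n i)
        + M.B *ᵥ S.control h (M.time n i) + S.coeff h (M.time n i) *ᵥ Xs (M.time n i))))‖
        ≤ L' * M.mesh n + ω * b := by
      rw [norm_smul, norm_inv, Real.norm_of_nonneg hm.le, inv_mul_le_iff₀ hm]
      refine (norm_add_le _ _).trans ((add_le_add e3 e4).trans ?_)
      rw [← mul_add]
      have : ω * ‖h‖ ≤ ω * b := mul_le_mul_of_nonneg_left (by linarith) hω.le
      exact mul_le_mul_of_nonneg_left (by linarith) hm.le
    refine (norm_sub_le _ _).trans ((add_le_add ((norm_add_le _ _).trans (add_le_add e1 e2))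
      e5).trans ?_)
    have e6 : 0 ≤ L' * (ω * b) := by positivity
    have e7 : 0 ≤ ((Ks + K') + b₀ + 1) * M.mesh n := by positivity
    simp only [hF, hC₁]
    linarith
  have hsucc := S.remainder_succ (x₀s := x₀s) hm.ne' h ξ u
  have hR : ∀ i ≤ n, ‖S.remainder n h x₀s ξ u i‖ ≤ E * F := fun i hi => by
    have h1 := norm_le_of_discrete_linear hm.le hK0.le (f := f)
      (fun i _ => hsucc i) (fun i hi => hK (θs + h) hmem _ (M.time_mem n hi.le)) i hi
    rw [S.remainder_zero hXs, norm_zero, zero_add, hnT] at h1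
    refine h1.trans ?_
    rw [hE, mul_assoc]
    refine mul_le_mul_of_nonneg_left ?_ (Real.exp_pos _).le
    calc _ ≤ ∑ j ∈ Finset.range n, M.mesh n * F := Finset.sum_le_sum fun j hj =>
          mul_le_mul_of_nonneg_left (hfb j (Finset.mem_range.1 hj)) hm.le
      _ ≤ _ := M.sum_mesh_le n F hF0
  have hpos : 0 ≤ ω * b + M.mesh n := by positivity
  have hEF : E * F = E * C₁ * (ω * b + M.mesh n) := by rw [hF]; ring
  refine ⟨fun i hi => (hR i hi).trans ?_, fun i hi => ?_⟩
  · rw [hEF]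
    exact mul_le_mul_of_nonneg_right (le_add_of_nonneg_right (by positivity)) hpos
  · rw [hsucc i, add_sub_cancel_left, norm_smul, Real.norm_of_nonneg hm.le]
    refine mul_le_mul_of_nonneg_left ?_ hm.le
    refine (norm_add_le _ _).trans ((add_le_add ((norm_mulVec_le _ _).trans
      (mul_le_mul (hK (θs + h) hmem _ (M.time_mem n hi.le)) (hR i hi.le) (norm_nonneg _)
        hK0.le)) (hfb i hi)).trans ?_)
    have : 0 ≤ E * C₁ * (ω * b + M.mesh n) := by positivity
    rw [hEF, hF]
    linarith

end Sensitivity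

end TrackedLinearODE

/-! ### Asymptotic orthogonality of parameter and nuisance directions. -/

namespace TrackedLinearODE

variable {p d q m : ℕ} {M : Model p d q m} {Θ : Set (EuclideanSpace ℝ (Fin p))} {σ : ℝ}
  {θs : EuclideanSpace ℝ (Fin p)} {x₀s : Fin d → ℝ} {Xs : ℝ → Fin d → ℝ}

lemma transpose_mulVec_dotProduct {a b : ℕ} (A : Matrix (Fin a) (Fin b) ℝ) (v : Fin a → ℝ)
    (w : Fin b → ℝ) : (Aᵀ *ᵥ v) ⬝ᵥ w = v ⬝ᵥ (A *ᵥ w) := by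
  rw [Matrix.mulVec_transpose, Matrix.dotProduct_mulVec]

namespace Sensitivity

variable (S : Sensitivity M θs Xs)

/-- Discrete product rule. The adjoint equation cancels the terms in `A`, and the optimality
relation for the control turns the pairing of the adjoint with `B u` into the control energy
pairing. -/
lemma adjoint_dotProduct_succ (n : ℕ) (h : EuclideanSpace ℝ (Fin p)) (ξ : Fin d → ℝ)
    (u : ℕ → Fin m → ℝ) (i : ℕ) :
    S.adjoint h (M.time n (i + 1)) ⬝ᵥ M.discreteState n θs ξ u (i + 1)
      - S.adjoint h (M.time n i) ⬝ᵥ M.discreteState n θs ξ u i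
    = ((S.adjoint h (M.time n (i + 1)) - S.adjoint h (M.time n i)
      - M.mesh n • (-((M.A θs (M.time n i))ᵀ *ᵥ S.adjoint h (M.time n i))
        - M.Cᵀ *ᵥ (M.C *ᵥ S.state h (M.time n i)))) ⬝ᵥ M.discreteState n θs ξ u i
      + (S.adjoint h (M.time n (i + 1)) - S.adjoint h (M.time n i)) ⬝ᵥ
        (M.discreteState n θs ξ u (i + 1) - M.discreteState n θs ξ u i))
      - (M.mesh n * ((M.C *ᵥ S.state h (M.time n i)) ⬝ᵥ (M.C *ᵥ M.discreteState n θs ξ u i))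
        + M.mesh n * (S.control h (M.time n i) ⬝ᵥ (M.U *ᵥ u i))) := by
  have h1 : S.adjoint h (M.time n i) ⬝ᵥ (M.B *ᵥ u i)
      = -(S.control h (M.time n i) ⬝ᵥ (M.U *ᵥ u i)) := by
    rw [← transpose_mulVec_dotProduct, M.U_symm, S.U_mulVec_control, dotProduct_neg, neg_neg,
      dotProduct_comm]
  have h2 : S.adjoint h (M.time n i) ⬝ᵥ M.discreteState n θs ξ u (i + 1)
      = S.adjoint h (M.time n i) ⬝ᵥ M.discreteState n θs ξ u i
        + M.mesh n * (S.adjoint h (M.time n i) ⬝ᵥ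
            (M.A θs (M.time n i) *ᵥ M.discreteState n θs ξ u i)
          + S.adjoint h (M.time n i) ⬝ᵥ (M.B *ᵥ u i)) := by
    rw [M.discreteState_succ, dotProduct_add, dotProduct_smul, dotProduct_add, smul_eq_mul]
  simp only [sub_dotProduct, dotProduct_sub, smul_dotProduct, neg_dotProduct, smul_eq_mul,
    transpose_mulVec_dotProduct, h2, h1]
  ring

/-- The product rule telescopes, and there is no boundary term since the adjoint vanishes at `0` and
`T`. The three groups in the constant come from the Euler defect of the adjoint, from the products
of increments, and from the grid point `i = n`, which occurs in `pair` but not in the telescoping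
sum. -/
lemma exists_orthogonality_bound (hLC : Conditions M Θ σ θs x₀s Xs) (hΘ : IsCompact Θ) :
    ∃ C, 0 ≤ C ∧ ∀ ω, 0 < ω → ∀ᶠ n in atTop, ∀ h ξ u,
      |M.pair n (fun i => M.C *ᵥ S.state h (M.time n i))
          (fun i => M.C *ᵥ M.discreteState n θs ξ u i)
        + ∑ i ∈ Finset.range n, M.mesh n * (S.control h (M.time n i) ⬝ᵥ (M.U *ᵥ u i))|
      ≤ C * ω * (‖h‖ * (‖ξ‖ + M.l2 n u)) := by
  obtain ⟨K, hK0, hK⟩ := hLC.exists_bound_A hΘ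
  obtain ⟨KT, hKT0, hKT⟩ := exists_entrySum_bound (R := fun t => (M.A θs t)ᵀ)
    (fun i j => hLC.continuousOn_A hLC.mem j i)
  obtain ⟨Ks, hKs0, hKs⟩ := exists_bound_sum S.continuousOn_Ξ
  obtain ⟨Kp, hKp0, hKp⟩ := exists_bound_sum S.continuousOn_P
  have hB := entrySum_nonneg M.B
  have hC := entrySum_nonneg M.C
  have hCt := entrySum_nonneg M.Cᵀ
  have hTp := M.T_pos
  set K' := Real.exp (K * M.T) * (1 + entrySum M.B * √M.T) with hK'
  have hK'0 : 0 ≤ K' := by positivity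
  set D := KT * Kp + entrySum M.Cᵀ * (entrySum M.C * Ks) with hD
  have hD0 : 0 ≤ D := by positivity
  have hlip : ∀ h, ∀ r ∈ Icc 0 M.T, ∀ s ∈ Icc 0 M.T,
      ‖S.adjoint h r - S.adjoint h s‖ ≤ D * ‖h‖ * |r - s| := fun h r hr s hs => by
    have hX := (convex_Icc 0 M.T).norm_image_sub_le_of_norm_hasDerivWithin_le
      (C := D * ‖h‖) (S.adjoint_deriv h) (fun t ht => by
        refine (norm_sub_le _ _).trans ?_
        rw [norm_neg]
        have e1 := (norm_mulVec_le (M.A θs t)ᵀ (S.adjoint h t)).trans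
          (mul_le_mul (hKT t ht) (hKp h t ht) (norm_nonneg _) hKT0)
        have e2 := (norm_mulVec_le M.Cᵀ (M.C *ᵥ S.state h t)).trans
          (mul_le_mul_of_nonneg_left ((norm_mulVec_le M.C (S.state h t)).trans
            (mul_le_mul_of_nonneg_left (hKs h t ht) hC)) hCt)
        rw [hD]
        linarith) hs hr
    rwa [Real.norm_eq_abs] at hX
  refine ⟨d * (K' * M.T) + d * (D * (K * K' * M.T + entrySum M.B * √M.T))
    + q * (entrySum M.C * Ks * (entrySum M.C * K')), by positivity, fun ω hω => ?_⟩
  filter_upwards [S.eventually_adjoint_consistent hLC hω, eventually_gt_atTop 0,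
    M.tendsto_mesh.eventually_le_const hω] with n hcons hn hmω h ξ u
  have hm := M.mesh_nonneg n
  have hl2 := M.l2_nonneg n u
  have hξ := norm_nonneg ξ
  have hh := norm_nonneg h
  set β := ‖ξ‖ + M.l2 n u with hβ
  have hβ0 : 0 ≤ β := by positivity
  have hx : ∀ i ≤ n, ‖M.discreteState n θs ξ u i‖ ≤ K' * β :=
    M.norm_discreteState_le hK0.le (hK θs hLC.mem) n ξ u
  set τ : ℕ → ℝ := fun i => (S.adjoint h (M.time n (i + 1)) - S.adjoint h (M.time n i)
      - M.mesh n • (-((M.A θs (M.time n i))ᵀ *ᵥ S.adjoint h (M.time n i))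
        - M.Cᵀ *ᵥ (M.C *ᵥ S.state h (M.time n i)))) ⬝ᵥ M.discreteState n θs ξ u i with hτ
  set κ : ℕ → ℝ := fun i => (S.adjoint h (M.time n (i + 1)) - S.adjoint h (M.time n i)) ⬝ᵥ
        (M.discreteState n θs ξ u (i + 1) - M.discreteState n θs ξ u i) with hκ
  have htel := Finset.sum_range_sub
    (fun i => S.adjoint h (M.time n i) ⬝ᵥ M.discreteState n θs ξ u i) n
  rw [M.time_last hn, M.time_zero, S.adjoint_last, S.adjoint_zero, zero_dotProduct,
    zero_dotProduct, sub_zero, Finset.sum_congr rfl fun i _ => S.adjoint_dotProduct_succ n h ξ u i,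
    Finset.sum_sub_distrib, Finset.sum_add_distrib, Finset.sum_add_distrib] at htel
  have hpair : M.pair n (fun i => M.C *ᵥ S.state h (M.time n i))
      (fun i => M.C *ᵥ M.discreteState n θs ξ u i)
      = ∑ i ∈ Finset.range n, M.mesh n * ((M.C *ᵥ S.state h (M.time n i)) ⬝ᵥ
          (M.C *ᵥ M.discreteState n θs ξ u i))
        + M.mesh n * ((M.C *ᵥ S.state h (M.time n n)) ⬝ᵥ
          (M.C *ᵥ M.discreteState n θs ξ u n)) := Finset.sum_range_succ _ _
  have hτb : |∑ i ∈ Finset.range n, τ i| ≤ M.T * (d * (ω * ‖h‖ * (K' * β))) := by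
    refine (Finset.abs_sum_le_sum_abs _ _).trans (le_trans (Finset.sum_le_sum fun i hi => ?_)
      (M.sum_mesh_le n _ (by positivity)))
    have hi' := Finset.mem_range.1 hi
    refine (abs_dotProduct_le _ _).trans ?_
    have := mul_le_mul (hcons h i hi') (hx i hi'.le) (norm_nonneg _) (by positivity)
    calc _ ≤ (d : ℝ) * (M.mesh n * (ω * ‖h‖) * (K' * β)) := by gcongr
      _ = _ := by ring
  have hκb : |∑ i ∈ Finset.range n, κ i|
      ≤ ω * (d * (D * ‖h‖ * (K * (K' * β) * M.T + entrySum M.B * √M.T * M.l2 n u))) := by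
    have h1 : ∀ i ∈ Finset.range n, |κ i| ≤ d * (M.mesh n * (D * ‖h‖)) *
        (M.mesh n * (K * (K' * β)) + entrySum M.B * (M.mesh n * ‖u i‖)) := fun i hi => by
      have hi' := Finset.mem_range.1 hi
      refine (abs_dotProduct_le _ _).trans ?_
      have e1 := hlip h _ (M.time_mem n hi') _ (M.time_mem n hi'.le)
      rw [M.time_succ, add_sub_cancel_left, abs_of_nonneg hm, ← M.time_succ] at e1
      have e2 : ‖M.discreteState n θs ξ u (i + 1) - M.discreteState n θs ξ u i‖
          ≤ M.mesh n * (K * (K' * β)) + entrySum M.B * (M.mesh n * ‖u i‖) := by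
        rw [M.discreteState_succ, add_sub_cancel_left, norm_smul, Real.norm_of_nonneg hm]
        have e3 := (norm_mulVec_le (M.A θs (M.time n i)) (M.discreteState n θs ξ u i)).trans
          (mul_le_mul (hK θs hLC.mem _ (M.time_mem n hi'.le)) (hx i hi'.le) (norm_nonneg _)
            hK0.le)
        have e4 := norm_mulVec_le M.B (u i)
        calc _ ≤ M.mesh n * (K * (K' * β) + entrySum M.B * ‖u i‖) :=
              mul_le_mul_of_nonneg_left ((norm_add_le _ _).trans (add_le_add e3 e4)) hm
          _ = _ := by ring
      calc _ ≤ (d : ℝ) * ((D * ‖h‖ * M.mesh n) *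
            (M.mesh n * (K * (K' * β)) + entrySum M.B * (M.mesh n * ‖u i‖))) :=
            mul_le_mul_of_nonneg_left (mul_le_mul e1 e2 (norm_nonneg _) (by positivity))
              d.cast_nonneg
        _ = _ := by ring
    refine (Finset.abs_sum_le_sum_abs _ _).trans ((Finset.sum_le_sum h1).trans ?_)
    rw [← Finset.mul_sum, Finset.sum_add_distrib,
      ← Finset.mul_sum _ (fun i => M.mesh n * ‖u i‖) (entrySum M.B)]
    have e5 := M.sum_mesh_le n (K * (K' * β)) (by positivity)
    have e6 := mul_le_mul_of_nonneg_left (M.sum_mesh_mul_norm_le n u) hB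
    calc _ ≤ d * (ω * (D * ‖h‖)) * (M.T * (K * (K' * β))
          + entrySum M.B * (√M.T * M.l2 n u)) := by gcongr
      _ = _ := by ring
  have hlast : |M.mesh n * ((M.C *ᵥ S.state h (M.time n n)) ⬝ᵥ
          (M.C *ᵥ M.discreteState n θs ξ u n))|
      ≤ ω * (q * (entrySum M.C * (Ks * ‖h‖) * (entrySum M.C * (K' * β)))) := by
    rw [abs_mul, abs_of_nonneg hm]
    refine mul_le_mul hmω ((abs_dotProduct_le _ _).trans (mul_le_mul_of_nonneg_left
      (mul_le_mul ?_ ?_ (norm_nonneg _) (by positivity)) q.cast_nonneg)) (abs_nonneg _) hω.le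
    · exact (norm_mulVec_le _ _).trans (mul_le_mul_of_nonneg_left
        (hKs h _ (M.time_mem n le_rfl)) hC)
    · exact (norm_mulVec_le _ _).trans (mul_le_mul_of_nonneg_left (hx n le_rfl) hC)
  have heq : M.pair n (fun i => M.C *ᵥ S.state h (M.time n i))
          (fun i => M.C *ᵥ M.discreteState n θs ξ u i)
        + ∑ i ∈ Finset.range n, M.mesh n * (S.control h (M.time n i) ⬝ᵥ (M.U *ᵥ u i))
      = (∑ i ∈ Finset.range n, τ i + ∑ i ∈ Finset.range n, κ i)
        + M.mesh n * ((M.C *ᵥ S.state h (M.time n n)) ⬝ᵥ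
          (M.C *ᵥ M.discreteState n θs ξ u n)) := by
    rw [hpair]
    simp only [hτ, hκ]
    linarith
  rw [heq]
  refine (abs_add_le _ _).trans ((add_le_add ((abs_add_le _ _).trans (add_le_add hτb hκb))
    hlast).trans ?_)
  have e7 : entrySum M.B * √M.T * M.l2 n u ≤ entrySum M.B * √M.T * β :=
    mul_le_mul_of_nonneg_left (by linarith) (by positivity)
  have e8 : ω * (d * (D * ‖h‖ * (K * (K' * β) * M.T + entrySum M.B * √M.T * M.l2 n u)))
      ≤ ω * (d * (D * ‖h‖ * (K * (K' * β) * M.T + entrySum M.B * √M.T * β))) := by gcongr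
  linarith

lemma eventually_fisher_close {ω : ℝ} (hω : 0 < ω) :
    ∀ᶠ n in atTop, ∀ h : EuclideanSpace ℝ (Fin p),
      |M.pair n (fun i => M.C *ᵥ S.state h (M.time n i)) (fun i => M.C *ᵥ S.state h (M.time n i))
        + M.energy n (fun i => S.control h (M.time n i)) - (h : Fin p → ℝ) ⬝ᵥ (S.fisher *ᵥ h)|
      ≤ ω * ‖h‖ ^ 2 := by
  have hω' : 0 < ω / (p ^ 2 + 1) := by positivity
  set F : ℕ → Fin p → Fin p → ℝ := fun n k l =>
    ∑ i ∈ Finset.range (n + 1), M.mesh n * ((M.C *ᵥ S.Ξ k (M.time n i)) ⬝ᵥ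
      (M.C *ᵥ S.Ξ l (M.time n i)))
    + ∑ i ∈ Finset.range n, M.mesh n * (S.w k (M.time n i) ⬝ᵥ (M.U *ᵥ S.w l (M.time n i))) with hF
  have hlim : ∀ k l, Tendsto (fun n => F n k l) atTop (𝓝 (S.fisher k l)) := fun k l => by
    have h1 := (M.tendsto_riemann_sum_succ (S.continuousOn_gram_integrand k l)).add
      (M.tendsto_riemann_sum (S.continuousOn_control_integrand k l))
    rw [← intervalIntegral.integral_add
      ((S.continuousOn_gram_integrand k l).intervalIntegrable_of_Icc M.T_pos.le)
      ((S.continuousOn_control_integrand k l).intervalIntegrable_of_Icc M.T_pos.le)] at h1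
    exact h1
  have hev := eventually_all.2 fun k => eventually_all.2 fun l =>
    (Metric.tendsto_nhds.1 (hlim k l) _ hω')
  filter_upwards [hev] with n hn h
  have hsum : M.pair n (fun i => M.C *ᵥ S.state h (M.time n i))
        (fun i => M.C *ᵥ S.state h (M.time n i))
        + M.energy n (fun i => S.control h (M.time n i)) = ∑ k, ∑ l, h k * h l * F n k l := by
    unfold Model.pair Model.energy
    simp only [S.gram_pointwise, S.control_pointwise, hF, mul_add, Finset.sum_add_distrib,
      Finset.mul_sum]
    congr 1
    · rw [Finset.sum_comm]
      refine Finset.sum_congr rfl fun k _ => ?_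
      rw [Finset.sum_comm]
      exact Finset.sum_congr rfl fun l _ => Finset.sum_congr rfl fun i _ => by ring
    · rw [Finset.sum_comm]
      refine Finset.sum_congr rfl fun k _ => ?_
      rw [Finset.sum_comm]
      exact Finset.sum_congr rfl fun l _ => Finset.sum_congr rfl fun i _ => by ring
  rw [hsum, quadratic_eq_sum, ← Finset.sum_sub_distrib]
  have h1 : ∀ k, |∑ l, h k * h l * F n k l - ∑ l, h k * h l * S.fisher k l|
      ≤ |h k| * ((∑ l, |h l|) * (ω / (p ^ 2 + 1))) := fun k => by
    rw [← Finset.sum_sub_distrib]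
    refine (Finset.abs_sum_le_sum_abs _ _).trans ?_
    rw [Finset.sum_mul, Finset.mul_sum]
    refine Finset.sum_le_sum fun l _ => ?_
    rw [← mul_sub, abs_mul, abs_mul, mul_assoc]
    have := (hn k l).le
    rw [Real.dist_eq] at this
    gcongr
  refine (Finset.abs_sum_le_sum_abs _ _).trans ((Finset.sum_le_sum fun k _ => h1 k).trans ?_)
  rw [← Finset.sum_mul]
  have h2 := sum_abs_le_norm h
  have h0 : 0 ≤ ∑ k, |h k| := Finset.sum_nonneg fun _ _ => abs_nonneg _
  calc _ ≤ (p * ‖h‖) * ((p * ‖h‖) * (ω / (p ^ 2 + 1))) := by gcongr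
    _ = (p ^ 2 / (p ^ 2 + 1)) * (ω * ‖h‖ ^ 2) := by ring
    _ ≤ _ := mul_le_of_le_one_left (by positivity) ((div_le_one (by positivity)).2 (by linarith))

lemma pair_state_eq_score (n : ℕ) (h : EuclideanSpace ℝ (Fin p)) (e : ℕ → Fin q → ℝ) :
    M.pair n (fun i => M.C *ᵥ S.state h (M.time n i)) e = (h : Fin p → ℝ) ⬝ᵥ S.score n e := by
  have h1 : ∀ i, (M.C *ᵥ S.state h (M.time n i)) ⬝ᵥ e i
      = ∑ k, h k * ((M.C *ᵥ S.Ξ k (M.time n i)) ⬝ᵥ e i) := fun i => by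
    simp only [state, Matrix.mulVec_sum, Matrix.mulVec_smul, sum_dotProduct, smul_dotProduct,
      smul_eq_mul]
  have h2 : (h : Fin p → ℝ) ⬝ᵥ S.score n e = ∑ k, ∑ i ∈ Finset.range (n + 1),
      h k * (M.mesh n * ((M.C *ᵥ S.Ξ k (M.time n i)) ⬝ᵥ e i)) := by
    refine Finset.sum_congr rfl fun k _ => ?_
    rw [← Finset.mul_sum]
    rfl
  rw [h2, Finset.sum_comm]
  refine Finset.sum_congr rfl fun i _ => ?_
  rw [h1, Finset.mul_sum]
  exact Finset.sum_congr rfl fun k _ => by ring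

end Sensitivity

end TrackedLinearODE

/-! ### Quadratic expansion of the excess cost. -/

namespace TrackedLinearODE

variable {p d q m : ℕ} {M : Model p d q m} {Θ : Set (EuclideanSpace ℝ (Fin p))} {σ : ℝ}
  {θs : EuclideanSpace ℝ (Fin p)} {x₀s : Fin d → ℝ} {Xs : ℝ → Fin d → ℝ}

lemma Model.energy_add (M : Model p d q m) (n : ℕ) (u v : ℕ → Fin m → ℝ) :
    M.energy n (fun i => u i + v i) = M.energy n u
      + 2 * ∑ i ∈ Finset.range n, M.mesh n * (u i ⬝ᵥ (M.U *ᵥ v i)) + M.energy n v := by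
  unfold Model.energy
  rw [Finset.mul_sum, ← Finset.sum_add_distrib, ← Finset.sum_add_distrib]
  refine Finset.sum_congr rfl fun i _ => ?_
  rw [Matrix.mulVec_add, add_dotProduct, dotProduct_add, dotProduct_add, M.U_symm (v i) (u i)]
  ring

lemma Model.tendsto_one_div_sqrt : Tendsto (fun n : ℕ => 1 / √(n : ℝ)) atTop (𝓝 0) := by
  have h := (Real.tendsto_sqrt_atTop.comp (tendsto_natCast_atTop_atTop (R := ℝ))).inv_tendsto_atTop
  simp only [one_div]
  exact h

lemma Model.mesh_eq (M : Model p d q m) (n : ℕ) : M.mesh n = M.T * (1 / √(n : ℝ)) ^ 2 := by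
  rw [div_pow, Real.sq_sqrt n.cast_nonneg, Model.mesh]
  ring

namespace Sensitivity

variable (S : Sensitivity M θs Xs)

/-- The excess cost at the perturbation `(h, ξ, u)` of the true data. -/
noncomputable def perturbedExcess (n : ℕ) (x₀s : Fin d → ℝ) (e : ℕ → Fin q → ℝ)
    (h : EuclideanSpace ℝ (Fin p)) (ξ : Fin d → ℝ) (u : ℕ → Fin m → ℝ) : ℝ :=
  M.excess n Xs e (θs + h) (x₀s + S.state h 0 + ξ) (fun i => S.control h (M.time n i) + u i)

/-- The part of the quadratic expansion of the excess cost which does not involve the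
parameter. -/
noncomputable def nuisance (_S : Sensitivity M θs Xs) (n : ℕ) (e : ℕ → Fin q → ℝ)
    (ξ : Fin d → ℝ) (u : ℕ → Fin m → ℝ) : ℝ :=
  M.pair n (fun i => M.C *ᵥ M.discreteState n θs ξ u i)
      (fun i => M.C *ᵥ M.discreteState n θs ξ u i) + M.energy n u
    - 2 * M.pair n (fun i => M.C *ᵥ M.discreteState n θs ξ u i) e

/-- The part of the quadratic expansion of the excess cost which involves the parameter. -/
noncomputable def quadratic (n : ℕ) (e : ℕ → Fin q → ℝ) (h : EuclideanSpace ℝ (Fin p)) : ℝ :=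
  (h : Fin p → ℝ) ⬝ᵥ (S.fisher *ᵥ h) - 2 * ((h : Fin p → ℝ) ⬝ᵥ S.score n e)

/-- An exact identity whose right-hand side lists the errors to control: the Riemann sums for
`fisher`, the failure of discrete orthogonality, and the three terms that involve the remainder. -/
lemma perturbedExcess_eq (n : ℕ) (x₀s : Fin d → ℝ) (e : ℕ → Fin q → ℝ)
    (h : EuclideanSpace ℝ (Fin p)) (ξ : Fin d → ℝ) (u : ℕ → Fin m → ℝ) :
    S.perturbedExcess n x₀s e h ξ u - (S.quadratic n e h + S.nuisance n e ξ u) =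
      (M.pair n (fun i => M.C *ᵥ S.state h (M.time n i)) (fun i => M.C *ᵥ S.state h (M.time n i))
        + M.energy n (fun i => S.control h (M.time n i)) - (h : Fin p → ℝ) ⬝ᵥ (S.fisher *ᵥ h))
      + 2 * (M.pair n (fun i => M.C *ᵥ S.state h (M.time n i))
          (fun i => M.C *ᵥ M.discreteState n θs ξ u i)
        + ∑ i ∈ Finset.range n, M.mesh n * (S.control h (M.time n i) ⬝ᵥ (M.U *ᵥ u i)))
      + 2 * M.pair n (fun i => M.C *ᵥ S.state h (M.time n i)
            + M.C *ᵥ M.discreteState n θs ξ u i)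
          (fun i => M.C *ᵥ S.remainder n h x₀s ξ u i)
      + M.pair n (fun i => M.C *ᵥ S.remainder n h x₀s ξ u i)
          (fun i => M.C *ᵥ S.remainder n h x₀s ξ u i)
      - 2 * M.pair n (fun i => M.C *ᵥ S.remainder n h x₀s ξ u i) e := by
  have hr : (fun i => M.C *ᵥ M.discreteState n (θs + h) (x₀s + S.state h 0 + ξ)
        (fun i => S.control h (M.time n i) + u i) i - M.C *ᵥ Xs (M.time n i))
      = fun i => (M.C *ᵥ S.state h (M.time n i) + M.C *ᵥ M.discreteState n θs ξ u i)
        + M.C *ᵥ S.remainder n h x₀s ξ u i := by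
    funext i
    simp only [remainder, perturbed, Matrix.mulVec_sub]
    abel
  unfold perturbedExcess Model.excess quadratic nuisance
  rw [hr, M.pair_add_self, M.pair_add_self, M.pair_add_left _ _ _ e, M.pair_add_left _ _ _ e,
    M.energy_add, S.pair_state_eq_score n h e]
  ring

/-- Uniform in `ξ` and `u`, with an error small relative to the square of the total scale. The scale
contains `1 / √n` to absorb the noise and the mesh. -/
lemma eventually_expansion (hLC : Conditions M Θ σ θs x₀s Xs) (hΘ : IsCompact Θ)
    (hXs : M.IsSolution θs x₀s Xs) {K₀ ω : ℝ} (hK₀ : 0 ≤ K₀) (hω : 0 < ω) :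
    ∀ᶠ (x : ℕ × EuclideanSpace ℝ (Fin p)) in atTop ×ˢ 𝓝 0, ∀ e,
      M.noiseSize x.1 e ≤ K₀ * (1 / √(x.1 : ℝ)) → ∀ ξ u,
      |S.perturbedExcess x.1 x₀s e x.2 ξ u - (S.quadratic x.1 e x.2 + S.nuisance x.1 e ξ u)|
        ≤ ω * (‖x.2‖ + (‖ξ‖ + M.l2 x.1 u) + 1 / √(x.1 : ℝ)) ^ 2 := by
  obtain ⟨K, hK0, hK⟩ := hLC.exists_bound_A hΘ
  obtain ⟨Ks, hKs0, hKs⟩ := exists_bound_sum S.continuousOn_Ξ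
  obtain ⟨C, hC0, hCrem⟩ := S.exists_remainder_bound hLC hΘ hXs
  obtain ⟨Co, hCo0, hCo⟩ := S.exists_orthogonality_bound hLC hΘ
  have hB := entrySum_nonneg M.B
  have hC := entrySum_nonneg M.C
  have hTp := M.T_pos
  set K' := Real.exp (K * M.T) * (1 + entrySum M.B * √M.T) with hK'
  have hK'0 : 0 ≤ K' := by positivity
  set c := entrySum M.C with hc
  -- The five summands are the constants of the five errors in `perturbedExcess_eq`, each relative
  -- to `ω₁ * s ^ 2`.
  set Γ := 1 + 2 * Co + 2 * (q * (M.T + M.T) * (c * (Ks + K') * (c * C)))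
    + q * (M.T + M.T) * (c * C * (c * C)) + 2 * (q * (c * C * (1 + √M.T) * K₀)) with hΓ
  have hΓ0 : 0 < Γ := by positivity
  obtain ⟨ω₁, hω₁, hω₁1, hω₁Γ⟩ : ∃ ω₁ : ℝ, 0 < ω₁ ∧ ω₁ ≤ 1 ∧ ω₁ * Γ ≤ ω :=
    ⟨min 1 (ω / Γ), lt_min one_pos (by positivity), min_le_left _ _,
      (le_div_iff₀ hΓ0).1 (min_le_right _ _)⟩
  -- The Euler bias is of order `1 / n`, hence negligible at the scale `1 / √n`.
  have hmesh : ∀ᶠ n : ℕ in atTop, M.mesh n ≤ ω₁ * (1 / √(n : ℝ)) := by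
    have h1 := (Model.tendsto_one_div_sqrt.const_mul M.T)
    rw [mul_zero] at h1
    filter_upwards [h1.eventually_le_const hω₁] with n hn
    rw [M.mesh_eq, pow_two, ← mul_assoc]
    exact mul_le_mul_of_nonneg_right hn (by positivity)
  have h1 := (((hCo ω₁ hω₁).and (S.eventually_fisher_close hω₁)).and
    (hmesh.and (eventually_gt_atTop 0))).prod_inl (𝓝 (0 : EuclideanSpace ℝ (Fin p)))
  filter_upwards [h1, hCrem ω₁ hω₁] with x hx hrem e he ξ u
  obtain ⟨n, h⟩ := x
  obtain ⟨⟨horth, hfis⟩, hmν, hn⟩ := hx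
  dsimp only at horth hfis hmν hn hrem he ⊢
  have hm := M.mesh_nonneg n
  have hmT := M.mesh_le hn
  have hl2 := M.l2_nonneg n u
  have hξ := norm_nonneg ξ
  have hh := norm_nonneg h
  have hN := M.noiseSize_nonneg n e
  obtain ⟨hR, hdR⟩ := hrem ξ u
  set ν := 1 / √(n : ℝ) with hν
  have hν0 : 0 ≤ ν := by positivity
  set b := ‖h‖ + (‖ξ‖ + M.l2 n u) with hb
  have hb0 : 0 ≤ b := by positivity
  set s := b + ν with hs
  have hs0 : 0 ≤ s := by positivity
  have hρ : C * (ω₁ * b + M.mesh n) ≤ C * (ω₁ * s) :=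
    mul_le_mul_of_nonneg_left (by rw [hs]; linarith) hC0
  have hρ0 : 0 ≤ C * (ω₁ * s) := by positivity
  have hCR : ∀ i ≤ n, ‖M.C *ᵥ S.remainder n h x₀s ξ u i‖ ≤ c * (C * (ω₁ * s)) := fun i hi =>
    (norm_mulVec_le _ _).trans (mul_le_mul_of_nonneg_left ((hR i hi).trans hρ) hC)
  have hz : ∀ i ≤ n, ‖M.C *ᵥ S.state h (M.time n i) + M.C *ᵥ M.discreteState n θs ξ u i‖
      ≤ c * ((Ks + K') * s) := fun i hi => by
    rw [← Matrix.mulVec_add]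
    refine (norm_mulVec_le _ _).trans (mul_le_mul_of_nonneg_left ((norm_add_le _ _).trans ?_) hC)
    have a1 : ‖S.state h (M.time n i)‖ ≤ Ks * ‖h‖ := hKs h _ (M.time_mem n hi)
    have a2 := M.norm_discreteState_le hK0.le (hK θs hLC.mem) n ξ u i hi
    have a3 : Ks * ‖h‖ ≤ Ks * s := mul_le_mul_of_nonneg_left (by linarith) hKs0
    have a4 : K' * (‖ξ‖ + M.l2 n u) ≤ K' * s := mul_le_mul_of_nonneg_left (by linarith) hK'0
    linarith
  have hq : (q : ℝ) * (M.T + M.mesh n) ≤ q * (M.T + M.T) := by gcongr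
  have e1 := hfis h
  have e2 := horth h ξ u
  have e3 := M.abs_pair_le n hz hCR
  have e4 := M.abs_pair_le n hCR hCR
  have e5 := M.abs_pair_noise_le n (fun i => M.C *ᵥ S.remainder n h x₀s ξ u i) e
    (fun _ => (0 : Fin 0 → ℝ)) (b₁ := c * (C * (ω₁ * s))) (b₂ := 0) (by positivity) le_rfl
    (hCR n le_rfl) (fun i hi => by
      rw [← Matrix.mulVec_sub, zero_mul, add_zero]
      refine (norm_mulVec_le _ _).trans ((mul_le_mul_of_nonneg_left ((hdR i hi).trans
        (mul_le_mul_of_nonneg_left hρ hm)) hC).trans (le_of_eq (by ring))))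
  rw [zero_mul, add_zero] at e5
  have f1 : ω₁ * ‖h‖ ^ 2 ≤ ω₁ * s ^ 2 := by
    have : ‖h‖ ≤ s := by linarith
    gcongr
  have f2 : Co * ω₁ * (‖h‖ * (‖ξ‖ + M.l2 n u)) ≤ Co * ω₁ * (s * s) := by
    have : ‖h‖ ≤ s := by linarith
    have : ‖ξ‖ + M.l2 n u ≤ s := by linarith
    gcongr
  have f3 : q * (M.T + M.mesh n) * (c * ((Ks + K') * s) * (c * (C * (ω₁ * s))))
      ≤ q * (M.T + M.T) * (c * ((Ks + K') * s) * (c * (C * (ω₁ * s)))) :=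
    mul_le_mul_of_nonneg_right hq (by positivity)
  have f4 : q * (M.T + M.mesh n) * (c * (C * (ω₁ * s)) * (c * (C * (ω₁ * s))))
      ≤ q * (M.T + M.T) * (c * (C * (1 * s)) * (c * (C * (ω₁ * s)))) := by
    refine (mul_le_mul_of_nonneg_right hq (by positivity)).trans ?_
    gcongr
  have f5 : q * ((c * (C * (ω₁ * s)) + c * (C * (ω₁ * s)) * √M.T) * M.noiseSize n e)
      ≤ q * ((c * (C * (ω₁ * s)) + c * (C * (ω₁ * s)) * √M.T) * (K₀ * s)) := by
    have : M.noiseSize n e ≤ K₀ * s :=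
      he.trans (mul_le_mul_of_nonneg_left (by linarith) hK₀)
    gcongr
  rw [S.perturbedExcess_eq]
  calc _ ≤ ω₁ * Γ * s ^ 2 := by
        rw [abs_le] at e1 e2 e3 e4 e5 ⊢
        have hexp : ω₁ * Γ * s ^ 2 = ω₁ * s ^ 2 + 2 * (Co * ω₁ * (s * s))
          + 2 * (q * (M.T + M.T) * (c * ((Ks + K') * s) * (c * (C * (ω₁ * s)))))
          + q * (M.T + M.T) * (c * (C * (1 * s)) * (c * (C * (ω₁ * s))))
          + 2 * (q * ((c * (C * (ω₁ * s)) + c * (C * (ω₁ * s)) * √M.T) * (K₀ * s))) := by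
          rw [hΓ]; ring
        rw [hexp]
        constructor <;> linarith [e1.1, e1.2, e2.1, e2.2, e3.1, e3.2, e4.1, e4.2, e5.1, e5.2]
    _ ≤ ω * s ^ 2 := mul_le_mul_of_nonneg_right hω₁Γ (sq_nonneg _)

end Sensitivity

end TrackedLinearODE

/-! ### Deterministic linearization of the minimizer. -/

namespace TrackedLinearODE

variable {p d q m : ℕ} {M : Model p d q m} {Θ : Set (EuclideanSpace ℝ (Fin p))} {σ : ℝ}
  {θs : EuclideanSpace ℝ (Fin p)} {x₀s : Fin d → ℝ} {Xs : ℝ → Fin d → ℝ}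

namespace Model

variable (M)

lemma discreteCost_nonneg (n : ℕ) (Y : ℕ → Fin q → ℝ) (θ : EuclideanSpace ℝ (Fin p))
    (x : Fin d → ℝ) (u : ℕ → Fin m → ℝ) : 0 ≤ M.discreteCost n Y θ x u :=
  add_nonneg (Finset.sum_nonneg fun _ _ =>
    mul_nonneg (M.mesh_nonneg n) (dotProduct_self_nonneg' _)) (M.energy_nonneg n u)

lemma discreteProfileCI_le (n : ℕ) (Y : ℕ → Fin q → ℝ) (θ : EuclideanSpace ℝ (Fin p))
    (x : Fin d → ℝ) (u : ℕ → Fin m → ℝ) :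
    M.discreteProfileCI n Y θ ≤ M.discreteCost n Y θ x u :=
  (ciInf_le ⟨0, by
    rintro _ ⟨x, rfl⟩
    exact Real.iInf_nonneg fun u => M.discreteCost_nonneg n Y θ x u⟩ x).trans
  (ciInf_le ⟨0, by rintro _ ⟨u, rfl⟩; exact M.discreteCost_nonneg n Y θ x u⟩ u)

/-- Points within `s` of the infima over `x` and `u` are enough, so attainment of these infima is
not needed. -/
lemma exists_near_minimizer {n : ℕ} {e : ℕ → EuclideanSpace ℝ (Fin q)}
    {θ : EuclideanSpace ℝ (Fin p)}
    (hmin : IsMinOn (M.discreteProfileCI n (observations M n Xs e)) Θ θ) {s : ℝ} (hs : 0 < s) :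
    ∃ x u, ∀ θ' ∈ Θ, ∀ x' u', M.excess n Xs (fun i => e i) θ x u
      ≤ M.excess n Xs (fun i => e i) θ' x' u' + s := by
  have hobs : observations M n Xs e = fun i => M.C *ᵥ Xs (M.time n i) + (e i : Fin q → ℝ) := rfl
  have h1 : (⨅ x, M.discreteProfile n (observations M n Xs e) θ x)
      < M.discreteProfileCI n (observations M n Xs e) θ + s := lt_add_of_pos_right _ hs
  obtain ⟨x, hx⟩ := exists_lt_of_ciInf_lt h1
  obtain ⟨u, hu⟩ := exists_lt_of_ciInf_lt (show (⨅ u, M.discreteCost n (observations M n Xs e) θ x u)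
    < M.discreteProfileCI n (observations M n Xs e) θ + s from hx)
  refine ⟨x, u, fun θ' hθ' x' u' => ?_⟩
  have h2 := isMinOn_iff.1 hmin θ' hθ'
  have h3 := M.discreteProfileCI_le n (observations M n Xs e) θ' x' u'
  rw [hobs] at hu h2 h3
  rw [M.discreteCost_eq_excess] at hu h3
  linarith

end Model

lemma norm_le_sup_norm (h : EuclideanSpace ℝ (Fin p)) : ‖h‖ ≤ (p + 1) * ‖(h : Fin p → ℝ)‖ := by
  rw [EuclideanSpace.norm_eq]
  refine Real.sqrt_le_iff.2 ⟨by positivity, ?_⟩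
  calc ∑ i, ‖h i‖ ^ 2 ≤ ∑ _i : Fin p, ‖(h : Fin p → ℝ)‖ ^ 2 :=
        Finset.sum_le_sum fun i _ => by
          have := norm_le_pi_norm (h : Fin p → ℝ) i
          gcongr
    _ = p * ‖(h : Fin p → ℝ)‖ ^ 2 := by simp
    _ ≤ ((p + 1) * ‖(h : Fin p → ℝ)‖) ^ 2 := by
        rw [mul_pow]
        have : (0 : ℝ) ≤ p := p.cast_nonneg
        refine mul_le_mul_of_nonneg_right ?_ (sq_nonneg _)
        nlinarith

lemma le_mul_of_quadratic_le {κ a b ν : ℝ} (hκ : 0 < κ) (ha : 0 ≤ a) (hν : 0 < ν)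
    (h : κ / 2 * b ^ 2 ≤ a * ν * b + κ * ν ^ 2) : b ≤ (2 * a / κ + 2) * ν := by
  by_contra! hlt
  have h1 : 0 ≤ 2 * a / κ * ν := by positivity
  have hb : 2 * ν < b := by linarith
  have h2 : 0 < κ / 2 * b * (b - (2 * a / κ + 2) * ν) :=
    mul_pos (mul_pos (half_pos hκ) (by linarith)) (by linarith)
  have h3 : κ / 2 * b * (b - (2 * a / κ + 2) * ν) = κ / 2 * b ^ 2 - a * ν * b - κ * ν * b := by
    field_simp
    ring
  have h4 : κ * ν * ν < κ * ν * b := mul_lt_mul_of_pos_left (by linarith) (mul_pos hκ hν)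
  nlinarith

namespace Sensitivity

variable (S : Sensitivity M θs Xs)

lemma fisher_symm : S.fisherᵀ = S.fisher := by
  ext k l
  simp only [fisher, Matrix.transpose_apply, Matrix.of_apply]
  congr 1
  funext t
  rw [dotProduct_comm, M.U_symm]

/-- The linearized estimation error. -/
noncomputable def linearError (n : ℕ) (e : ℕ → Fin q → ℝ) : EuclideanSpace ℝ (Fin p) :=
  WithLp.toLp 2 (S.fisher⁻¹ *ᵥ S.score n e)

lemma fisher_posDef (hLC : Conditions M Θ σ θs x₀s Xs) (hΘ : IsCompact Θ)
    (hXs : M.IsSolution θs x₀s Xs) : S.fisher.PosDef :=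
  Matrix.PosDef.of_dotProduct_mulVec_pos
    (by rw [Matrix.IsHermitian, Matrix.conjTranspose_eq_transpose_of_trivial, S.fisher_symm])
    fun v hv => by simpa using hLC.fisher_pos hΘ hXs S v hv

lemma fisher_mulVec_linearError (hLC : Conditions M Θ σ θs x₀s Xs) (hΘ : IsCompact Θ)
    (hXs : M.IsSolution θs x₀s Xs) (n : ℕ) (e : ℕ → Fin q → ℝ) :
    S.fisher *ᵥ (S.linearError n e : Fin p → ℝ) = S.score n e := by
  have hu : IsUnit S.fisher.det := (S.fisher_posDef hLC hΘ hXs).det_pos.ne'.isUnit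
  simp only [linearError]
  rw [Matrix.mulVec_mulVec, Matrix.mul_nonsing_inv _ hu, Matrix.one_mulVec]

/-- Completion of the square: `linearError` is the minimizer of the parameter block. -/
lemma quadratic_sub (hLC : Conditions M Θ σ θs x₀s Xs) (hΘ : IsCompact Θ)
    (hXs : M.IsSolution θs x₀s Xs) (n : ℕ) (e : ℕ → Fin q → ℝ) (h : EuclideanSpace ℝ (Fin p)) :
    S.quadratic n e h - S.quadratic n e (S.linearError n e)
      = (h - S.linearError n e : Fin p → ℝ) ⬝ᵥ (S.fisher *ᵥ (h - S.linearError n e : Fin p → ℝ)) := by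
  unfold quadratic
  rw [← S.fisher_mulVec_linearError hLC hΘ hXs n e]
  have h1 : (S.linearError n e : Fin p → ℝ) ⬝ᵥ (S.fisher *ᵥ (h : Fin p → ℝ))
      = (h : Fin p → ℝ) ⬝ᵥ (S.fisher *ᵥ (S.linearError n e : Fin p → ℝ)) := by
    rw [← transpose_mulVec_dotProduct, S.fisher_symm, dotProduct_comm]
  rw [Matrix.mulVec_sub, dotProduct_sub, sub_dotProduct, sub_dotProduct, h1]
  ring

lemma exists_fisher_lower_bound (hLC : Conditions M Θ σ θs x₀s Xs) (hΘ : IsCompact Θ)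
    (hXs : M.IsSolution θs x₀s Xs) : ∃ c, 0 < c ∧ ∀ h : EuclideanSpace ℝ (Fin p),
      c * ‖h‖ ^ 2 ≤ (h : Fin p → ℝ) ⬝ᵥ (S.fisher *ᵥ h) := by
  obtain ⟨c, hc, h⟩ := exists_quadratic_lower_bound (hLC.fisher_pos hΘ hXs S)
  refine ⟨c / (p + 1) ^ 2, by positivity, fun v => le_trans ?_ (h v)⟩
  rw [div_mul_eq_mul_div, div_le_iff₀ (by positivity), mul_assoc, ← mul_pow, mul_comm ‖_‖ (_ + _)]
  have := norm_le_sup_norm v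
  gcongr

lemma exists_score_bound (hLC : Conditions M Θ σ θs x₀s Xs) (hXs : M.IsSolution θs x₀s Xs) :
    ∃ c, 0 ≤ c ∧ ∀ n e, ‖S.score n e‖ ≤ c * M.noiseSize n e := by
  have hk : ∀ k, ∃ c, 0 ≤ c ∧ ∀ n e, |S.score n e k| ≤ c * M.noiseSize n e := fun k => by
    obtain ⟨b₀, hb₀, h₀⟩ := ContinuousOn.exists_bound (S.continuousOn_Ξ k)
    obtain ⟨b₁, hb₁, h₁⟩ := ContinuousOn.exists_bound
      (((ContinuousOn.matrix_mulVec (hLC.continuousOn_A hLC.mem) (S.continuousOn_Ξ k)).add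
        (ContinuousOn.const_mulVec M.B (S.continuousOn_w k))).add
        (ContinuousOn.matrix_mulVec (S.G_cont k) hXs.continuousOn))
    have hC := entrySum_nonneg M.C
    exact ⟨_, by positivity, fun n e => M.abs_pair_curve_noise_le hb₁ (S.Ξ_deriv k) h₀ h₁ n e⟩
  choose c hc0 hc using hk
  refine ⟨∑ k, c k, Finset.sum_nonneg fun k _ => hc0 k, fun n e => ?_⟩
  have hN := M.noiseSize_nonneg n e
  refine (pi_norm_le_iff_of_nonneg (mul_nonneg (Finset.sum_nonneg fun k _ => hc0 k) hN)).2
    fun k => (hc k n e).trans (mul_le_mul_of_nonneg_right ?_ hN)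
  exact Finset.single_le_sum (f := c) (fun k _ => hc0 k) (Finset.mem_univ k)

lemma exists_linearError_bound (hLC : Conditions M Θ σ θs x₀s Xs)
    (hXs : M.IsSolution θs x₀s Xs) :
    ∃ c, 0 ≤ c ∧ ∀ n e, ‖S.linearError n e‖ ≤ c * M.noiseSize n e := by
  obtain ⟨c, hc0, hc⟩ := S.exists_score_bound hLC hXs
  have hF := entrySum_nonneg S.fisher⁻¹
  refine ⟨(p + 1) * (entrySum S.fisher⁻¹ * c), by positivity, fun n e => ?_⟩
  have h1 : ‖S.linearError n e‖ ≤ (p + 1) * ‖S.fisher⁻¹ *ᵥ S.score n e‖ :=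
    norm_le_sup_norm (S.linearError n e)
  have h2 := (norm_mulVec_le S.fisher⁻¹ (S.score n e)).trans
    (mul_le_mul_of_nonneg_left (hc n e) hF)
  have h3 : (0 : ℝ) ≤ p + 1 := by positivity
  generalize entrySum S.fisher⁻¹ = f at h2 hF ⊢
  refine h1.trans ((mul_le_mul_of_nonneg_left h2 h3).trans (le_of_eq ?_))
  ring

/-- Lower bound of the quadratic expansion. -/
lemma exists_expansion_lower_bound (hLC : Conditions M Θ σ θs x₀s Xs) (hΘ : IsCompact Θ)
    (hXs : M.IsSolution θs x₀s Xs) : ∃ κ c, 0 < κ ∧ 0 ≤ c ∧ ∀ᶠ n in atTop, ∀ e h ξ u,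
      κ * (‖h‖ + (‖ξ‖ + M.l2 n u)) ^ 2
        ≤ S.quadratic n e h + S.nuisance n e ξ u
          + c * M.noiseSize n e * (‖h‖ + (‖ξ‖ + M.l2 n u)) := by
  obtain ⟨K, hK0, hK⟩ := hLC.exists_bound_A hΘ
  obtain ⟨c₁, hc₁, h₁⟩ := M.exists_pair_state_noise_bound hK0.le
  obtain ⟨c₂, hc₂, h₂⟩ := S.exists_score_bound hLC hXs
  obtain ⟨k₁, hk₁, hQ⟩ := S.exists_fisher_lower_bound hLC hΘ hXs
  obtain ⟨k₂, hk₂, hco⟩ := hLC.exists_coercive hΘ hXs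
  refine ⟨min k₁ k₂ / 2, 2 * (p * c₂ + c₁), half_pos (lt_min hk₁ hk₂), by positivity, ?_⟩
  filter_upwards [hco] with n hn e h ξ u
  have hl2 := M.l2_nonneg n u
  have hξ := norm_nonneg ξ
  have hh := norm_nonneg h
  have hN := M.noiseSize_nonneg n e
  set β := ‖ξ‖ + M.l2 n u with hβ
  have hβ0 : 0 ≤ β := by positivity
  have e1 : |(h : Fin p → ℝ) ⬝ᵥ S.score n e| ≤ p * (‖h‖ * (c₂ * M.noiseSize n e)) :=
    (abs_dotProduct_le _ _).trans (mul_le_mul_of_nonneg_left (mul_le_mul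
      ((pi_norm_le_iff_of_nonneg hh).2 fun k => PiLp.norm_apply_le h k) (h₂ n e) (norm_nonneg _) hh)
      p.cast_nonneg)
  have e2 := h₁ θs (hK θs hLC.mem) n ξ u e
  have e3 : min k₁ k₂ * ‖h‖ ^ 2 ≤ k₁ * ‖h‖ ^ 2 :=
    mul_le_mul_of_nonneg_right (min_le_left _ _) (sq_nonneg _)
  have e4 : min k₁ k₂ * β ^ 2 ≤ k₂ * β ^ 2 :=
    mul_le_mul_of_nonneg_right (min_le_right _ _) (sq_nonneg _)
  have e5 := hQ h
  have e6 := hn ξ u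
  have e7 : min k₁ k₂ / 2 * (‖h‖ + β) ^ 2 ≤ min k₁ k₂ * ‖h‖ ^ 2 + min k₁ k₂ * β ^ 2 := by
    have := mul_nonneg (lt_min hk₁ hk₂).le (sq_nonneg (‖h‖ - β))
    nlinarith
  have e8 := (abs_le.1 e1).2
  have e9 := (abs_le.1 e2).2
  have e10 : 0 ≤ p * c₂ * M.noiseSize n e * β := by positivity
  have e11 : 0 ≤ c₁ * M.noiseSize n e * ‖h‖ := by positivity
  unfold quadratic nuisance
  rw [← hβ] at e6 e9
  nlinarith

lemma nuisance_zero (n : ℕ) (e : ℕ → Fin q → ℝ) :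
    S.nuisance n e 0 (fun _ => 0) = 0 := by
  have h : ∀ i, M.discreteState n θs 0 (fun _ => (0 : Fin m → ℝ)) i = 0 := fun i => by
    have := M.discreteState_smul n θs 0 (fun _ => 0) 0 i
    simpa using this
  simp [nuisance, h, Model.pair, Model.energy]

lemma quadratic_zero (n : ℕ) (e : ℕ → Fin q → ℝ) : S.quadratic n e 0 = 0 := by
  simp [quadratic]

/-- Two comparisons with a near minimizer `(h, ξ, u)`. Against the truth, coercivity gives `‖h‖ +
‖ξ‖ + l2 u = O(n^{-1/2})`. Against `(linearError, ξ, u)` the nuisance block cancels, and the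
completed square bounds `‖h - linearError‖ ^ 2` by the expansion error, an arbitrarily small
multiple of `1 / n`. -/
lemma eventually_linearization (hLC : Conditions M Θ σ θs x₀s Xs) (hΘ : IsCompact Θ)
    (hXs : M.IsSolution θs x₀s Xs) {K₀ δ : ℝ} (hK₀ : 0 ≤ K₀) (hδ : 0 < δ) :
    ∀ᶠ n : ℕ in atTop, ∀ e, M.noiseSize n e ≤ K₀ * (1 / √(n : ℝ)) → ∀ θ ∈ Θ,
      (∀ s > 0, ∃ x u, ∀ θ' ∈ Θ, ∀ x' u',
        M.excess n Xs e θ x u ≤ M.excess n Xs e θ' x' u' + s) →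
      ‖θ - θs - S.linearError n e‖ ≤ δ * (1 / √(n : ℝ)) := by
  obtain ⟨κ, c, hκ, hc, hlow⟩ := S.exists_expansion_lower_bound hLC hΘ hXs
  obtain ⟨k₁, hk₁, hQ⟩ := S.exists_fisher_lower_bound hLC hΘ hXs
  obtain ⟨ch, hch, hlin⟩ := S.exists_linearError_bound hLC hXs
  set K₁ := 2 * (c * K₀) / κ + 2 with hK₁
  have hK₁0 : 0 ≤ K₁ := by positivity
  set Λ := (ch * K₀ + K₁ + 1) ^ 2 + 1 + (K₁ + 1) ^ 2 with hΛ
  have hΛ0 : 0 < Λ := by positivity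
  -- `ω ≤ κ / 4` lets half of the coercivity survive in the first comparison; `ω * Λ ≤ k₁ * δ ^ 2`
  -- makes the second one give exactly `δ`, the three terms of `Λ` being the two expansion errors
  -- and the tolerance of near minimization.
  obtain ⟨ω, hω, hωκ, hωΛ⟩ : ∃ ω : ℝ, 0 < ω ∧ ω ≤ κ / 4 ∧ ω * Λ ≤ k₁ * δ ^ 2 :=
    ⟨min (κ / 4) (k₁ * δ ^ 2 / Λ), lt_min (by positivity) (by positivity), min_le_left _ _,
      (le_div_iff₀ hΛ0).1 (min_le_right _ _)⟩
  obtain ⟨pa, hpa, pb, hpb, hpq⟩ := eventually_prod_iff.1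
    (S.eventually_expansion hLC hΘ hXs hK₀ hω)
  obtain ⟨r, hr, hball⟩ := Metric.eventually_nhds_iff.1 (hpb.and hLC.eventually_mem)
  obtain ⟨η, hη, hcons⟩ := hLC.exists_consistent hΘ hXs hr
  have hlim : ∀ C : ℝ, Tendsto (fun n : ℕ => C * (1 / √(n : ℝ))) atTop (𝓝 0) := fun C => by
    have := Model.tendsto_one_div_sqrt.const_mul C
    rwa [mul_zero] at this
  filter_upwards [hpa, hlow, hcons, (hlim K₀).eventually_le_const hη,
    (hlim (ch * K₀)).eventually_lt_const hr, eventually_gt_atTop 0] with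
    n hna hnlow hncons hnη hnr hn e he θ hθ hmin
  set ν := 1 / √(n : ℝ) with hν
  have hν0 : 0 < ν := by
    have : (0 : ℝ) < n := Nat.cast_pos.2 hn
    positivity
  have hexp : ∀ h : EuclideanSpace ℝ (Fin p), ‖h‖ < r → ∀ ξ u,
      |S.perturbedExcess n x₀s e h ξ u - (S.quadratic n e h + S.nuisance n e ξ u)|
        ≤ ω * (‖h‖ + (‖ξ‖ + M.l2 n u) + ν) ^ 2 ∧ θs + h ∈ Θ := fun h hh ξ u => by
    have h1 := hball (y := h) (by rwa [dist_zero_right])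
    exact ⟨hpq hna h1.1 e he ξ u, h1.2⟩
  -- Consistency brings `θ` into the ball where the local expansion is valid.
  have hθr : ‖θ - θs‖ < r := by
    obtain ⟨x, u, hxu⟩ := hmin η hη
    exact hncons e (he.trans hnη) θ hθ x u (hxu θs hLC.mem x₀s 0)
  obtain ⟨x, u', hxu⟩ := hmin (ω * ν ^ 2) (by positivity)
  obtain ⟨h, rfl⟩ : ∃ h, θ = θs + h := ⟨θ - θs, by abel⟩
  rw [add_sub_cancel_left] at hθr ⊢
  obtain ⟨ξ, rfl⟩ : ∃ ξ, x = x₀s + S.state h 0 + ξ := ⟨x - (x₀s + S.state h 0), by abel⟩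
  obtain ⟨u, rfl⟩ : ∃ u : ℕ → Fin m → ℝ, u' = fun i => S.control h (M.time n i) + u i :=
    ⟨fun i => u' i - S.control h (M.time n i), by
      funext i
      exact (add_sub_cancel _ _).symm⟩
  have hle : ∀ h', ‖h'‖ < r → ∀ ξ' u', S.perturbedExcess n x₀s e h ξ u
      ≤ S.perturbedExcess n x₀s e h' ξ' u' + ω * ν ^ 2 := fun h' hh' ξ' u' =>
    hxu _ (hexp h' hh' ξ' u').2 _ _
  have hl2 := M.l2_nonneg n u
  have hξ := norm_nonneg ξ
  have hh := norm_nonneg h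
  have hN := M.noiseSize_nonneg n e
  set β := ‖ξ‖ + M.l2 n u with hβ
  have hβ0 : 0 ≤ β := by positivity
  have hX := (abs_le.1 (hexp h hθr ξ u).1).1
  have hb : ‖h‖ + β ≤ K₁ * ν := by
    refine le_mul_of_quadratic_le hκ (mul_nonneg hc hK₀) hν0 ?_
    have h0 : ‖(0 : EuclideanSpace ℝ (Fin p))‖ < r := by rwa [norm_zero]
    have e1 := (abs_le.1 (hexp 0 h0 0 (fun _ => 0)).1).2
    have hl20 : M.l2 n (fun _ => (0 : Fin m → ℝ)) = 0 := by simp [Model.l2]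
    rw [S.quadratic_zero, S.nuisance_zero, hl20, norm_zero, norm_zero] at e1
    simp only [add_zero, zero_add, sub_zero] at e1
    have e2 := hle 0 h0 0 (fun _ => 0)
    have e3 := hnlow e h ξ u
    have e4 : c * M.noiseSize n e * (‖h‖ + β) ≤ c * (K₀ * ν) * (‖h‖ + β) := by gcongr
    have e5 : ω * (‖h‖ + β + ν) ^ 2 ≤ ω * (2 * (‖h‖ + β) ^ 2 + 2 * ν ^ 2) := by
      refine mul_le_mul_of_nonneg_left ?_ hω.le
      nlinarith [sq_nonneg (‖h‖ + β - ν)]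
    have e6 : ω * (2 * (‖h‖ + β) ^ 2 + 4 * ν ^ 2)
        ≤ κ / 4 * (2 * (‖h‖ + β) ^ 2 + 4 * ν ^ 2) := by gcongr
    linarith
  have hl : ‖S.linearError n e‖ ≤ ch * K₀ * ν := by
    refine (hlin n e).trans ?_
    rw [mul_assoc]
    gcongr
  -- Second comparison: only `h` is replaced, by `linearError`, with `ξ` and `u` kept.
  have e1 := (abs_le.1 (hexp _ (hl.trans_lt hnr) ξ u).1).2
  have e2 := hle _ (hl.trans_lt hnr) ξ u
  have e3 := S.quadratic_sub hLC hΘ hXs n e h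
  have e4 := hQ (h - S.linearError n e)
  rw [← hβ] at e1
  have e5 : ω * (‖S.linearError n e‖ + β + ν) ^ 2 ≤ ω * ((ch * K₀ + K₁ + 1) * ν) ^ 2 := by
    have : ‖S.linearError n e‖ + β + ν ≤ (ch * K₀ + K₁ + 1) * ν := by linarith
    gcongr
  have e6 : ω * (‖h‖ + β + ν) ^ 2 ≤ ω * ((K₁ + 1) * ν) ^ 2 := by
    have : ‖h‖ + β + ν ≤ (K₁ + 1) * ν := by linarith
    gcongr
  have e7 : k₁ * ‖h - S.linearError n e‖ ^ 2 ≤ k₁ * (δ * ν) ^ 2 := by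
    have e8 : ω * Λ * ν ^ 2 ≤ k₁ * δ ^ 2 * ν ^ 2 := mul_le_mul_of_nonneg_right hωΛ (sq_nonneg _)
    have e9 : ω * Λ * ν ^ 2 = ω * ((ch * K₀ + K₁ + 1) * ν) ^ 2 + ω * ν ^ 2
      + ω * ((K₁ + 1) * ν) ^ 2 := by rw [hΛ]; ring
    have e10 : ((h - S.linearError n e : EuclideanSpace ℝ (Fin p)) : Fin p → ℝ)
      = (h - S.linearError n e : Fin p → ℝ) := rfl
    rw [e10, ← e3] at e4
    have e11 : k₁ * (δ * ν) ^ 2 = k₁ * δ ^ 2 * ν ^ 2 := by ring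
    linarith
  exact (pow_le_pow_iff_left₀ (norm_nonneg _) (by positivity) two_ne_zero).1
    (le_of_mul_le_mul_left e7 hk₁)

end Sensitivity

end TrackedLinearODE

/-! ### Second moments of the cumulated noise. -/

namespace TrackedLinearODE

variable {p d q m : ℕ} {M : Model p d q m} {Ω : Type*} [MeasurableSpace Ω] {P : Measure Ω}
  {n : ℕ} {e : ℕ → Ω → EuclideanSpace ℝ (Fin q)} {σ : ℝ}

lemma posSemidef_sq_smul_one (q : ℕ) (σ : ℝ) :
    (σ ^ 2 • (1 : Matrix (Fin q) (Fin q) ℝ)).PosSemidef :=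
  Matrix.PosSemidef.one.smul (sq_nonneg σ)

lemma hasLaw_coordinate {X : Ω → EuclideanSpace ℝ (Fin q)}
    (hX : HasLaw X (multivariateGaussian 0 (σ ^ 2 • (1 : Matrix (Fin q) (Fin q) ℝ))) P)
    (j : Fin q) : HasLaw (fun ω => X ω j) (gaussianReal 0 (σ ^ 2).toNNReal) P := by
  have h := (measurePreserving_eval_multivariateGaussian (μ := 0)
    (posSemidef_sq_smul_one q σ) (i := j)).fun_comp_hasLaw hX
  simpa using h

lemma memLp_coordinate {X : Ω → EuclideanSpace ℝ (Fin q)}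
    (hX : HasLaw X (multivariateGaussian 0 (σ ^ 2 • (1 : Matrix (Fin q) (Fin q) ℝ))) P)
    (j : Fin q) : MemLp (fun ω => X ω j) 2 P := by
  have h := hasLaw_coordinate hX j
  have h2 := memLp_id_gaussianReal (μ := 0) (v := (σ ^ 2).toNNReal) 2
  rw [← h.map_eq] at h2
  exact (memLp_map_measure_iff aestronglyMeasurable_id h.aemeasurable).1 h2

variable [IsProbabilityMeasure P]

/-- The second moment of a partial sum of the noise. -/
lemma integral_sq_sum_noise
    (hlaw : ∀ i ≤ n, HasLaw (e i)
      (multivariateGaussian 0 (σ ^ 2 • (1 : Matrix (Fin q) (Fin q) ℝ))) P)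
    (hind : iIndepFun (fun i : Fin (n + 1) => e i) P) {k : ℕ} (hk : k ≤ n) (j : Fin q) :
    Integrable (fun ω => (∑ i ∈ Finset.range (k + 1), e i ω j) ^ 2) P ∧
      ∫ ω, (∑ i ∈ Finset.range (k + 1), e i ω j) ^ 2 ∂P = (k + 1) * σ ^ 2 := by
  have hle : ∀ i ∈ Finset.range (k + 1), i ≤ n := fun i hi =>
    (Nat.lt_succ_iff.1 (Finset.mem_range.1 hi)).trans hk
  have hLp : ∀ i ∈ Finset.range (k + 1), MemLp (fun ω => e i ω j) 2 P := fun i hi =>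
    memLp_coordinate (hlaw i (hle i hi)) j
  have hsum : MemLp (fun ω => ∑ i ∈ Finset.range (k + 1), e i ω j) 2 P :=
    memLp_finsetSum _ hLp
  refine ⟨hsum.integrable_sq, ?_⟩
  have hmean : ∫ ω, ∑ i ∈ Finset.range (k + 1), e i ω j ∂P = 0 := by
    rw [integral_finsetSum _ fun i hi => (hLp i hi).integrable one_le_two]
    refine Finset.sum_eq_zero fun i hi => ?_
    rw [(hasLaw_coordinate (hlaw i (hle i hi)) j).integral_eq, integral_id_gaussianReal]
  have hvar := variance_of_integral_eq_zero hsum.aemeasurable hmean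
  rw [← hvar]
  have hfun : (fun ω => ∑ i ∈ Finset.range (k + 1), e i ω j)
      = ∑ i ∈ Finset.range (k + 1), fun ω => e i ω j := by
    funext ω
    simp
  rw [hfun, IndepFun.variance_sum hLp]
  · rw [Finset.sum_congr rfl fun i hi => (hasLaw_coordinate (hlaw i (hle i hi)) j).variance_eq]
    simp only [variance_id_gaussianReal, Finset.sum_const, Finset.card_range, nsmul_eq_mul,
      Real.coe_toNNReal _ (sq_nonneg σ)]
    push_cast
    ring
  · intro a ha b hb hab
    have h1 := hind.indepFun (i := ⟨a, Nat.lt_succ_iff.2 (hle a ha)⟩)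
      (j := ⟨b, Nat.lt_succ_iff.2 (hle b hb)⟩) (by simpa using hab)
    exact h1.comp (φ := fun x : EuclideanSpace ℝ (Fin q) => x j)
      (ψ := fun x : EuclideanSpace ℝ (Fin q) => x j) (by fun_prop) (by fun_prop)

lemma sq_norm_le_sum_sq {a : ℕ} (v : Fin a → ℝ) : ‖v‖ ^ 2 ≤ ∑ j, v j ^ 2 := by
  refine (sq_norm_le_dotProduct v).trans (le_of_eq ?_)
  exact Finset.sum_congr rfl fun j _ => (pow_two _).symm

/-- The sum of squares which dominates the size of the cumulated noise. -/
noncomputable def Model.noiseEnergy (M : Model p d q m) (n : ℕ) (e : ℕ → Fin q → ℝ) : ℝ :=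
  M.mesh n ^ 2 * (∑ j, (∑ i ∈ Finset.range (n + 1), e i j) ^ 2
    + ∑ k ∈ Finset.range n, M.mesh n * ∑ j, (∑ i ∈ Finset.range (k + 1), e i j) ^ 2)

lemma Model.sq_noiseSize_le (M : Model p d q m) (n : ℕ) (e : ℕ → Fin q → ℝ) :
    M.noiseSize n e ^ 2 ≤ M.noiseEnergy n e := by
  have hm := M.mesh_nonneg n
  have h : ∀ k, ‖M.noisePath n e k‖ ^ 2
      ≤ M.mesh n ^ 2 * ∑ j, (∑ i ∈ Finset.range (k + 1), e i j) ^ 2 := fun k => by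
    refine (sq_norm_le_sum_sq _).trans (le_of_eq ?_)
    rw [Finset.mul_sum]
    refine Finset.sum_congr rfl fun j _ => ?_
    simp only [noisePath, Pi.smul_apply, Finset.sum_apply, smul_eq_mul, mul_pow]
  rw [noiseSize, Real.sq_sqrt (by positivity), noiseEnergy, mul_add]
  refine add_le_add (h n) ?_
  rw [Finset.mul_sum (Finset.range n)]
  refine Finset.sum_le_sum fun k _ => ?_
  rw [mul_left_comm]
  exact mul_le_mul_of_nonneg_left (h k) hm

/-- Each coordinate of a partial sum has second moment at most `2 * n * σ ^ 2`, and the prefactor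
`mesh ^ 2` turns this into order `1 / n`. -/
lemma integral_noiseEnergy_le (M : Model p d q m) (hn : 0 < n)
    (hlaw : ∀ i ≤ n, HasLaw (e i)
      (multivariateGaussian 0 (σ ^ 2 • (1 : Matrix (Fin q) (Fin q) ℝ))) P)
    (hind : iIndepFun (fun i : Fin (n + 1) => e i) P) :
    Integrable (fun ω => M.noiseEnergy n (fun i => e i ω)) P ∧
      ∫ ω, M.noiseEnergy n (fun i => e i ω) ∂P
        ≤ 2 * M.T ^ 2 * (q * σ ^ 2) * (1 + M.T) * (1 / √(n : ℝ)) ^ 2 := by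
  have hm := M.mesh_nonneg n
  have hTp := M.T_pos
  have hI : ∀ k ≤ n, Integrable (fun ω => ∑ j, (∑ i ∈ Finset.range (k + 1), e i ω j) ^ 2) P :=
    fun k hk => integrable_finsetSum _ fun j _ => (integral_sq_sum_noise hlaw hind hk j).1
  have hv : ∀ k ≤ n, ∫ ω, ∑ j, (∑ i ∈ Finset.range (k + 1), e i ω j) ^ 2 ∂P
      ≤ q * (2 * n * σ ^ 2) := fun k hk => by
    rw [integral_finsetSum _ fun j _ => (integral_sq_sum_noise hlaw hind hk j).1,
      Finset.sum_congr rfl fun j _ => (integral_sq_sum_noise hlaw hind hk j).2, Finset.sum_const,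
      Finset.card_univ, Fintype.card_fin, nsmul_eq_mul]
    have h1 : (k : ℝ) + 1 ≤ 2 * n := by
      have h2 : (k : ℝ) ≤ n := Nat.cast_le.2 hk
      have h3 : (1 : ℝ) ≤ n := Nat.one_le_cast.2 hn
      linarith
    gcongr
  have hI2 : Integrable (fun ω => ∑ k ∈ Finset.range n,
      M.mesh n * ∑ j, (∑ i ∈ Finset.range (k + 1), e i ω j) ^ 2) P :=
    integrable_finsetSum _ fun k hk => (hI k (Finset.mem_range.1 hk).le).const_mul _
  refine ⟨((hI n le_rfl).add hI2).const_mul _, ?_⟩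
  unfold Model.noiseEnergy
  rw [integral_const_mul, integral_add (hI n le_rfl) hI2,
    integral_finsetSum _ fun k hk => (hI k (Finset.mem_range.1 hk).le).const_mul _]
  have h2 : ∑ k ∈ Finset.range n, ∫ ω, M.mesh n * ∑ j, (∑ i ∈ Finset.range (k + 1), e i ω j) ^ 2 ∂P
      ≤ M.T * (q * (2 * n * σ ^ 2)) := by
    refine le_trans (Finset.sum_le_sum fun k hk => ?_) (M.sum_mesh_le n _ (by positivity))
    rw [integral_const_mul]
    exact mul_le_mul_of_nonneg_left (hv k (Finset.mem_range.1 hk).le) hm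
  refine (mul_le_mul_of_nonneg_left (add_le_add (hv n le_rfl) h2) (sq_nonneg _)).trans
    (le_of_eq ?_)
  have hn0 : (n : ℝ) ≠ 0 := Nat.cast_ne_zero.2 hn.ne'
  rw [div_pow, Real.sq_sqrt n.cast_nonneg, Model.mesh]
  field_simp

/-- The size of the cumulated noise is of order `n^{-1/2}` in probability. -/
lemma measureReal_noiseSize_gt_le (M : Model p d q m) (hn : 0 < n)
    (hlaw : ∀ i ≤ n, HasLaw (e i)
      (multivariateGaussian 0 (σ ^ 2 • (1 : Matrix (Fin q) (Fin q) ℝ))) P)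
    (hind : iIndepFun (fun i : Fin (n + 1) => e i) P) {K : ℝ} (hK : 0 < K) :
    P.real {ω | K * (1 / √(n : ℝ)) < M.noiseSize n (fun i => e i ω)}
      ≤ 2 * M.T ^ 2 * (q * σ ^ 2) * (1 + M.T) / K ^ 2 := by
  obtain ⟨hint, hle⟩ := integral_noiseEnergy_le M hn hlaw hind
  have hν : 0 < 1 / √(n : ℝ) := by
    have : (0 : ℝ) < n := Nat.cast_pos.2 hn
    positivity
  have hnn : 0 ≤ᵐ[P] fun ω => M.noiseEnergy n (fun i => e i ω) := Eventually.of_forall fun ω =>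
    (sq_nonneg _).trans (M.sq_noiseSize_le n _)
  -- Markov's inequality for the square of the threshold.
  have h1 := (mul_meas_ge_le_integral_of_nonneg hnn hint ((K * (1 / √(n : ℝ))) ^ 2)).trans hle
  have h2 : P.real {ω | K * (1 / √(n : ℝ)) < M.noiseSize n (fun i => e i ω)}
      ≤ P.real {ω | (K * (1 / √(n : ℝ))) ^ 2 ≤ M.noiseEnergy n (fun i => e i ω)} := by
    refine measureReal_mono fun ω hω => ?_
    have hω' : K * (1 / √(n : ℝ)) < M.noiseSize n (fun i => e i ω) := hω
    exact (pow_le_pow_left₀ (by positivity) hω'.le 2).trans (M.sq_noiseSize_le n _)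
  rw [le_div_iff₀ (by positivity)]
  generalize P.real {ω | (K * (1 / √(n : ℝ))) ^ 2 ≤ M.noiseEnergy n (fun i => e i ω)} = x at h1 h2
  refine (mul_le_mul_of_nonneg_right h2 (sq_nonneg K)).trans
    (le_of_mul_le_mul_right (a := (1 / √(n : ℝ)) ^ 2) ?_ (by positivity))
  linarith [show x * K ^ 2 * (1 / √(n : ℝ)) ^ 2 = (K * (1 / √(n : ℝ))) ^ 2 * x by ring]

end TrackedLinearODE

/-! ### Characteristic functions and the limit law. -/

namespace TrackedLinearODE

section CharFun

variable {q : ℕ} {Ω : Type*} [MeasurableSpace Ω] {P : Measure Ω}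

/-- The characteristic function of a linear statistic of independent Gaussian vectors. -/
lemma integral_exp_sum_inner {n : ℕ} {e : ℕ → Ω → EuclideanSpace ℝ (Fin q)} {σ : ℝ}
    (hlaw : ∀ i ≤ n, HasLaw (e i)
      (multivariateGaussian 0 (σ ^ 2 • (1 : Matrix (Fin q) (Fin q) ℝ))) P)
    (hind : iIndepFun (fun i : Fin (n + 1) => e i) P) (v : ℕ → Fin q → ℝ) :
    ∫ ω, Complex.exp (((∑ i ∈ Finset.range (n + 1), v i ⬝ᵥ (e i ω : Fin q → ℝ) : ℝ) : ℂ)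
        * Complex.I) ∂P
      = Complex.exp (((-(σ ^ 2 * ∑ i ∈ Finset.range (n + 1), v i ⬝ᵥ v i) / 2 : ℝ) : ℂ)) := by
  set X : Fin (n + 1) → Ω → ℝ := fun i ω => v i ⬝ᵥ (e i ω : Fin q → ℝ) with hX
  have hle : ∀ i : Fin (n + 1), (i : ℕ) ≤ n := fun i => Nat.lt_succ_iff.1 i.2
  have hmeas : ∀ w : Fin q → ℝ, Measurable fun x : EuclideanSpace ℝ (Fin q) =>
      w ⬝ᵥ (x : Fin q → ℝ) := fun w => by
    unfold dotProduct
    fun_prop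
  have hXm : ∀ i, AEMeasurable (X i) P := fun i =>
    (hmeas (v i)).comp_aemeasurable (hlaw i (hle i)).aemeasurable
  have hXind : iIndepFun X P := hind.comp (fun i x => v i ⬝ᵥ (x : Fin q → ℝ)) fun i => hmeas (v i)
  have h1 := congrFun (hXind.charFun_map_fun_sum_eq_prod hXm) 1
  rw [Finset.prod_apply, charFun_apply_real, integral_map (by fun_prop) (by fun_prop)] at h1
  have h2 : ∀ i, charFun (P.map (X i)) 1
      = Complex.exp (((-(σ ^ 2 * (v i ⬝ᵥ v i)) / 2 : ℝ) : ℂ)) := fun i => by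
    have h3 : charFun (P.map (X i)) 1 = charFun (P.map (e i)) (WithLp.toLp 2 (v i)) := by
      rw [charFun_apply_real, charFun_apply, integral_map (hXm i) (by fun_prop),
        integral_map (hlaw i (hle i)).aemeasurable (by fun_prop)]
      refine integral_congr_ae (Eventually.of_forall fun ω => ?_)
      simp only [hX, Complex.ofReal_one, one_mul, EuclideanSpace.inner_eq_star_dotProduct,
        star_trivial]
    rw [h3, (hlaw i (hle i)).map_eq, charFun_multivariateGaussian (posSemidef_sq_smul_one q σ)]
    simp only [inner_zero_right, Matrix.smul_mulVec, Matrix.one_mulVec, dotProduct_smul,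
      smul_eq_mul]
    congr 1
    push_cast
    ring
  rw [Finset.prod_congr rfl fun i _ => h2 i, ← Complex.exp_sum, ← Complex.ofReal_sum] at h1
  have h4 : ∀ ω, ∑ i ∈ Finset.range (n + 1), v i ⬝ᵥ (e i ω : Fin q → ℝ) = ∑ i, X i ω := fun ω =>
    Finset.sum_range fun i => v i ⬝ᵥ (e i ω : Fin q → ℝ)
  have h5 : -(σ ^ 2 * ∑ i ∈ Finset.range (n + 1), v i ⬝ᵥ v i) / 2
      = ∑ i : Fin (n + 1), -(σ ^ 2 * (v i ⬝ᵥ v i)) / 2 := by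
    rw [Finset.sum_range fun i => v i ⬝ᵥ v i, Finset.mul_sum, ← Finset.sum_neg_distrib,
      Finset.sum_div]
  rw [h5, ← h1]
  refine integral_congr_ae (Eventually.of_forall fun ω => ?_)
  simp only [h4, Complex.ofReal_one, one_mul]

end CharFun

variable {p d q m : ℕ} {M : Model p d q m} {Θ : Set (EuclideanSpace ℝ (Fin p))} {σ : ℝ}
  {θs : EuclideanSpace ℝ (Fin p)} {x₀s : Fin d → ℝ} {Xs : ℝ → Fin d → ℝ}

namespace Sensitivity

variable (S : Sensitivity M θs Xs)

/-- The asymptotic covariance matrix of the estimator. -/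
noncomputable def covariance (σ : ℝ) : Matrix (Fin p) (Fin p) ℝ :=
  (M.T * σ ^ 2) • (S.fisher⁻¹ * S.gram * S.fisher⁻¹)

lemma gram_symm : S.gramᵀ = S.gram := by
  ext k l
  simp only [gram, Matrix.transpose_apply, Matrix.of_apply]
  congr 1
  funext t
  rw [dotProduct_comm]

lemma fisher_inv_symm : (S.fisher⁻¹)ᵀ = S.fisher⁻¹ := by
  rw [Matrix.transpose_nonsing_inv, S.fisher_symm]

lemma dotProduct_covariance (σ : ℝ) (t : Fin p → ℝ) : t ⬝ᵥ (S.covariance σ *ᵥ t)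
    = M.T * σ ^ 2 * ((S.fisher⁻¹ *ᵥ t) ⬝ᵥ (S.gram *ᵥ (S.fisher⁻¹ *ᵥ t))) := by
  rw [covariance, Matrix.smul_mulVec, dotProduct_smul, smul_eq_mul, ← Matrix.mulVec_mulVec,
    ← Matrix.mulVec_mulVec, ← transpose_mulVec_dotProduct, S.fisher_inv_symm]

lemma covariance_posDef (hLC : Conditions M Θ σ θs x₀s Xs) (hΘ : IsCompact Θ)
    (hXs : M.IsSolution θs x₀s Xs) (hσ : 0 < σ) : (S.covariance σ).PosDef := by
  refine Matrix.PosDef.of_dotProduct_mulVec_pos ?_ fun t ht => ?_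
  · rw [Matrix.IsHermitian, Matrix.conjTranspose_eq_transpose_of_trivial, covariance,
      Matrix.transpose_smul, Matrix.transpose_mul, Matrix.transpose_mul, S.fisher_inv_symm,
      S.gram_symm, Matrix.mul_assoc]
  · rw [star_trivial, S.dotProduct_covariance]
    refine mul_pos (mul_pos M.T_pos (by positivity)) (hLC.gram_pos hΘ hXs S _ fun h0 => ht ?_)
    have hu : IsUnit S.fisher.det := (S.fisher_posDef hLC hΘ hXs).det_pos.ne'.isUnit
    have h1 : S.fisher *ᵥ (S.fisher⁻¹ *ᵥ t) = t := by
      rw [Matrix.mulVec_mulVec, Matrix.mul_nonsing_inv _ hu, Matrix.one_mulVec]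
    rw [← h1, h0, Matrix.mulVec_zero]

variable {Ω : Type*} [MeasurableSpace Ω] {P : Measure Ω}

lemma aemeasurable_linearError {n : ℕ} {e : ℕ → Ω → EuclideanSpace ℝ (Fin q)}
    (he : ∀ i ≤ n, AEMeasurable (e i) P) :
    AEMeasurable (fun ω => S.linearError n (fun i => e i ω)) P := by
  have hs : AEMeasurable (fun ω => S.score n (fun i => e i ω)) P := by
    refine aemeasurable_pi_iff.2 fun k => ?_
    unfold score Model.pair
    refine Finset.aemeasurable_fun_sum _ fun i hi => AEMeasurable.const_mul ?_ _
    have h1 := he i (Nat.lt_succ_iff.1 (Finset.mem_range.1 hi))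
    unfold dotProduct
    fun_prop
  have hc : Continuous fun v : Fin p → ℝ => WithLp.toLp 2 (S.fisher⁻¹ *ᵥ v) := by fun_prop
  exact hc.measurable.comp_aemeasurable hs

/-- Since `fisher⁻¹` is symmetric, it moves onto `t`; the projection is then a linear form in the
noise with deterministic weights, as `integral_exp_sum_inner` requires. -/
lemma inner_linearError (n : ℕ) (e : ℕ → Fin q → ℝ) (t : EuclideanSpace ℝ (Fin p)) :
    inner ℝ (√(n : ℝ) • S.linearError n e) t = ∑ i ∈ Finset.range (n + 1),
      ((√(n : ℝ) * M.mesh n) • (M.C *ᵥ S.state (WithLp.toLp 2 (S.fisher⁻¹ *ᵥ t)) (M.time n i)))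
        ⬝ᵥ e i := by
  have h1 := S.pair_state_eq_score n (WithLp.toLp 2 (S.fisher⁻¹ *ᵥ t)) e
  have h2 : inner ℝ (S.linearError n e) t
      = (S.fisher⁻¹ *ᵥ (t : Fin p → ℝ)) ⬝ᵥ S.score n e := by
    rw [EuclideanSpace.inner_eq_star_dotProduct, star_trivial, linearError,
      ← transpose_mulVec_dotProduct, S.fisher_inv_symm]
  rw [real_inner_smul_left, h2]
  have h3 : (WithLp.toLp 2 (S.fisher⁻¹ *ᵥ (t : Fin p → ℝ)) : EuclideanSpace ℝ (Fin p)).ofLp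
    = S.fisher⁻¹ *ᵥ (t : Fin p → ℝ) := rfl
  rw [h3] at h1
  rw [← h1, Model.pair, Finset.mul_sum]
  refine Finset.sum_congr rfl fun i _ => ?_
  rw [smul_dotProduct, smul_eq_mul, mul_assoc]

/-- The squared weight `n * mesh ^ 2` equals `T * mesh`, so the sum is `T` times a Riemann sum for
`gram`. -/
lemma tendsto_variance (t : EuclideanSpace ℝ (Fin p)) :
    Tendsto (fun n : ℕ => ∑ i ∈ Finset.range (n + 1),
      ((√(n : ℝ) * M.mesh n) • (M.C *ᵥ S.state t (M.time n i)))
        ⬝ᵥ ((√(n : ℝ) * M.mesh n) • (M.C *ᵥ S.state t (M.time n i)))) atTop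
      (𝓝 (M.T * ((t : Fin p → ℝ) ⬝ᵥ (S.gram *ᵥ t)))) := by
  have hc : ContinuousOn (fun r => (M.C *ᵥ S.state t r) ⬝ᵥ (M.C *ᵥ S.state t r)) (Icc 0 M.T) :=
    ContinuousOn.dotProd (ContinuousOn.const_mulVec _ (S.continuousOn_state t))
      (ContinuousOn.const_mulVec _ (S.continuousOn_state t))
  have h := (M.tendsto_riemann_sum_succ hc).const_mul M.T
  rw [← S.gram_quadratic] at h
  refine h.congr' ?_
  filter_upwards [eventually_gt_atTop 0] with n hn
  rw [Finset.mul_sum]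
  refine Finset.sum_congr rfl fun i _ => ?_
  rw [smul_dotProduct, dotProduct_smul, smul_eq_mul, smul_eq_mul, ← M.natCast_mul_mesh hn]
  have := Real.mul_self_sqrt (Nat.cast_nonneg (α := ℝ) n)
  linear_combination (-(M.mesh n * M.mesh n
    * ((M.C *ᵥ S.state t (M.time n i)) ⬝ᵥ (M.C *ᵥ S.state t (M.time n i))))) * this

variable [IsProbabilityMeasure P]

/-- The characteristic function is explicit for every `n`, so only the convergence of the variances
and Lévy's continuity theorem are needed. -/
lemma tendstoInDistribution_linearError (hLC : Conditions M Θ σ θs x₀s Xs) (hΘ : IsCompact Θ)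
    (hXs : M.IsSolution θs x₀s Xs) (hσ : 0 < σ) {e : ℕ → ℕ → Ω → EuclideanSpace ℝ (Fin q)}
    (hlaw : ∀ n, ∀ i ≤ n, HasLaw (e n i)
      (multivariateGaussian 0 (σ ^ 2 • (1 : Matrix (Fin q) (Fin q) ℝ))) P)
    (hind : ∀ n, iIndepFun (fun i : Fin (n + 1) => e n i) P) :
    TendstoInDistribution (fun (n : ℕ) ω => √(n : ℝ) • S.linearError n (fun i => e n i ω)) atTop id
      (fun _ => P) (multivariateGaussian 0 (S.covariance σ)) := by
  have hmeas : ∀ n : ℕ, AEMeasurable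
      (fun ω => √(n : ℝ) • S.linearError n (fun i => e n i ω)) P := fun n =>
    (S.aemeasurable_linearError fun i hi => (hlaw n i hi).aemeasurable).const_smul (√(n : ℝ))
  refine ⟨hmeas, aemeasurable_id, ?_⟩
  refine ProbabilityMeasure.tendsto_of_tendsto_charFun fun t => ?_
  simp only [ProbabilityMeasure.coe_mk, Measure.map_id]
  rw [charFun_multivariateGaussian (S.covariance_posDef hLC hΘ hXs hσ).posSemidef]
  set g : EuclideanSpace ℝ (Fin p) := WithLp.toLp 2 (S.fisher⁻¹ *ᵥ t) with hg
  have h1 : ∀ n : ℕ, charFun (P.map fun ω => √(n : ℝ) • S.linearError n (fun i => e n i ω)) t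
      = Complex.exp (((-(σ ^ 2 * ∑ i ∈ Finset.range (n + 1),
        ((√(n : ℝ) * M.mesh n) • (M.C *ᵥ S.state g (M.time n i)))
        ⬝ᵥ ((√(n : ℝ) * M.mesh n) • (M.C *ᵥ S.state g (M.time n i)))) / 2 : ℝ) : ℂ)) := fun n => by
    rw [charFun_apply, integral_map (hmeas n) (by fun_prop),
      ← integral_exp_sum_inner (hlaw n) (hind n)]
    simp only [S.inner_linearError n, ← hg]
  simp only [h1]
  have h2 : (inner ℝ t 0 : ℝ) * Complex.I - ((t : Fin p → ℝ) ⬝ᵥ (S.covariance σ *ᵥ t) : ℝ) / 2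
      = ((-(σ ^ 2 * (M.T * ((g : Fin p → ℝ) ⬝ᵥ (S.gram *ᵥ g)))) / 2 : ℝ) : ℂ) := by
    rw [S.dotProduct_covariance, inner_zero_right]
    push_cast
    ring
  have h3 := (((S.tendsto_variance g).const_mul (σ ^ 2)).neg.div_const 2)
  have h4 := (Complex.continuous_exp.tendsto _).comp ((Complex.continuous_ofReal.tendsto _).comp h3)
  rw [h2]
  exact h4

/-- Up to an event of small probability, the noise is of order `n^{-1/2}` and the estimator is
close to its linearization. -/
lemma eventually_close_in_probability (hLC : Conditions M Θ σ θs x₀s Xs) (hΘ : IsCompact Θ)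
    (hXs : M.IsSolution θs x₀s Xs) {e : ℕ → ℕ → Ω → EuclideanSpace ℝ (Fin q)}
    (hlaw : ∀ n, ∀ i ≤ n, HasLaw (e n i)
      (multivariateGaussian 0 (σ ^ 2 • (1 : Matrix (Fin q) (Fin q) ℝ))) P)
    (hind : ∀ n, iIndepFun (fun i : Fin (n + 1) => e n i) P)
    {θhat : ℕ → Ω → EuclideanSpace ℝ (Fin p)}
    (hargmin : ∀ᶠ n in atTop, ∀ᵐ ω ∂P, θhat n ω ∈ Θ ∧
      IsMinOn (M.discreteProfileCI n (observations M n Xs (fun i => e n i ω))) Θ (θhat n ω))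
    {η : ℝ} (hη : 0 < η) : ∃ K : ℝ, 0 ≤ K ∧ ∀ δ : ℝ, 0 < δ → ∀ᶠ n : ℕ in atTop,
      P.real {ω | ¬ (M.noiseSize n (fun i => e n i ω) ≤ K * (1 / √(n : ℝ)) ∧
        ‖θhat n ω - θs - S.linearError n (fun i => e n i ω)‖ ≤ δ * (1 / √(n : ℝ)))} ≤ η := by
  have hTp := M.T_pos
  set A := 2 * M.T ^ 2 * (q * σ ^ 2) * (1 + M.T) with hA
  have hA0 : 0 ≤ A := by positivity
  -- `K` comes from the Markov bound on `noiseSize` and is fixed before `δ`: shrinking `δ` only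
  -- costs a larger `n`.
  obtain ⟨K, hK, hKη⟩ : ∃ K : ℝ, 0 < K ∧ A / K ^ 2 ≤ η := by
    refine ⟨√(A / η) + 1, by positivity, ?_⟩
    rw [div_le_iff₀ (by positivity), mul_comm, ← div_le_iff₀ hη]
    calc A / η = √(A / η) ^ 2 := (Real.sq_sqrt (by positivity)).symm
      _ ≤ _ := by
        have := Real.sqrt_nonneg (A / η)
        gcongr
        linarith
  refine ⟨K, hK.le, fun δ hδ => ?_⟩
  filter_upwards [S.eventually_linearization hLC hΘ hXs hK.le hδ, hargmin,
    eventually_gt_atTop 0] with n hlin hmin hn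
  refine le_trans ?_ ((measureReal_noiseSize_gt_le M hn (hlaw n) (hind n) hK).trans hKη)
  have hae : {ω | ¬ (M.noiseSize n (fun i => e n i ω) ≤ K * (1 / √(n : ℝ)) ∧
        ‖θhat n ω - θs - S.linearError n (fun i => e n i ω)‖ ≤ δ * (1 / √(n : ℝ)))}
      ≤ᵐ[P] {ω | K * (1 / √(n : ℝ)) < M.noiseSize n (fun i => e n i ω)} := by
    filter_upwards [hmin] with ω hω hbad
    refine lt_of_not_ge fun hsmall => hbad ⟨hsmall, ?_⟩
    exact hlin _ hsmall _ hω.1 fun s hs => M.exists_near_minimizer hω.2 hs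
  exact ENNReal.toReal_mono (measure_ne_top _ _) (measure_mono_ae hae)

end Sensitivity

end TrackedLinearODE

/-! ### Transfer of the limit law and of tightness from the linearization to the estimator. -/

theorem mainTheorem3 {p d q m : ℕ} (M : TrackedLinearODE.Model p d q m)
    (Θ : Set (EuclideanSpace ℝ (Fin p))) (hΘ : IsCompact Θ)
    (σ : ℝ) (hσ : 0 < σ)
    (θs : EuclideanSpace ℝ (Fin p)) (x₀s : Fin d → ℝ) (Xs : ℝ → Fin d → ℝ)
    (hXs : M.IsSolution θs x₀s Xs)
    (hLC : TrackedLinearODE.Conditions M Θ σ θs x₀s Xs) :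
    ∃ V : Matrix (Fin p) (Fin p) ℝ, V.PosDef ∧
      ∀ (Ω : Type*) [MeasurableSpace Ω] (P : Measure Ω) [IsProbabilityMeasure P]
        (ε : ℕ → ℕ → Ω → EuclideanSpace ℝ (Fin q))
        (_hε_law : ∀ n, ∀ i ≤ n, HasLaw (ε n i)
          (multivariateGaussian 0 (σ ^ 2 • (1 : Matrix (Fin q) (Fin q) ℝ))) P)
        (_hε_indep : ∀ n, iIndepFun (fun i : Fin (n + 1) => ε n i) P)
        (θhat : ℕ → Ω → EuclideanSpace ℝ (Fin p))
        (_hθhat_meas : ∀ n, AEMeasurable (θhat n) P)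
        (_hθhat_argmin : ∀ᶠ n in atTop, ∀ᵐ ω ∂P, θhat n ω ∈ Θ ∧
          IsMinOn (M.discreteProfileCI n
            (TrackedLinearODE.observations M n Xs (fun i => ε n i ω))) Θ (θhat n ω)),
        TendstoInDistribution (fun (n : ℕ) ω => √(n : ℝ) • (θhat n ω - θs)) atTop id
          (fun _ => P) (multivariateGaussian 0 V) ∧
        TrackedLinearODE.IsBigOInProbability P (fun n ω => θhat n ω - θs)
          (fun n => 1 / √(n : ℝ)) := by 
  obtain ⟨S⟩ := hLC.nonempty_sensitivity hXs
  refine ⟨S.covariance σ, S.covariance_posDef hLC hΘ hXs hσ, fun Ω _ P _ ε hlaw hind θhat hmeas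
    hargmin => ⟨?_, fun η hη => ?_⟩⟩
  -- Slutsky: it remains to see that `√n (θhat - θs - linearError)` tends to `0` in probability.
  · refine tendstoInDistribution_of_tendstoInMeasure_sub _ _
      (S.tendstoInDistribution_linearError hLC hΘ hXs hσ hlaw hind) ?_
      fun n => ((hmeas n).sub_const θs).const_smul (√(n : ℝ))
    refine tendstoInMeasure_iff_measureReal_norm.2 fun δ hδ => Metric.tendsto_nhds.2 fun η hη => ?_
    obtain ⟨K, -, hK⟩ := S.eventually_close_in_probability hLC hΘ hXs hlaw hind hargmin
      (half_pos hη)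
    filter_upwards [hK (δ / 2) (half_pos hδ), eventually_gt_atTop 0] with n hn hn0
    rw [Real.dist_eq, sub_zero, abs_of_nonneg measureReal_nonneg]
    refine lt_of_le_of_lt ((measureReal_mono fun ω hω hgood => ?_).trans hn) (half_lt_self hη)
    have hsqrt : 0 < √(n : ℝ) := Real.sqrt_pos.2 (Nat.cast_pos.2 hn0)
    have hω' : δ ≤ ‖√(n : ℝ) • (θhat n ω - θs)
        - √(n : ℝ) • S.linearError n (fun i => ε n i ω) - 0‖ := hω
    rw [sub_zero, ← smul_sub, norm_smul, Real.norm_of_nonneg hsqrt.le] at hω'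
    have h1 := mul_le_mul_of_nonneg_left hgood.2 hsqrt.le
    have h2 : √(n : ℝ) * (δ / 2 * (1 / √(n : ℝ))) = δ / 2 := by field_simp
    linarith
  · obtain ⟨c, hc, hlin⟩ := S.exists_linearError_bound hLC hXs
    obtain ⟨K, hK0, hK⟩ := S.eventually_close_in_probability hLC hΘ hXs hlaw hind hargmin hη
    -- `c * K` bounds the linearized error on the good event, and `1` is the value of `δ` used for
    -- the linearization gap.
    refine ⟨c * K + 1, ?_⟩
    filter_upwards [hK 1 one_pos] with n hn
    refine (measureReal_mono fun ω hω hgood => ?_).trans hn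
    have hω' : (c * K + 1) * (1 / √(n : ℝ)) < ‖θhat n ω - θs‖ := hω
    have h1 := (hlin n fun i => ε n i ω).trans (mul_le_mul_of_nonneg_left hgood.1 hc)
    have h2 := norm_add_le (θhat n ω - θs - S.linearError n (fun i => ε n i ω))
      (S.linearError n (fun i => ε n i ω))
    rw [sub_add_cancel] at h2
    linarith [hgood.2]
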